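/- Let $\mathbb k$ be an algebraically closed field of characteristic zero, and let $\mathfrak g=\mathfrak{gl}(m,n)$ be the Lie superalgebra of $(m+n)\times(m+n)$ matrices over $\mathbb k$, with matrix units $e_{i,j}$, where the indices $1,\dots,m$ are even and $m+1,\dots,m+n$ are odd. Let $\mathfrak h$, $\mathfrak n^+$, $\mathfrak n^-$ be the diagonal, strictly upper triangular and strictly lower triangular matrices. Let $\epsilon_1,\dots,\epsilon_m,\delta_1,\dots,\delta_n$ be the basis of $\mathfrak h^*$ dual to $e_{1,1},\dots,e_{m+n,m+n}$, with the form $(\epsilon_i,\epsilon_j)=\delta_{ij}$, $(\delta_i,\delta_j)=-\delta_{ij}$, $(\epsilon_i,\delta_j)=0$. Let $\Delta^+=\Delta^+_0\cup\Delta^+_1$ be the set of roots of $\mathfrak n^+$, divided into even and odd roots, put $\rho=\frac12\sum_{\alpha\in\Delta_0^+}\alpha-\frac12\sum_{\alpha\in\Delta_1^+}\alpha$, write $\alpha^\vee=2\alpha/(\alpha,\alpha)$ for non-isotropic roots $\alpha$, and let $h_\alpha\in\mathfrak h$ be defined by $\beta(h_\alpha)=(\alpha,\beta)$ for all $\beta\in\mathfrak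 h^*$. For $\alpha\in\Delta^+$ let $e_{-\alpha}$ be the matrix unit of weight $-\alpha$ and let $e_\alpha\in\mathfrak g^\alpha$ be such that $[e_\alpha,e_{-\alpha}]=h_\alpha$. Let $1\le r\le m$, $1\le s\le n$, and $\gamma=\epsilon_r-\delta_s$. A partition of $\gamma$ is a map $\pi:\Delta^+\to\mathbb N$ with $\sum_\alpha\pi(\alpha)\alpha=\gamma$ and $\pi(\alpha)\le1$ for isotropic $\alpha$; let $\pi^0$ be the unique partition of $\gamma$ supported on the simple roots. Fix a total ordering of $\Delta^+$ and put $e_{-\pi}=\prod_{\alpha}e_{-\alpha}^{\pi(\alpha)}$, the product being taken in this order. A Šapovalov element for $\gamma$ is an element $\theta_\gamma=\sum_\pi e_{-\pi}H_\pi$ (sum over the partitions of $\gamma$) with $H_\pi\in U(\mathfrak h)=S(\mathfrak h)$, $H_{\pi^0}=1$ and $$e_\alpha\theta_\gamma\in U(\mathfrak g)\big(h_\gamma+\rho(h_\gamma)-\tfrac12(\gamma,\gamma)\big)+U(\mathfrak g)\mathfrak n^+\qquad\text{for all }\alpha\in\Delta^+ .$$ Its value at $\lambda\in\mathfrak h^*$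 is $\theta_\gamma(\lambda)=\sum_\pi H_\pi(\lambda)e_{-\pi}\in U(\mathfrak n^-)$. Put $\mathcal H_\gamma=\{\lambda\in\mathfrak h^*\mid(\lambda+\rho,\gamma)=\frac12(\gamma,\gamma)\}$; here $(\gamma,\gamma)=0$. For a square matrix $B=(b_{i,j})$ of size $l$ with entries in a ring put $$\overrightarrow{\det}(B)=\sum_{w\in S_l}\operatorname{sign}(w)\,b_{w(1),1}\cdots b_{w(l),l},\qquad \overleftarrow{\det}(B)=\sum_{w\in S_l}\operatorname{sign}(w)\,b_{w(l),l}\cdots b_{w(1),1},$$ both equal to $1$ if $l=0$. Write ${}_iB$ for the matrix obtained from $B$ by deleting row $i$. For $\lambda\in\mathfrak h^*$ put $a_j=(\lambda+\rho,(\epsilon_r-\epsilon_{r+j})^\vee)$ for $1\le j\le m-r$ and $b_i=(\lambda+\rho,(\delta_i-\delta_s)^\vee)$ for $1\le i\le s-1$. Let $A^+(\lambda,r)$ be the $(m-r+1)\times(m-r)$ matrix whose $(i,l)$ entry is $e_{r+l,r+i-1}$ if $i\le l$, $-a_l$ if $i=l+1$, and $0$ if $i>l+1$. Let $A^-(\lambda,s)$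 be the $s\times(s-1)$ matrix whose $(i,l)$ entry is $e_{m+i,m+l}$ if $i>l$, $b_l$ if $i=l$, and $0$ if $i<l$. Let $B^+(\lambda,r)$ and $B^-(\lambda,s)$ be obtained from $A^+(\lambda,r)$ and $A^-(\lambda,s)$ by replacing each $a_j$ by $a_j-1$ and each $b_i$ by $b_i-1$, respectively. **Theorem.** A Šapovalov element for $\gamma$ exists, and for every Šapovalov element $\theta_\gamma$ for $\gamma$ and every $\lambda\in\mathcal H_\gamma$, $$\theta_\gamma(\lambda)=(-1)^{m+r}\sum_{j=1}^{m-r+1}\sum_{i=1}^{s}(-1)^{i+j}\,\overrightarrow{\det}({}_jA^+(\lambda,r))\,\overleftarrow{\det}({}_iA^-(\lambda,s))\,e_{m+i,\,j+r-1}$$ and $$\theta_\gamma(\lambda)=\sum_{j=1}^{m-r+1}\sum_{i=1}^{s}e_{m+i,\,j+r-1}\,(-1)^{i+j+r+m}\,\overleftarrow{\det}({}_jB^+(\lambda,r))\,\overrightarrow{\det}({}_iB^-(\lambda,s)).$$ -/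

import Mathlib

noncomputable section

namespace GLSuper

/-! ## The Lie superalgebra `gl(m,n)` and its enveloping algebra

The indices `0, …, m-1` are even (they belong to `ε_1, …, ε_m`) and the indices `m, …, m+n-1` are odd
(they belong to `δ_1, …, δ_n`).  As a vector space `gl(m,n)` is the space of all matrices. -/

/-- The parity of an index. -/
def parity (m n : ℕ) (i : Fin (m + n)) : ZMod 2 := if (i : ℕ) < m then 0 else 1

/-- The matrix `x` is homogeneous of degree `p`. -/
def IsHomogeneous {k : Type*} [Field k] {m n : ℕ} (p : ZMod 2)
    (x : Matrix (Fin (m + n)) (Fin (m + n)) k) : Prop :=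
  ∀ i j, x i j ≠ 0 → parity m n i + parity m n j = p

/-- The sign `(-1)^{pq}`. -/
def superSign (k : Type*) [Field k] (p q : ZMod 2) : k := if p = 1 ∧ q = 1 then -1 else 1

/-- The defining relations of the enveloping algebra of `gl(m,n)`:
`x y - (-1)^{pq} y x = [x, y]` for `x, y` homogeneous of degrees `p, q`, where
`[x, y] = xy - (-1)^{pq} yx` is the matrix supercommutator. -/
inductive Rel (k : Type*) [Field k] (m n : ℕ) :
    TensorAlgebra k (Matrix (Fin (m + n)) (Fin (m + n)) k) →
    TensorAlgebra k (Matrix (Fin (m + n)) (Fin (m + n)) k) → Prop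
  | bracket (p q : ZMod 2) (x y : Matrix (Fin (m + n)) (Fin (m + n)) k)
      (hx : IsHomogeneous p x) (hy : IsHomogeneous q y) :
      Rel k m n
        (TensorAlgebra.ι k x * TensorAlgebra.ι k y
          - superSign k p q • (TensorAlgebra.ι k y * TensorAlgebra.ι k x))
        (TensorAlgebra.ι k (x * y - superSign k p q • (y * x)))

/-- The enveloping algebra `U(g)` of `g = gl(m,n)`. -/
def U (k : Type*) [Field k] (m n : ℕ) : Type _ := RingQuot (Rel k m n)

instance instRingU (k : Type*) [Field k] (m n : ℕ) : Ring (U k m n) :=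
  inferInstanceAs (Ring (RingQuot (Rel k m n)))

instance instAlgebraU (k : Type*) [Field k] (m n : ℕ) : Algebra k (U k m n) :=
  inferInstanceAs (Algebra k (RingQuot (Rel k m n)))

/-- The canonical map `g → U(g)`. -/
def ι (k : Type*) [Field k] (m n : ℕ) :
    Matrix (Fin (m + n)) (Fin (m + n)) k →ₗ[k] U k m n :=
  (RingQuot.mkAlgHom k (Rel k m n)).toLinearMap ∘ₗ TensorAlgebra.ι k

/-- The matrix unit `e_{i,j}`, as an element of `U(g)`. -/
def e (k : Type*) [Field k] {m n : ℕ} (i j : Fin (m + n)) : U k m n :=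
  ι k m n (Matrix.single i j 1)

/-! ## Weights and roots

The Cartan subalgebra `h` consists of the diagonal matrices, and a weight `lam ∈ h^*` is given by its
coordinates `lam i = lam (e_{i,i})`. -/

/-- `1` on even indices and `-1` on odd ones. -/
def sgn (R : Type*) [CommRing R] (m n : ℕ) (i : Fin (m + n)) : R := if (i : ℕ) < m then 1 else -1

/-- The invariant form on weights given by the supertrace: `(ε_i, ε_j) = δ_{ij}`,
`(δ_i, δ_j) = -δ_{ij}` and `(ε_i, δ_j) = 0`. -/
def form {R : Type*} [CommRing R] {m n : ℕ} (lam mu : Fin (m + n) → R) : R :=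
  ∑ i, sgn R m n i * lam i * mu i

/-- The positive roots for the upper triangular Borel subalgebra.
The pair `(i, j)` with `i < j` stands for the root of the vector `e_{i,j}`. -/
abbrev PosRoot (m n : ℕ) : Type := {p : Fin (m + n) × Fin (m + n) // p.1 < p.2}

/-- A positive root as a weight, with coordinates in any commutative ring `R`. -/
def wt (R : Type*) [CommRing R] {m n : ℕ} (α : PosRoot m n) : Fin (m + n) → R :=
  Pi.single α.1.1 1 - Pi.single α.1.2 1

/-- A positive root is odd when it joins an even index and an odd one. -/
def IsOddRoot {m n : ℕ} (α : PosRoot m n) : Prop := parity m n α.1.1 ≠ parity m n α.1.2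

instance instDecidableIsOddRoot {m n : ℕ} (α : PosRoot m n) : Decidable (IsOddRoot α) :=
  inferInstanceAs (Decidable (_ ≠ _))

/-- The simple roots join neighbouring indices. -/
def IsSimpleRoot {m n : ℕ} (α : PosRoot m n) : Prop := (α.1.1 : ℕ) + 1 = α.1.2

/-- Half the sum of the positive even roots minus half the sum of the positive odd roots. -/
def rho (k : Type*) [Field k] (m n : ℕ) : Fin (m + n) → k :=
  (1 / 2 : k) • (∑ α : PosRoot m n with ¬ IsOddRoot α, wt k α)
    - (1 / 2 : k) • (∑ α : PosRoot m n with IsOddRoot α, wt k α)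

/-- `(lam, α^∨)`, where `α^∨ = 2 α / (α, α)`; used for non-isotropic roots `α` only. -/
def corootPairing {k : Type*} [Field k] {m n : ℕ} (lam : Fin (m + n) → k) (α : PosRoot m n) : k :=
  form lam ((2 / form (wt k α) (wt k α)) • wt k α)

/-- The element `h_α` of `h`, determined by `β (h_α) = (α, β)` for all weights `β`:
its coefficient at `e_{i,i}` is `± α_i`. -/
def hRoot (k : Type*) [Field k] {m n : ℕ} (α : PosRoot m n) : U k m n :=
  ∑ i, (sgn k m n i * wt k α i) • e k i i

/-- The negative root vector `e_{-α}`: the matrix unit `e_{j,i}` for `α = (i, j)`. -/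
def eNeg (k : Type*) [Field k] {m n : ℕ} (α : PosRoot m n) : U k m n := e k α.1.2 α.1.1

/-- The positive root vector `e_α`, normalized by `[e_α, e_{-α}] = h_α`. -/
def ePos (k : Type*) [Field k] {m n : ℕ} (α : PosRoot m n) : U k m n :=
  sgn k m n α.1.1 • e k α.1.1 α.1.2

/-- The odd root `ε_r - δ_s` (with `r` and `s` counted from `0`). -/
def gammaRoot {m n : ℕ} (r : Fin m) (s : Fin n) : PosRoot m n :=
  ⟨(Fin.castAdd n r, Fin.natAdd m s), by
    rw [Fin.lt_def]; simp only [Fin.val_castAdd, Fin.val_natAdd]; omega⟩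

/-- The root `ε_i - ε_j`. -/
def sigmaRoot {m n : ℕ} (i j : Fin m) (h : i < j) : PosRoot m n :=
  ⟨(Fin.castAdd n i, Fin.castAdd n j), by
    rw [Fin.lt_def]; simp only [Fin.val_castAdd]; exact h⟩

/-- The root `δ_i - δ_j`. -/
def tauRoot {m n : ℕ} (i j : Fin n) (h : i < j) : PosRoot m n :=
  ⟨(Fin.natAdd m i, Fin.natAdd m j), by
    have h' : (i : ℕ) < j := h
    rw [Fin.lt_def]; simp only [Fin.val_natAdd]; omega⟩

/-! ## Partitions and Šapovalov elements -/

/-- The partitions of `γ`: families of natural numbers `π α`, at most `1` for isotropic `α`, with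
`∑ π α • α = γ`.  (Twice a root of `gl(m,n)` is never a root, so there is no further condition.) -/
def RootPartition {m n : ℕ} (γ : PosRoot m n) : Type :=
  {π : PosRoot m n → ℕ //
    (∀ α, form (wt ℤ α) (wt ℤ α) = 0 → π α ≤ 1) ∧ ∑ α, π α • wt ℤ α = wt ℤ γ}

/-- The ordered product `e_{-π} = ∏ e_{-α}^{π α}`; the list `L` is the chosen ordering of the
positive roots. -/
def ePart (k : Type*) [Field k] {m n : ℕ} (L : List (PosRoot m n)) {γ : PosRoot m n}
    (π : RootPartition γ) : U k m n :=
  (L.map fun α => eNeg k α ^ π.1 α).prod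

/-- The embedding of `S(h) = U(h)` in `U(g)`; the variable `X i` goes to `e_{i,i}`.  (The elements
`e_{i,i}` commute, so the order of the factors plays no role.) -/
def cartan {k : Type*} [Field k] {m n : ℕ} (f : MvPolynomial (Fin (m + n)) k) : U k m n :=
  ∑ d ∈ f.support, f.coeff d • (List.ofFn fun i => e k i i ^ d i).prod

/-- The element `∑_π e_{-π} H_π` of `U(b^-)`.  (There are only finitely many partitions of `γ`, so
finitely supported families are all families.) -/
def sapSum {k : Type*} [Field k] {m n : ℕ} (L : List (PosRoot m n)) {γ : PosRoot m n}
    (H : RootPartition γ →₀ MvPolynomial (Fin (m + n)) k) : U k m n :=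
  H.sum fun π f => ePart k L π * cartan f

/-- The value `∑_π H_π(lam) e_{-π}` at `lam` of the element `∑_π e_{-π} H_π`. -/
def sapEval {k : Type*} [Field k] {m n : ℕ} (L : List (PosRoot m n)) {γ : PosRoot m n}
    (H : RootPartition γ →₀ MvPolynomial (Fin (m + n)) k) (lam : Fin (m + n) → k) : U k m n :=
  H.sum fun π f => MvPolynomial.eval lam f • ePart k L π

/-- The left ideal `U(g) (h_γ + ρ(h_γ) - (γ,γ)/2) + U(g) n^+`. -/
def sapIdeal (k : Type*) [Field k] {m n : ℕ} (γ : PosRoot m n) : Ideal (U k m n) :=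
  Ideal.span {hRoot k γ +
      algebraMap k (U k m n) (form (rho k m n) (wt k γ) - form (wt k γ) (wt k γ) / 2)}
    ⊔ Ideal.span (Set.range fun α : PosRoot m n => ePos k α)

/-- The element `θ_γ = ∑_π e_{-π} H_π` is a Šapovalov element for `γ`: the coefficient of the
partition `π⁰` of `γ` into simple roots is `1`, and `e_α θ_γ` lies in the left ideal
`U(g) (h_γ + ρ(h_γ) - (γ,γ)/2) + U(g) n^+` for all positive roots `α`. -/
structure IsSapovalov {k : Type*} [Field k] {m n : ℕ} (L : List (PosRoot m n)) (γ : PosRoot m n)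
    (H : RootPartition γ →₀ MvPolynomial (Fin (m + n)) k) : Prop where
  normalized : ∀ π : RootPartition γ, (∀ α, ¬ IsSimpleRoot α → π.1 α = 0) → H π = 1
  highest : ∀ α : PosRoot m n, ePos k α * sapSum L H ∈ sapIdeal k γ

/-- The hyperplane of the weights `lam` with `(lam + ρ, γ) = (γ, γ) / 2`. -/
def hyperplane (k : Type*) [Field k] {m n : ℕ} (γ : PosRoot m n) : Set (Fin (m + n) → k) :=
  {lam | form (lam + rho k m n) (wt k γ) = form (wt k γ) (wt k γ) / 2}

/-! ## Noncommutative determinants and the matrices -/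

/-- The determinant working from left to right, `∑_w sign(w) b_{w(1),1} ⋯ b_{w(l),l}`. -/
def detLR {R : Type*} [Ring R] {l : ℕ} (B : Matrix (Fin l) (Fin l) R) : R :=
  ∑ w : Equiv.Perm (Fin l),
    ((Equiv.Perm.sign w : ℤˣ) : ℤ) • (List.ofFn fun c => B (w c) c).prod

/-- The determinant working from right to left, `∑_w sign(w) b_{w(l),l} ⋯ b_{w(1),1}`. -/
def detRL {R : Type*} [Ring R] {l : ℕ} (B : Matrix (Fin l) (Fin l) R) : R :=
  ∑ w : Equiv.Perm (Fin l),
    ((Equiv.Perm.sign w : ℤˣ) : ℤ) • (List.ofFn fun c => B (w c) c).reverse.prod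

/-- The matrix obtained by deleting row `i`. -/
def delRow {R : Type*} {l c : ℕ} (i : Fin (l + 1)) (B : Matrix (Fin (l + 1)) (Fin c) R) :
    Matrix (Fin l) (Fin c) R :=
  B.submatrix i.succAbove id

/-- For `r ∈ {0, …, m-1}` and `j ∈ {0, …, m-1-r}`, the index `r + j`. -/
def plusIdx {m : ℕ} (r : Fin m) (j : Fin (m - 1 - r + 1)) : Fin m :=
  ⟨r + j, by have := j.2; have := r.2; omega⟩

/-- For `s ∈ {0, …, n-1}` and `i ∈ {0, …, s}`, the index `i` in `{0, …, n-1}`. -/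
def minusIdx {n : ℕ} (s : Fin n) (i : Fin ((s : ℕ) + 1)) : Fin n :=
  ⟨i, by have := i.2; have := s.2; omega⟩

theorem lt_plusIdx_succ {m : ℕ} (r : Fin m) (l : Fin (m - 1 - r)) : r < plusIdx r l.succ := by
  rw [Fin.lt_def]; simp only [plusIdx, Fin.val_succ]; omega

theorem minusIdx_castSucc_lt {n : ℕ} (s : Fin n) (i : Fin (s : ℕ)) :
    minusIdx s i.castSucc < s := by
  rw [Fin.lt_def]; simp only [minusIdx, Fin.val_castSucc]; exact i.2

/-- The numbers `(lam + ρ, (ε_r - ε_{r+j})^∨)`, `j = 1, …, m - r` (here `j = l + 1`). -/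
def aCoeff {k : Type*} [Field k] {m n : ℕ} (lam : Fin (m + n) → k) (r : Fin m)
    (l : Fin (m - 1 - r)) : k :=
  corootPairing (lam + rho k m n) (sigmaRoot r (plusIdx r l.succ) (lt_plusIdx_succ r l))

/-- The numbers `(lam + ρ, (δ_i - δ_s)^∨)`, `i = 1, …, s - 1` (here `i` is counted from `0`). -/
def bCoeff {k : Type*} [Field k] {m n : ℕ} (lam : Fin (m + n) → k) (s : Fin n)
    (i : Fin (s : ℕ)) : k :=
  corootPairing (lam + rho k m n)
    (tauRoot (minusIdx s i.castSucc) s (minusIdx_castSucc_lt s i))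

/-- The matrix with one more row than columns whose entries on and above the main diagonal are the
matrix units `e_{r+l,r+i-1}` (row `i`, column `l`, all counted from `1`), with entries
`-a_1, -a_2, …` just below the main diagonal and zeros further down. -/
def plusMatrix {k : Type*} [Field k] {m n : ℕ} (r : Fin m) (a : Fin (m - 1 - r) → k) :
    Matrix (Fin (m - 1 - r + 1)) (Fin (m - 1 - r)) (U k m n) :=
  Matrix.of fun i l =>
    if (i : ℕ) ≤ l then e k (Fin.castAdd n (plusIdx r l.succ)) (Fin.castAdd n (plusIdx r i))
    else if (i : ℕ) = l + 1 then algebraMap k (U k m n) (-a l)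
    else 0

/-- The matrix with one more row than columns with entries `b_1, b_2, …` on the main diagonal, the
matrix units `e_{m+i,m+l}` (row `i`, column `l`, all counted from `1`) below it, and zeros above. -/
def minusMatrix {k : Type*} [Field k] {m n : ℕ} (s : Fin n) (b : Fin (s : ℕ) → k) :
    Matrix (Fin ((s : ℕ) + 1)) (Fin (s : ℕ)) (U k m n) :=
  Matrix.of fun i l =>
    if (l : ℕ) < i then e k (Fin.natAdd m (minusIdx s i)) (Fin.natAdd m (minusIdx s l.castSucc))
    else if (i : ℕ) = l then algebraMap k (U k m n) (b l)
    else 0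

/-- The matrix `A^+(lam, r)`. -/
def Aplus {k : Type*} [Field k] {m n : ℕ} (lam : Fin (m + n) → k) (r : Fin m) :
    Matrix (Fin (m - 1 - r + 1)) (Fin (m - 1 - r)) (U k m n) :=
  plusMatrix r fun l => aCoeff lam r l

/-- The matrix `A^-(lam, s)`. -/
def Aminus {k : Type*} [Field k] {m n : ℕ} (lam : Fin (m + n) → k) (s : Fin n) :
    Matrix (Fin ((s : ℕ) + 1)) (Fin (s : ℕ)) (U k m n) :=
  minusMatrix s fun i => bCoeff lam s i

/-- The matrix `B^+(lam, r)`: each `a_j` is replaced by `a_j - 1`. -/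
def Bplus {k : Type*} [Field k] {m n : ℕ} (lam : Fin (m + n) → k) (r : Fin m) :
    Matrix (Fin (m - 1 - r + 1)) (Fin (m - 1 - r)) (U k m n) :=
  plusMatrix r fun l => aCoeff lam r l - 1

/-- The matrix `B^-(lam, s)`: each `b_i` is replaced by `b_i - 1`. -/
def Bminus {k : Type*} [Field k] {m n : ℕ} (lam : Fin (m + n) → k) (s : Fin n) :
    Matrix (Fin ((s : ℕ) + 1)) (Fin (s : ℕ)) (U k m n) :=
  minusMatrix s fun i => bCoeff lam s i - 1

/-- The odd root vector `e_{m+i,r+j-1}` (with `r, i, j` counted from `1`; here they are counted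
from `0`). -/
def oddVector (k : Type*) [Field k] {m n : ℕ} (r : Fin m) (s : Fin n) (j : Fin (m - 1 - r + 1))
    (i : Fin ((s : ℕ) + 1)) : U k m n :=
  e k (Fin.natAdd m (minusIdx s i)) (Fin.castAdd n (plusIdx r j))

end GLSuper

end

/-!
Write `a = r` and `b = m + s` for the two ends of the chain `r, r + 1, …, m + s` of indices in the
support of `γ`.

*Existence.*  The element is built by a recursion along this chain: `Z(r, q) = δ_{q,r}` and
`Z(o + 1, q) = e_{q,o} Z(o, o) + Z(o, q) C_o`, with polynomials `C_o` of degree one in `S(h)`.  So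
`θ = Z(b, b)` is a sum over the increasing paths from `a` to `b` of products of matrix units, times
the `C_p` of the nodes `p` that the path avoids.  A raising operator `e_{i,i+1}` commutes past all
steps except those at `i` and `i + 1`, and the `C_p` are determined by the requirement that what it
produces there cancels; the last of these conditions is the linear condition that defines the
hyperplane (`MatrixUnits.raise_ringChain_mem`, `ePos_mul_ringChain_mem`).  A word of weight `-γ`
has exactly one odd letter, so that sorting its letters produces no signs, and an interchange of two
letters produces at most one shorter word, which has a letter that is not simple; hence `θ` has the
form `∑_π e_{-π} H_π`, with `H_{π⁰} = 1` (`exists_isSapovalov`).  Evaluation at `lam` turns `θ` into the same chain with the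
scalars `C_o(lam)` as coefficients.

*Uniqueness on the hyperplane.*  Any two Šapovalov elements have the same value on the hyperplane
(`IsSapovalov.sapEval_eq`).  Instead of Verma modules and the Poincaré–Birkhoff–Witt theorem, the
argument uses an oscillator representation.  With the exponents of the bosonic variables shifted, its
vacuum is a torsion-free highest weight vector `v` of any given weight over any commutative algebra
(`exists_highest_weight_vector`).  This is used over `k[t]`, for a line in the hyperplane along
which no root `α ≠ γ` in the support of `γ` is constant.  Then the matrix coefficients
`e_σ e_{-π} v` have their top degree in `t` on the diagonal, so that a singular combination of the
`e_{-π} v` without the term `e_{-γ} v` vanishes (`eq_zero_of_singular`).  The term `e_{-γ} v` can be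
eliminated between two Šapovalov elements, and the normalization `H_{π⁰} = 1` does the rest.

*The determinants.*  In the scalar chain the single odd step of a path separates an even part from an
odd one.  Cutting the paths there writes `Z(b, b)` as a double sum over the two ends of the odd step
(`chain_split`, `chain_expand_fin`).  The commutator of `e_{q,o}` with `Z(o, o)` is `Z(o, q)`, so the
chain also satisfies the recursion with the factors in the opposite order and with all `c_o` raised
by `1` (`scalarChain_succ'`); this accounts for the difference between `A^±` and `B^±`.  The
determinants are maximal minors of Hessenberg matrices, and expansion along the first column gives
them the same recursion (`detRL_delRow_lowerHess`); the other order of the factors is handled by the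
opposite ring, and `A^+` by reversing the indices.
-/

noncomputable section

universe u v

namespace GLSuper

/-! ### The relations of the matrix units -/

section

variable {k : Type*} [Field k] {m n : ℕ}

/-- The sign in the supercommutator of `e_{i,j}` and `e_{u,v}`. -/
def unitSign (k : Type*) [Field k] {m n : ℕ} (i j u v : Fin (m + n)) : k :=
  superSign k (parity m n i + parity m n j) (parity m n u + parity m n v)

theorem isHomogeneous_single (i j : Fin (m + n)) (c : k) :
    IsHomogeneous (parity m n i + parity m n j) (Matrix.single i j c) := by
  intro u v h
  rw [Matrix.single_apply] at h
  split_ifs at h with h'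
  · rw [h'.1, h'.2]
  · exact absurd rfl h

theorem ι_bracket (p q : ZMod 2) (x y : Matrix (Fin (m + n)) (Fin (m + n)) k)
    (hx : IsHomogeneous p x) (hy : IsHomogeneous q y) :
    ι k m n x * ι k m n y - superSign k p q • (ι k m n y * ι k m n x)
      = ι k m n (x * y - superSign k p q • (y * x)) := by
  have h := RingQuot.mkAlgHom_rel k (Rel.bracket p q x y hx hy)
  rw [map_sub, map_smul, map_mul, map_mul] at h
  exact h

/-- The supercommutator of two matrix units. -/
theorem e_mul_e (i j u v : Fin (m + n)) :
    e k i j * e k u v = unitSign k i j u v • (e k u v * e k i j)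
      + (if j = u then e k i v else 0) - unitSign k i j u v • (if v = i then e k u j else 0) := by
  have h := ι_bracket (k := k) _ _ _ _ (isHomogeneous_single i j 1) (isHomogeneous_single u v 1)
  have h1 : ∀ i j u v : Fin (m + n), ι k m n (Matrix.single i j 1 * Matrix.single u v 1)
      = if j = u then e k i v else 0 := by
    intro i j u v
    split_ifs with h
    · subst h; simp [e]
    · rw [Matrix.single_mul_single_of_ne _ _ _ _ h, map_zero]
  rw [map_sub, map_smul, h1, h1] at h
  rw [add_sub_assoc, ← sub_eq_iff_eq_add']
  exact h

theorem superSign_mul_self (p q : ZMod 2) : superSign k p q * superSign k p q = 1 := by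
  unfold superSign; split_ifs <;> simp

theorem superSign_zero_left (q : ZMod 2) : superSign k 0 q = 1 := by
  simp [superSign]

theorem superSign_zero_right (q : ZMod 2) : superSign k q 0 = 1 := by
  simp [superSign]

theorem unitSign_self_left (i u v : Fin (m + n)) : unitSign k i i u v = 1 := by
  rw [unitSign, CharTwo.add_self_eq_zero, superSign_zero_left]

theorem bilinear_eq_sum {ι A : Type*} [Fintype ι] [DecidableEq ι] [AddCommGroup A] [Module k A]
    (B : Matrix ι ι k →ₗ[k] Matrix ι ι k →ₗ[k] A) (x y : Matrix ι ι k) :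
    B x y = ∑ i, ∑ j, ∑ u, ∑ v,
      (x i j * y u v) • B (Matrix.single i j 1) (Matrix.single u v 1) := by
  have h : ∀ z : Matrix ι ι k, z = ∑ i, ∑ j, z i j • Matrix.single i j 1 := by
    intro z
    conv_lhs => rw [Matrix.matrix_eq_sum_single z]
    simp [Matrix.smul_single]
  conv_lhs => rw [h x]
  simp only [map_sum, LinearMap.sum_apply, map_smul, LinearMap.smul_apply]
  refine Finset.sum_congr rfl fun i _ => Finset.sum_congr rfl fun j _ => ?_
  conv_lhs => rw [h y]
  simp only [map_sum, map_smul, Finset.smul_sum, mul_smul]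

/-- A family of elements satisfying the relations of the matrix units defines a homomorphism from
`U(g)`. -/
theorem exists_lift {A : Type*} [Ring A] [Algebra k A] (T : Fin (m + n) → Fin (m + n) → A)
    (hT : ∀ i j u v, T i j * T u v - unitSign k i j u v • (T u v * T i j)
      = (if j = u then T i v else 0) - unitSign k i j u v • (if v = i then T u j else 0)) :
    ∃ φ : U k m n →ₐ[k] A, ∀ i j, φ (e k i j) = T i j := by
  let t : Matrix (Fin (m + n)) (Fin (m + n)) k →ₗ[k] A :=
    ∑ i, ∑ j, (LinearMap.toSpanSingleton k A (T i j)).comp (Matrix.entryLinearMap k k i j)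
  have ht : ∀ x, t x = ∑ i, ∑ j, x i j • T i j := by
    intro x
    simp [t, LinearMap.sum_apply]
  have hts : ∀ i j (c : k), t (Matrix.single i j c) = c • T i j := by
    intro i j c
    rw [ht, Finset.sum_eq_single i, Finset.sum_eq_single j]
    · simp
    · intro j' _ hj'; simp [hj'.symm]
    · simp
    · intro i' _ hi'; simp [hi'.symm]
    · simp
  have hmul : ∀ i j u v (c d : k), t (Matrix.single i j c * Matrix.single u v d)
      = (c * d) • if j = u then T i v else 0 := by
    intro i j u v c d
    split_ifs with h
    · subst h; simp [hts]
    · rw [Matrix.single_mul_single_of_ne _ _ _ _ h, map_zero, smul_zero]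
  have key : ∀ (p q : ZMod 2) (x y : Matrix (Fin (m + n)) (Fin (m + n)) k),
      IsHomogeneous p x → IsHomogeneous q y →
      t x * t y - superSign k p q • (t y * t x) = t (x * y - superSign k p q • (y * x)) := by
    intro p q x y hx hy
    have hF := bilinear_eq_sum ((LinearMap.mul k A).compl₁₂ t t
      - superSign k p q • ((LinearMap.mul k A).compl₁₂ t t).flip) x y
    have hG := bilinear_eq_sum ((LinearMap.mul k (Matrix (Fin (m + n)) (Fin (m + n)) k)
      - superSign k p q • (LinearMap.mul k (Matrix (Fin (m + n)) (Fin (m + n)) k)).flip).compr₂ t)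
      x y
    simp only [LinearMap.sub_apply, LinearMap.smul_apply, LinearMap.flip_apply,
      LinearMap.compl₁₂_apply, LinearMap.mul_apply', LinearMap.compr₂_apply] at hF hG
    rw [hF, hG]
    refine Finset.sum_congr rfl fun i _ => Finset.sum_congr rfl fun j _ =>
          Finset.sum_congr rfl fun u _ => Finset.sum_congr rfl fun v _ => ?_
    by_cases hxz : x i j = 0
    · simp [hxz]
    by_cases hyz : y u v = 0
    · simp [hyz]
    have := hT i j u v
    rw [unitSign, hx i j hxz, hy u v hyz] at this
    rw [map_sub, map_smul, hmul, hmul, hts, hts]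
    simp only [one_smul, mul_one, this]
  let φ : U k m n →ₐ[k] A := RingQuot.liftAlgHom k ⟨TensorAlgebra.lift k t, by
    intro a b hab
    cases hab with
    | bracket p q x y hx hy => simpa using key p q x y hx hy⟩
  refine ⟨φ, fun i j => ?_⟩
  have : φ (ι k m n (Matrix.single i j 1)) = t (Matrix.single i j 1) := by
    change RingQuot.liftAlgHom k _ (RingQuot.mkAlgHom k (Rel k m n) (TensorAlgebra.ι k _)) = _
    rw [RingQuot.liftAlgHom_mkAlgHom_apply, TensorAlgebra.lift_ι_apply]
  rw [e, this, hts, one_smul]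

end

/-! ### The Cartan subalgebra -/

section

variable {k : Type*} [Field k] {m n : ℕ}

theorem commute_e_diag (i j : Fin (m + n)) : Commute (e k i i) (e k j j) := by
  have h := e_mul_e (k := k) i i j j
  rw [unitSign_self_left, one_smul, one_smul] at h
  rw [Commute, SemiconjBy, h]
  by_cases hij : i = j
  · subst hij; simp
  · simp [hij, Ne.symm hij]

open scoped IsMulCommutative

instance instIsMulCommutativeCartan : IsMulCommutative
    (Algebra.adjoin k (Set.range fun i : Fin (m + n) => e k i i)) :=
  Algebra.isMulCommutative_adjoin k (by
    rintro _ ⟨i, rfl⟩ _ ⟨j, rfl⟩; exact commute_e_diag i j)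

/-- The map `cartan` as a homomorphism of algebras, defined through the commutative subalgebra
generated by the `e_{i,i}`. -/
def cartanHom (k : Type*) [Field k] (m n : ℕ) : MvPolynomial (Fin (m + n)) k →ₐ[k] U k m n :=
  (Algebra.adjoin k (Set.range fun i : Fin (m + n) => e k i i)).val.comp
    (MvPolynomial.aeval fun i =>
      (⟨e k i i, Algebra.subset_adjoin ⟨i, rfl⟩⟩ :
        Algebra.adjoin k (Set.range fun i : Fin (m + n) => e k i i)))

theorem cartan_eq_cartanHom (f : MvPolynomial (Fin (m + n)) k) :
    cartan f = cartanHom k m n f := by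
  conv_rhs => rw [f.as_sum, map_sum]
  refine Finset.sum_congr rfl fun d _ => ?_
  rw [cartanHom, AlgHom.comp_apply, MvPolynomial.aeval_monomial, Finsupp.prod_fintype _ _ (by simp),
    ← List.prod_ofFn, map_mul, AlgHom.commutes, map_list_prod, List.map_ofFn, Algebra.smul_def]
  rfl

theorem cartanHom_X (i : Fin (m + n)) : cartanHom k m n (MvPolynomial.X i) = e k i i := by
  rw [cartanHom, AlgHom.comp_apply, MvPolynomial.aeval_X]
  rfl

theorem e_diag_mul (i u v : Fin (m + n)) :
    e k i i * e k u v = e k u v * (e k i i + algebraMap k _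
      ((if i = u then 1 else 0) - if i = v then 1 else 0)) := by
  have h := e_mul_e (k := k) i i u v
  rw [unitSign_self_left, one_smul, one_smul] at h
  rw [h, mul_add, ← Algebra.commutes, ← Algebra.smul_def, sub_smul]
  by_cases h1 : i = u <;> by_cases h2 : v = i <;> simp [h1, h2, eq_comm] <;> simp_all [eq_comm, sub_eq_add_neg]

theorem commute_cartanHom (f g : MvPolynomial (Fin (m + n)) k) :
    Commute (cartanHom k m n f) (cartanHom k m n g) := by
  rw [Commute, SemiconjBy, ← map_mul, mul_comm, map_mul]

theorem hRoot_eq_cartanHom (α : PosRoot m n) :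
    ∃ f, hRoot k α = cartanHom k m n f := by
  refine ⟨∑ i, (sgn k m n i * wt k α i) • MvPolynomial.X i, ?_⟩
  simp [hRoot, map_sum, map_smul, cartanHom_X]

/-- The left ideal `U(g) (h_γ + ρ(h_γ) - (γ,γ)/2) + U(g) n^+` is stable under right multiplication
by `S(h)`, because `h` is commutative and normalizes `n^+`. -/
theorem mul_cartanHom_mem_sapIdeal (γ : PosRoot m n) {x : U k m n} (hx : x ∈ sapIdeal k γ)
    (f : MvPolynomial (Fin (m + n)) k) : x * cartanHom k m n f ∈ sapIdeal k γ := by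
  induction f using MvPolynomial.induction_on generalizing x with
  | C c =>
    rw [← MvPolynomial.algebraMap_eq, AlgHom.commutes, ← Algebra.commutes]
    exact (sapIdeal k γ).mul_mem_left _ hx
  | add p q hp hq => rw [map_add, mul_add]; exact add_mem (hp hx) (hq hx)
  | mul_X p i hp =>
    rw [map_mul, ← mul_assoc, cartanHom_X]
    refine (?_ : ∀ y ∈ sapIdeal k γ, y * e k i i ∈ sapIdeal k γ) _ (hp hx)
    clear hp hx x p
    intro y hy
    rw [sapIdeal, Submodule.mem_sup] at hy
    obtain ⟨y1, hy1, y2, hy2, rfl⟩ := hy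
    rw [add_mul]
    refine add_mem ?_ ?_
    · obtain ⟨a, rfl⟩ := Submodule.mem_span_singleton.1 hy1
      obtain ⟨g, hg⟩ := hRoot_eq_cartanHom (k := k) γ
      have hc : Commute (hRoot k γ + algebraMap k (U k m n)
          (form (rho k m n) (wt k γ) - form (wt k γ) (wt k γ) / 2)) (e k i i) := by
        rw [hg, ← cartanHom_X]
        exact (commute_cartanHom _ _).add_left (Algebra.commutes _ _)
      rw [smul_eq_mul, mul_assoc, hc.eq, ← mul_assoc]
      exact Ideal.mul_mem_left _ _ (Submodule.mem_sup_left (Submodule.mem_span_singleton_self _))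
    · refine Submodule.mem_sup_right ?_
      induction hy2 using Submodule.span_induction with
      | mem z hz =>
        obtain ⟨α, rfl⟩ := hz
        have h := e_diag_mul (k := k) i α.1.1 α.1.2
        rw [mul_add, ← sub_eq_iff_eq_add, ← Algebra.commutes] at h
        simp only
        rw [ePos, smul_mul_assoc, ← h, smul_sub, ← mul_smul_comm, ← mul_smul_comm]
        exact sub_mem (Ideal.mul_mem_left _ _ (Submodule.subset_span ⟨α, rfl⟩))
          (Ideal.mul_mem_left _ _ (Submodule.subset_span ⟨α, rfl⟩))
      | zero => simp
      | add a b _ _ ha hb => rw [add_mul]; exact add_mem ha hb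
      | smul a b _ hb => rw [smul_eq_mul, mul_assoc]; exact Ideal.mul_mem_left _ _ hb

end

/-! ### Oscillators -/

section

variable {k : Type*} [Field k] {m n : ℕ}

theorem superSign_add_left (p q r : ZMod 2) :
    superSign k (p + q) r = superSign k p r * superSign k q r := by
  have h : ∀ p q r : ZMod 2, (p + q = 1 ∧ r = 1) ↔
      ((p = 1 ∧ r = 1) ∧ ¬ (q = 1 ∧ r = 1)) ∨ (¬ (p = 1 ∧ r = 1) ∧ (q = 1 ∧ r = 1)) := by decide
  unfold superSign
  simp only [h p q r]
  split_ifs <;> first | (exfalso; tauto) | simp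

theorem superSign_comm (p q : ZMod 2) : superSign k p q = superSign k q p := by
  simp only [superSign, and_comm]

/-- The sign in the supercommutator of two oscillators; the oscillator `(j, i)` of the `i`-th copy has
the parity of `j` plus that of `i`. -/
def oscSign (k : Type*) [Field k] {m n : ℕ} (a b : Fin (m + n) × Fin (m + n)) : k :=
  superSign k (parity m n a.1 + parity m n a.2) (parity m n b.1 + parity m n b.2)

theorem unitSign_eq_oscSign (a b i l : Fin (m + n)) (u v : Fin (m + n)) :
    unitSign k a b u v = oscSign k (b, i) (u, l) * oscSign k (a, i) (u, l) *
      oscSign k (b, i) (v, l) * oscSign k (a, i) (v, l) := by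
  have h : ∀ p q r : ZMod 2, p + q = (p + r) + (q + r) := by decide
  have h' : ∀ p q r : ZMod 2, superSign k p (q + r) = superSign k p q * superSign k p r := by
    intro p q r
    rw [superSign_comm, superSign_add_left, superSign_comm q, superSign_comm r]
  simp only [unitSign, oscSign]
  rw [h _ _ (parity m n i), h (parity m n u) _ (parity m n l), superSign_add_left,
    h' _ (parity m n u + _), h' _ (parity m n u + _)]
  generalize superSign k _ _ = x1
  generalize superSign k _ _ = x2
  generalize superSign k _ _ = x3
  generalize superSign k _ _ = x4
  ring

/-- Oscillators `y_a, z_a` with the canonical supercommutation relations yield a representation of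
`gl(m,n)` by the quadratic elements `∑_i y_{(j,i)} z_{(l,i)}`. -/
theorem oscillator_relation {A : Type*} [Ring A] [Algebra k A]
    (y z : Fin (m + n) × Fin (m + n) → A)
    (hyy : ∀ a b, y a * y b = oscSign k a b • (y b * y a))
    (hzz : ∀ a b, z a * z b = oscSign k a b • (z b * z a))
    (hzy : ∀ a b, z a * y b = oscSign k a b • (y b * z a) + if a = b then 1 else 0)
    (a b u v : Fin (m + n)) :
    (∑ i, y (a, i) * z (b, i)) * (∑ i, y (u, i) * z (v, i))
      - unitSign k a b u v • ((∑ i, y (u, i) * z (v, i)) * (∑ i, y (a, i) * z (b, i)))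
      = (if b = u then ∑ i, y (a, i) * z (v, i) else 0)
        - unitSign k a b u v • (if v = a then ∑ i, y (u, i) * z (b, i) else 0) := by
  have key : ∀ i l, y (a, i) * z (b, i) * (y (u, l) * z (v, l))
      - unitSign k a b u v • (y (u, l) * z (v, l) * (y (a, i) * z (b, i)))
      = (if i = l then (if b = u then y (a, i) * z (v, i) else 0) else 0)
        - unitSign k a b u v • (if i = l then (if v = a then y (u, i) * z (b, i) else 0) else 0) := by
    intro i l
    have h1 : y (a, i) * z (b, i) * (y (u, l) * z (v, l))
        = unitSign k a b u v • oscSign k (a, i) (v, l) • (y (u, l) * y (a, i) * (z (v, l) * z (b, i)))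
          + if i = l then (if b = u then y (a, i) * z (v, i) else 0) else 0 := by
      have : y (a, i) * z (b, i) * (y (u, l) * z (v, l))
          = y (a, i) * (z (b, i) * y (u, l)) * z (v, l) := by noncomm_ring
      rw [this, hzy, mul_add, add_mul, mul_smul_comm, ← mul_assoc, hyy, smul_mul_assoc,
        smul_mul_assoc, smul_mul_assoc, mul_assoc _ _ (z (v, l)), hzz (b, i)]
      simp only [mul_smul_comm, smul_smul]
      congr 1
      · congr 1
        rw [unitSign_eq_oscSign a b i l u v, mul_assoc _ (oscSign k (a, i) (v, l)),
          oscSign.eq_1 k (a, i) (v, l), superSign_mul_self, mul_one]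
        ring
      · by_cases hil : i = l <;> by_cases hbu : b = u <;> simp [hil, hbu]
    have h2 : y (u, l) * z (v, l) * (y (a, i) * z (b, i))
        = oscSign k (a, i) (v, l) • (y (u, l) * y (a, i) * (z (v, l) * z (b, i)))
          + if i = l then (if v = a then y (u, i) * z (b, i) else 0) else 0 := by
      have : y (u, l) * z (v, l) * (y (a, i) * z (b, i))
          = y (u, l) * (z (v, l) * y (a, i)) * z (b, i) := by noncomm_ring
      rw [this, hzy, mul_add, add_mul, mul_smul_comm, smul_mul_assoc, oscSign, superSign_comm]
      congr 1
      · rw [oscSign]; congr 1; noncomm_ring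
      · by_cases hil : i = l
        · by_cases hbu : v = a <;> simp [hil, hbu]
        · simp [hil, Ne.symm hil]
    rw [h1, h2, smul_add]
    abel
  simp only [Finset.sum_mul_sum]
  rw [Finset.sum_comm (f := fun l i => y (u, l) * z (v, l) * (y (a, i) * z (b, i))),
    Finset.smul_sum, ← Finset.sum_sub_distrib]
  simp only [Finset.smul_sum, ← Finset.sum_sub_distrib, key]
  simp only [Finset.sum_sub_distrib, Finset.sum_ite_eq, Finset.mem_univ, if_true, ← Finset.smul_sum]
  congr 1
  · split_ifs <;> simp
  · split_ifs <;> simp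

/-! ### Fock space -/

/-- The functions from exponents of the bosonic variables to `Λ`, on which the fermions act.  A function
stands for the sum of its values times the monomials.  Negative exponents are allowed and
there is no finiteness condition: only the relations of the operators and the vacuum matter. -/
def Fock (J Λ : Type*) : Type _ := (J → ℤ) → Λ

instance instAddCommGroupFock (J Λ : Type*) [AddCommGroup Λ] : AddCommGroup (Fock J Λ) :=
  inferInstanceAs (AddCommGroup ((J → ℤ) → Λ))

instance instModuleFock (R J Λ : Type*) [Semiring R] [AddCommGroup Λ] [Module R Λ] :
    Module R (Fock J Λ) :=
  inferInstanceAs (Module R ((J → ℤ) → Λ))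

instance instIsScalarTowerFock (k R J Λ : Type*) [Semiring k] [Semiring R] [AddCommGroup Λ]
    [Module R Λ] [Module k Λ] [SMul k R] [IsScalarTower k R Λ] : IsScalarTower k R (Fock J Λ) :=
  inferInstanceAs (IsScalarTower k R ((J → ℤ) → Λ))

/-- The value at an exponent. -/
def Fock.val {J Λ : Type*} (f : Fock J Λ) (d : J → ℤ) : Λ := f d

section Fock

theorem Fock.ext {J Λ : Type*} {f g : Fock J Λ} (h : ∀ d, f.val d = g.val d) : f = g := funext h

variable {R J Λ : Type*} [CommRing R] [AddCommGroup Λ] [Module R Λ]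

theorem Fock.val_add (f g : Fock J Λ) (d : J → ℤ) : (f + g).val d = f.val d + g.val d := rfl

theorem Fock.val_zero (d : J → ℤ) : (0 : Fock J Λ).val d = 0 := rfl

theorem Fock.val_smul (c : R) (f : Fock J Λ) (d : J → ℤ) : (c • f).val d = c • f.val d := rfl

/-- An operator on the coefficients, acting pointwise. -/
def pointwise (J : Type*) (T : Module.End R Λ) : Module.End R (Fock J Λ) where
  toFun f d := T (f.val d)
  map_add' f g := funext fun d => map_add T (f.val d) (g.val d)
  map_smul' c f := funext fun d => map_smul T c (f.val d)

theorem val_pointwise (T : Module.End R Λ) (f : Fock J Λ) (d : J → ℤ) :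
    (pointwise J T f).val d = T (f.val d) := rfl

theorem pointwise_anticomm {S T : Module.End R Λ} (h : S * T = -(T * S)) :
    pointwise J S * pointwise J T = -(pointwise J T * pointwise J S) :=
  LinearMap.ext fun f => funext fun d => LinearMap.congr_fun h (f.val d)

theorem pointwise_ccr {S T : Module.End R Λ} {p : Prop} [Decidable p]
    (h : S * T = -(T * S) + if p then 1 else 0) :
    pointwise J S * pointwise J T
      = -(pointwise J T * pointwise J S) + if p then 1 else 0 := by
  refine LinearMap.ext fun f => funext fun d => (LinearMap.congr_fun h (f.val d)).trans ?_
  split_ifs <;> rfl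

variable [DecidableEq J]

/-- Multiplication by the bosonic variable `x_j` on functions of the exponents. -/
def bosonMul (R Λ : Type*) [CommRing R] [AddCommGroup Λ] [Module R Λ] (j : J) :
    Module.End R (Fock J Λ) where
  toFun f d := f.val (d - Pi.single j 1)
  map_add' _ _ := rfl
  map_smul' _ _ := rfl

/-- The derivative with respect to the bosonic variable `x_j` on monomials whose exponents are
shifted by `κ`. -/
def bosonDer (Λ : Type*) [AddCommGroup Λ] [Module R Λ] (κ : J → R) (j : J) :
    Module.End R (Fock J Λ) where
  toFun f d := (((d j + 1 : ℤ) : R) + κ j) • f.val (d + Pi.single j 1)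
  map_add' f g := funext fun _ => smul_add _ (f.val _) (g.val _)
  map_smul' c f := funext fun _ => smul_comm _ c (f.val _)

theorem val_bosonMul (j : J) (f : Fock J Λ) (d : J → ℤ) :
    (bosonMul R Λ j f).val d = f.val (d - Pi.single j 1) := rfl

theorem val_bosonDer (κ : J → R) (j : J) (f : Fock J Λ) (d : J → ℤ) :
    (bosonDer Λ κ j f).val d = (((d j + 1 : ℤ) : R) + κ j) • f.val (d + Pi.single j 1) := rfl

theorem bosonMul_comm (a b : J) :
    bosonMul R Λ a * bosonMul R Λ b = bosonMul R Λ b * bosonMul R Λ a :=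
  LinearMap.ext fun f => Fock.ext fun d => by
    simp only [Module.End.mul_apply, val_bosonMul, sub_right_comm]

theorem bosonDer_comm (κ : J → R) (a b : J) :
    bosonDer Λ κ a * bosonDer Λ κ b = bosonDer Λ κ b * bosonDer Λ κ a := by
  by_cases h : a = b
  · rw [h]
  refine LinearMap.ext fun f => Fock.ext fun d => ?_
  simp [Module.End.mul_apply, val_bosonDer, h, Ne.symm h, smul_smul, mul_comm, add_right_comm d]

theorem bosonDer_bosonMul (κ : J → R) (a b : J) :
    bosonDer Λ κ a * bosonMul R Λ b
      = bosonMul R Λ b * bosonDer Λ κ a + if a = b then 1 else 0 := by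
  refine LinearMap.ext fun f => Fock.ext fun d => ?_
  by_cases h : a = b
  · subst h
    simp only [val_bosonDer, val_bosonMul, Module.End.mul_apply, if_true,
      LinearMap.add_apply, Fock.val_add, Module.End.one_apply, add_sub_cancel_right,
      sub_add_cancel, Pi.sub_apply, Pi.single_eq_same]
    conv_rhs => rw [← one_smul R (f.val d), smul_smul, ← add_smul]
    congr 1; push_cast; ring
  · simp [Module.End.mul_apply, val_bosonDer, val_bosonMul, h, sub_add_eq_add_sub]

theorem bosonMul_pointwise (a : J) (T : Module.End R Λ) :
    bosonMul R Λ a * pointwise J T = pointwise J T * bosonMul R Λ a := rfl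

theorem bosonDer_pointwise (κ : J → R) (a : J) (T : Module.End R Λ) :
    bosonDer Λ κ a * pointwise J T = pointwise J T * bosonDer Λ κ a :=
  LinearMap.ext fun f => Fock.ext fun d => by
    simp [Module.End.mul_apply, val_bosonDer, val_pointwise]

variable [Fintype J]

/-- The vacuum vector. -/
def vacuum (J : Type*) [DecidableEq J] [Fintype J] (w : Λ) : Fock J Λ :=
  (Pi.single 0 w : (J → ℤ) → Λ)

theorem val_vacuum (w : Λ) (d : J → ℤ) : (vacuum J w).val d = if d = 0 then w else 0 := by
  rw [Fock.val, vacuum, Pi.single_apply]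

theorem bosonDer_vacuum (κ : J → R) (j : J) (h : κ j = 0) (w : Λ) :
    bosonDer Λ κ j (vacuum J w) = 0 := by
  refine Fock.ext fun d => ?_
  rw [val_bosonDer, val_vacuum, Fock.val_zero]
  split_ifs with hd
  · have : d j + 1 = 0 := by simpa using congr_fun hd j
    rw [this, h]; simp
  · rw [smul_zero]

theorem pointwise_vacuum {T : Module.End R Λ} {w : Λ} (h : T w = 0) :
    pointwise J T (vacuum J w) = 0 := by
  refine Fock.ext fun d => ?_
  rw [val_pointwise, val_vacuum, Fock.val_zero]
  split_ifs
  · exact h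
  · exact map_zero T

theorem bosonMul_bosonDer_vacuum (κ : J → R) (j : J) (w : Λ) :
    bosonMul R Λ j (bosonDer Λ κ j (vacuum J w)) = κ j • vacuum J w := by
  refine Fock.ext fun d => ?_
  rw [val_bosonMul, val_bosonDer, sub_add_cancel, Fock.val_smul, val_vacuum]
  split_ifs with hd
  · subst hd; simp
  · simp

end Fock

/-- The exterior algebra as a module over the Clifford algebra of a hyperbolic space: operators with
the canonical anticommutation relations. -/
theorem exists_fermions {R : Type v} [CommRing R] (k : Type u) [Field k] [Algebra k R]
    (J : Type) [DecidableEq J] :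
    ∃ (Λ : Type v) (_ : AddCommGroup Λ) (_ : Module R Λ) (_ : Module k Λ) (_ : IsScalarTower k R Λ)
      (fm fd : J → Module.End R Λ) (w : Λ),
      (∀ a b, fm a * fm b = -(fm b * fm a)) ∧ (∀ a b, fd a * fd b = -(fd b * fd a)) ∧
      (∀ a b, fd a * fm b = -(fm b * fd a) + if a = b then 1 else 0) ∧ (∀ a, fd a w = 0) ∧
      ∀ c : R, c • w = 0 → c = 0 := by
  refine ⟨ExteriorAlgebra R (J → R), inferInstance, inferInstance, Module.compHom _ (algebraMap k R),
    ⟨fun x y z => ?_⟩,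
    fun a => LinearMap.mulLeft R (ExteriorAlgebra.ι R (Pi.single a 1)),
    fun a => CliffordAlgebra.contractLeft (LinearMap.proj a : (J → R) →ₗ[R] R), 1,
    fun a b => LinearMap.ext fun x => ?_,
    fun a b => LinearMap.ext fun x => CliffordAlgebra.contractLeft_comm _ _ _,
    fun a b => LinearMap.ext fun x => ?_, fun a => CliffordAlgebra.contractLeft_one _ _,
    fun c hc => ?_⟩
  · rw [Algebra.smul_def x y]; exact mul_smul _ _ _
  · change ExteriorAlgebra.ι R (Pi.single a 1) * (ExteriorAlgebra.ι R (Pi.single b 1) * x)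
      = -(ExteriorAlgebra.ι R (Pi.single b 1) * (ExteriorAlgebra.ι R (Pi.single a 1) * x))
    rw [← mul_assoc, ← mul_assoc, ← neg_mul,
      eq_neg_of_add_eq_zero_left (ExteriorAlgebra.ι_add_mul_swap _ _)]
  · refine (CliffordAlgebra.contractLeft_ι_mul _ _ _).trans ?_
    by_cases h : a = b
    · subst h
      rw [LinearMap.proj_apply, Pi.single_eq_same, one_smul, if_pos rfl, sub_eq_neg_add]
      rfl
    · rw [LinearMap.proj_apply, Pi.single_eq_of_ne h, zero_smul, if_neg h, sub_eq_neg_add]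
      rfl
  · rw [← Algebra.algebraMap_eq_smul_one] at hc
    exact (ExteriorAlgebra.algebraMap_eq_zero_iff _ _).1 hc

/-! ### Highest weight vectors of arbitrary weight -/

section Oscillators

variable {R Λ : Type*} [CommRing R] [Algebra k R] [AddCommGroup Λ] [Module R Λ] [Module k Λ]
  [IsScalarTower k R Λ] (κ : Fin (m + n) × Fin (m + n) → R)
  (fm fd : Fin (m + n) × Fin (m + n) → Module.End R Λ)

/-- The first oscillator of each pair: a creation operator for `j ≥ i` and an annihilation operator
for `j < i`, where `i` is the number of the copy; bosonic when `j` and `i` have the same parity.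
The fermions act through the operators `fm` and `fd`. -/
def oscY (a : Fin (m + n) × Fin (m + n)) :
    Module.End R (Fock (Fin (m + n) × Fin (m + n)) Λ) :=
  if parity m n a.1 = parity m n a.2 then
    if a.2 ≤ a.1 then bosonMul R Λ a else bosonDer Λ κ a
  else if a.2 ≤ a.1 then pointwise _ (fm a) else pointwise _ (fd a)

/-- The second oscillator of each pair, conjugate to the first one. -/
def oscZ (a : Fin (m + n) × Fin (m + n)) :
    Module.End R (Fock (Fin (m + n) × Fin (m + n)) Λ) :=
  if parity m n a.1 = parity m n a.2 then
    if a.2 ≤ a.1 then bosonDer Λ κ a else -bosonMul R Λ a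
  else if a.2 ≤ a.1 then pointwise _ (fd a) else pointwise _ (fm a)

theorem oscSign_eq (a b : Fin (m + n) × Fin (m + n)) :
    oscSign k a b = if parity m n a.1 = parity m n a.2 then 1 else
      if parity m n b.1 = parity m n b.2 then 1 else -1 := by
  have h : ∀ p q : ZMod 2, p + q = 1 ↔ ¬ p = q := by decide
  unfold oscSign superSign
  simp only [h]
  split_ifs <;> first | rfl | (exfalso; tauto)

variable {fm fd}
  (hmm : ∀ a b, pointwise (Fin (m + n) × Fin (m + n)) (fm a) * pointwise _ (fm b)
    = -(pointwise _ (fm b) * pointwise _ (fm a)))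
  (hdd : ∀ a b, pointwise (Fin (m + n) × Fin (m + n)) (fd a) * pointwise _ (fd b)
    = -(pointwise _ (fd b) * pointwise _ (fd a)))
  (hdm : ∀ a b, pointwise (Fin (m + n) × Fin (m + n)) (fd a) * pointwise _ (fm b)
    = -(pointwise _ (fm b) * pointwise _ (fd a)) + if a = b then 1 else 0)
include hmm hdd hdm

theorem oscY_oscY (a b : Fin (m + n) × Fin (m + n)) :
    oscY κ fm fd a * oscY κ fm fd b = oscSign k a b • (oscY κ fm fd b * oscY κ fm fd a) := by
  by_cases hab : a = b
  · subst hab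
    rw [oscSign_eq]
    unfold oscY
    split_ifs with h1 h2
    · rw [one_smul]
    · rw [one_smul]
    · rw [neg_one_smul]; exact hmm _ _
    · rw [neg_one_smul]; exact hdd _ _
  · rw [oscSign_eq]
    unfold oscY
    split_ifs <;> simp only [one_smul, neg_one_smul] <;>
    first
    | exact bosonMul_comm _ _
    | exact bosonDer_comm _ _ _
    | exact hmm _ _
    | exact hdd _ _
    | exact bosonMul_pointwise _ _
    | exact bosonDer_pointwise _ _ _
    | exact (bosonMul_pointwise _ _).symm
    | exact (bosonDer_pointwise _ _ _).symm
    | (rw [bosonDer_bosonMul, if_neg hab, add_zero])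
    | (rw [bosonDer_bosonMul, if_neg (Ne.symm hab), add_zero])
    | (rw [hdm, if_neg hab, add_zero])
    | (rw [hdm, if_neg (Ne.symm hab), add_zero, neg_neg])

theorem oscZ_oscZ (a b : Fin (m + n) × Fin (m + n)) :
    oscZ κ fm fd a * oscZ κ fm fd b = oscSign k a b • (oscZ κ fm fd b * oscZ κ fm fd a) := by
  by_cases hab : a = b
  · subst hab
    rw [oscSign_eq]
    unfold oscZ
    split_ifs with h1 h2
    · rw [one_smul]
    · rw [one_smul]
    · rw [neg_one_smul]; exact hdd _ _
    · rw [neg_one_smul]; exact hmm _ _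
  · rw [oscSign_eq]
    unfold oscZ
    split_ifs <;> simp only [one_smul, neg_one_smul, neg_mul, mul_neg, neg_neg, neg_inj] <;>
    first
    | exact bosonMul_comm _ _
    | exact bosonDer_comm _ _ _
    | exact hmm _ _
    | exact hdd _ _
    | exact bosonMul_pointwise _ _
    | exact bosonDer_pointwise _ _ _
    | exact (bosonMul_pointwise _ _).symm
    | exact (bosonDer_pointwise _ _ _).symm
    | (rw [bosonDer_bosonMul, if_neg hab, add_zero])
    | (rw [bosonDer_bosonMul, if_neg (Ne.symm hab), add_zero])
    | (rw [hdm, if_neg hab, add_zero])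
    | (rw [hdm, if_neg (Ne.symm hab), add_zero, neg_neg])

theorem oscZ_oscY (a b : Fin (m + n) × Fin (m + n)) :
    oscZ κ fm fd a * oscY κ fm fd b
      = oscSign k a b • (oscY κ fm fd b * oscZ κ fm fd a) + if a = b then 1 else 0 := by
  by_cases hab : a = b
  · subst hab
    rw [oscSign_eq, if_pos rfl]
    unfold oscY oscZ
    split_ifs with h1 h2
    · rw [one_smul, bosonDer_bosonMul, if_pos rfl]
    · rw [one_smul, neg_mul, mul_neg, bosonDer_bosonMul, if_pos rfl]; abel
    · rw [neg_one_smul, hdm, if_pos rfl]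
    · rw [neg_one_smul, hdm, if_pos rfl]; abel
  · rw [oscSign_eq, if_neg hab, add_zero]
    unfold oscZ oscY
    split_ifs <;> simp only [one_smul, neg_one_smul, neg_mul, mul_neg, neg_inj] <;>
    first
    | exact bosonMul_comm _ _
    | exact bosonDer_comm _ _ _
    | exact hmm _ _
    | exact hdd _ _
    | exact bosonMul_pointwise _ _
    | exact bosonDer_pointwise _ _ _
    | exact (bosonMul_pointwise _ _).symm
    | exact (bosonDer_pointwise _ _ _).symm
    | (rw [bosonDer_bosonMul, if_neg hab, add_zero])
    | (rw [bosonDer_bosonMul, if_neg (Ne.symm hab), add_zero])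
    | (rw [hdm, if_neg hab, add_zero])
    | (rw [hdm, if_neg (Ne.symm hab), add_zero, neg_neg])

/-- In the Fock representation the vacuum can be given any weight by shifting the exponents of the
variables `(i, i)`. -/
theorem oscillator_highest_weight_vector (lam : Fin (m + n) → R) (w : Λ) (hw : ∀ a, fd a w = 0) :
    ∃ φ : U k m n →ₐ[k] Module.End R (Fock (Fin (m + n) × Fin (m + n)) Λ),
      (∀ i, φ (e k i i) (vacuum _ w) = lam i • vacuum _ w) ∧
      ∀ i j, i < j → φ (e k i j) (vacuum _ w) = 0 := by
  -- the weight of the vacuum when all exponents are unshifted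
  let sh : Fin (m + n) → R := fun l =>
    ∑ i, if l < i then -algebraMap k R (oscSign k (l, i) (l, i)) else 0
  let κ : Fin (m + n) × Fin (m + n) → R := fun a => if a.1 = a.2 then lam a.1 - sh a.1 else 0
  have hzy := oscZ_oscY (k := k) κ hmm hdd hdm
  obtain ⟨φ, hφ⟩ := exists_lift (k := k) (fun j l => ∑ i, oscY κ fm fd (j, i) * oscZ κ fm fd (l, i))
    (oscillator_relation _ _ (oscY_oscY κ hmm hdd hdm) (oscZ_oscZ κ hmm hdd hdm) hzy)
  have hZ : ∀ l i, i < l → oscZ κ fm fd (l, i) (vacuum _ w) = 0 := by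
    intro l i h
    unfold oscZ
    rw [if_pos h.le, if_pos h.le]
    split_ifs
    · exact bosonDer_vacuum κ _ (if_neg h.ne') _
    · exact pointwise_vacuum (hw _)
  have hY : ∀ l i, l < i → oscY κ fm fd (l, i) (vacuum _ w) = 0 := by
    intro l i h
    unfold oscY
    rw [if_neg h.not_ge, if_neg h.not_ge]
    split_ifs
    · exact bosonDer_vacuum κ _ (if_neg h.ne) _
    · exact pointwise_vacuum (hw _)
  have hYZ : ∀ j l i, j < i → oscY κ fm fd (j, i) (oscZ κ fm fd (l, i) (vacuum _ w))
      = if l = j then -oscSign k (l, i) (l, i) • vacuum _ w else 0 := by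
    intro j l i h
    have h1 := congr_arg (fun T => oscSign k (l, i) (j, i) • T (vacuum _ w)) (hzy (l, i) (j, i))
    simp only [Module.End.mul_apply, LinearMap.add_apply, LinearMap.smul_apply, hY j i h, map_zero,
      smul_zero, smul_add, smul_smul] at h1
    rw [oscSign, superSign_mul_self, one_smul] at h1
    rw [← neg_eq_of_add_eq_zero_left h1.symm]
    by_cases hlj : l = j
    · subst hlj
      simp [oscSign]
    · simp [hlj]
  refine ⟨φ, fun l => ?_, fun j l hjl => ?_⟩
  · rw [hφ]
    simp only [LinearMap.sum_apply, Module.End.mul_apply]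
    have h1 : ∀ i, oscY κ fm fd (l, i) (oscZ κ fm fd (l, i) (vacuum _ w))
        = ((if i = l then lam l - sh l else 0)
          + if l < i then -algebraMap k R (oscSign k (l, i) (l, i)) else 0) • vacuum _ w := by
      intro i
      rcases lt_trichotomy i l with h | h | h
      · rw [hZ l i h, map_zero, if_neg h.ne, if_neg h.not_gt, add_zero, zero_smul]
      · subst h
        unfold oscY oscZ
        rw [if_pos rfl, if_pos le_rfl, if_pos rfl, if_pos le_rfl, bosonMul_bosonDer_vacuum]
        simp [κ]
      · rw [hYZ l l i h, if_pos rfl, if_neg h.ne', if_pos h, zero_add, neg_smul, neg_smul,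
          algebraMap_smul]
    simp only [h1, ← Finset.sum_smul, Finset.sum_add_distrib, Finset.sum_ite_eq', Finset.mem_univ,
      if_true]
    rw [sub_add_cancel]
  · rw [hφ]
    simp only [LinearMap.sum_apply, Module.End.mul_apply]
    refine Finset.sum_eq_zero fun i _ => ?_
    rcases lt_or_ge i l with h | h
    · rw [hZ l i h, map_zero]
    · rw [hYZ j l i (hjl.trans_le h), if_neg hjl.ne']

end Oscillators

/-- For every commutative `k`-algebra `R` and every weight with coordinates in `R` there is a
representation of `U(g)` over `R` with a torsion-free vector of this weight killed by `n^+`. -/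
theorem exists_highest_weight_vector {k : Type u} [Field k] {m n : ℕ} {R : Type v} [CommRing R]
    [Algebra k R] (lam : Fin (m + n) → R) :
    ∃ (M : Type v) (_ : AddCommGroup M) (_ : Module R M) (_ : Module k M) (_ : IsScalarTower k R M)
      (φ : U k m n →ₐ[k] Module.End R M) (v : M),
      (∀ c : R, c • v = 0 → c = 0) ∧ (∀ i, φ (e k i i) v = lam i • v) ∧
      ∀ i j, i < j → φ (e k i j) v = 0 := by
  obtain ⟨Λ, _, _, _, _, fm, fd, w, hmm, hdd, hdm, hw, htf⟩ :=
    exists_fermions (R := R) k (Fin (m + n) × Fin (m + n))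
  obtain ⟨φ, h1, h2⟩ := oscillator_highest_weight_vector (k := k) (m := m) (n := n)
    (fun a b => pointwise_anticomm (hmm a b)) (fun a b => pointwise_anticomm (hdd a b))
    (fun a b => pointwise_ccr (hdm a b)) lam w hw
  refine ⟨_, inferInstance, inferInstance, inferInstance, inferInstance, φ, _, fun c hc => ?_, h1, h2⟩
  have h0 := congr_arg (fun f => Fock.val f 0) hc
  simp only [Fock.val_smul, val_vacuum, if_true, Fock.val_zero] at h0
  exact htf c h0

end

/-! ### Words in the negative root vectors -/

section

variable {k : Type*} [Field k] {m n : ℕ}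

/-- The product `e_{-α_1} ⋯ e_{-α_l}` for a list of positive roots. -/
def wordProd (k : Type*) [Field k] {m n : ℕ} (w : List (PosRoot m n)) : U k m n :=
  (w.map (eNeg k)).prod

/-- The sum of the roots of a word. -/
def wordWt {m n : ℕ} (w : List (PosRoot m n)) : Fin (m + n) → ℤ := (w.map (wt ℤ)).sum

theorem wordProd_nil : wordProd k ([] : List (PosRoot m n)) = 1 := rfl

theorem wordProd_cons (α : PosRoot m n) (w : List (PosRoot m n)) :
    wordProd k (α :: w) = eNeg k α * wordProd k w := by
  rw [wordProd, List.map_cons, List.prod_cons]; rfl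

theorem wordWt_nil : wordWt ([] : List (PosRoot m n)) = 0 := rfl

theorem wordWt_cons (α : PosRoot m n) (w : List (PosRoot m n)) :
    wordWt (α :: w) = wt ℤ α + wordWt w := by
  rw [wordWt, List.map_cons, List.sum_cons]; rfl

theorem wordWt_perm {w w' : List (PosRoot m n)} (h : w.Perm w') : wordWt w = wordWt w' :=
  (h.map _).sum_eq

/-- The coefficient of a weight at the simple root joining `p` and `p + 1`. -/
def cut {m n : ℕ} (p : Fin (m + n)) : (Fin (m + n) → ℤ) →+ ℤ where
  toFun β := ∑ i with i ≤ p, β i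
  map_zero' := by simp
  map_add' β β' := by simp [Finset.sum_add_distrib]

/-- The simple root joining `p` and `p + 1` occurs in `α`. -/
def Crosses {m n : ℕ} (p : Fin (m + n)) (α : PosRoot m n) : Prop := α.1.1 ≤ p ∧ p < α.1.2

instance instDecidableCrosses {m n : ℕ} (p : Fin (m + n)) (α : PosRoot m n) :
    Decidable (Crosses p α) := inferInstanceAs (Decidable (_ ∧ _))

theorem cut_wt (p : Fin (m + n)) (α : PosRoot m n) :
    cut p (wt ℤ α) = if Crosses p α then 1 else 0 := by
  have h := α.2
  simp only [cut, wt, AddMonoidHom.coe_mk, ZeroHom.coe_mk, Pi.sub_apply, Finset.sum_sub_distrib,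
    Pi.single_apply, Finset.sum_ite_eq', Finset.mem_filter, Finset.mem_univ, true_and, Crosses]
  split_ifs <;> omega

theorem cut_wordWt (p : Fin (m + n)) (w : List (PosRoot m n)) :
    cut p (wordWt w) = (w.countP fun α => Crosses p α : ℕ) := by
  induction w with
  | nil => simp [wordWt_nil]
  | cons α w ih =>
    rw [wordWt_cons, map_add, ih, cut_wt, List.countP_cons, add_comm]
    simp

theorem eq_nil_of_wordWt_eq_zero {w : List (PosRoot m n)} (h : wordWt w = 0) : w = [] := by
  cases w with
  | nil => rfl
  | cons α w =>
    have h1 := cut_wordWt α.1.1 (α :: w)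
    rw [h, map_zero, List.countP_cons, if_pos (by simpa [Crosses] using α.2)] at h1
    omega

section WordOfRoot

variable {γ : PosRoot m n} {w : List (PosRoot m n)} (hw : wordWt w = wt ℤ γ)
include hw

theorem countP_crosses (p : Fin (m + n)) :
    (w.countP fun α => Crosses p α) = if Crosses p γ then 1 else 0 := by
  have h := cut_wordWt p w
  rw [hw, cut_wt] at h
  split_ifs at h ⊢ <;> omega

theorem crosses_of_mem {α : PosRoot m n} (hα : α ∈ w) {p : Fin (m + n)} (hp : Crosses p α) :
    Crosses p γ := by
  by_contra hγ
  have h := countP_crosses hw p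
  rw [if_neg hγ, List.countP_eq_zero] at h
  exact h α hα (by simpa using hp)

theorem mem_interval_of_mem {α : PosRoot m n} (hα : α ∈ w) : γ.1.1 ≤ α.1.1 ∧ α.1.2 ≤ γ.1.2 := by
  have h1 := crosses_of_mem hw hα ⟨le_rfl, α.2⟩
  refine ⟨h1.1, ?_⟩
  by_contra h
  exact absurd (crosses_of_mem hw hα ⟨h1.2.le, not_le.1 h⟩).2 (lt_irrefl _)

theorem nodup_of_wordWt_eq : w.Nodup := by
  rw [List.nodup_iff_count_le_one]
  intro α
  have h1 : w.count α ≤ w.countP fun β => Crosses α.1.1 β := by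
    refine List.countP_mono_left fun β _ hβ => ?_
    rw [beq_iff_eq] at hβ
    subst hβ
    exact decide_eq_true ⟨le_rfl, β.2⟩
  have h2 := countP_crosses hw α.1.1
  split_ifs at h2 <;> omega

/-- Two different roots of a word of weight `γ` have disjoint supports. -/
theorem not_crosses_of_mem {α β : PosRoot m n} (hα : α ∈ w) (hβ : β ∈ w) (hne : α ≠ β)
    {p : Fin (m + n)} (hp : Crosses p α) : ¬ Crosses p β := by
  intro hpβ
  have h2 := countP_crosses hw p
  have h3 := (List.perm_cons_erase hα).countP_eq (fun α => decide (Crosses p α))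
  rw [List.countP_cons_of_pos (by simpa using hp)] at h3
  have h4 : 0 < (w.erase α).countP fun α => Crosses p α :=
    List.countP_pos_iff.2 ⟨β, (List.mem_erase_of_ne hne.symm).2 hβ, by simpa using hpβ⟩
  split_ifs at h2 <;> omega

theorem eq_singleton_of_mem (hγ : γ ∈ w) : w = [γ] := by
  have h0 := nodup_of_wordWt_eq hw
  have h : ∀ α ∈ w, α = γ := by
    intro α hα
    by_contra hne
    exact not_crosses_of_mem hw hα hγ hne ⟨le_rfl, α.2⟩ (crosses_of_mem hw hα ⟨le_rfl, α.2⟩)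
  rw [List.eq_replicate_iff.2 ⟨rfl, h⟩] at h0 ⊢
  rw [List.nodup_replicate] at h0
  have : w.length ≠ 0 := by
    rw [Ne, List.length_eq_zero_iff]; rintro rfl; simp at hγ
  rw [show w.length = 1 by omega]; rfl

end WordOfRoot

/-- The word of a partition, ordered by the list `L`. -/
def partWord {m n : ℕ} (L : List (PosRoot m n)) {γ : PosRoot m n} (π : RootPartition γ) :
    List (PosRoot m n) := L.flatMap fun α => List.replicate (π.1 α) α

theorem ePart_eq_wordProd (L : List (PosRoot m n)) {γ : PosRoot m n} (π : RootPartition γ) :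
    ePart k L π = wordProd k (partWord L π) := by
  simp [ePart, wordProd, partWord, List.flatMap, List.prod_flatten,
    List.map_map, Function.comp_def]

section PartWord

variable {L : List (PosRoot m n)} (hnodup : L.Nodup) (hall : ∀ α, α ∈ L) {γ : PosRoot m n}
include hnodup hall

theorem wordWt_partWord (π : RootPartition γ) : wordWt (partWord L π) = wt ℤ γ := by
  rw [← π.2.2, ← Finset.sum_map_toList]
  have hp : Finset.univ.toList.Perm L := by
    rw [List.perm_ext_iff_of_nodup (Finset.nodup_toList _) hnodup]
    intro α; simp [hall]
  rw [(hp.map _).sum_eq]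
  simp [wordWt, partWord, List.flatMap, List.sum_flatten,
    List.map_map, Function.comp_def]

theorem count_partWord (π : RootPartition γ) (α : PosRoot m n) :
    (partWord L π).count α = π.1 α := by
  rw [partWord, List.count_flatMap]
  have : ∀ (L : List (PosRoot m n)), L.Nodup →
      (L.map (List.count α ∘ fun α => List.replicate (π.1 α) α)).sum = if α ∈ L then π.1 α else 0 := by
    intro L hL
    induction L with
    | nil => simp
    | cons β L ih =>
      rw [List.nodup_cons] at hL
      rw [List.map_cons, List.sum_cons, ih hL.2]
      by_cases h : β = α
      · subst h; simp [hL.1]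
      · simp only [Function.comp_apply, List.count_replicate, beq_iff_eq, h, if_false, zero_add,
          List.mem_cons, Ne.symm h, false_or]
  rw [this L hnodup, if_pos (hall α)]

theorem partWord_perm_iff {π π' : RootPartition γ} :
    (partWord L π).Perm (partWord L π') ↔ π = π' := by
  refine ⟨fun h => Subtype.ext <| funext fun α => ?_, fun h => h ▸ List.Perm.refl _⟩
  rw [← count_partWord hnodup hall π, ← count_partWord hnodup hall π', h.count_eq]

end PartWord

end

/-! ### The degree of words along a line of weights -/

section

open Polynomial

variable {k : Type u} [Field k] {m n : ℕ}

section Line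

variable {M : Type v} [AddCommGroup M] [Module k[X] M] [Module k M] [IsScalarTower k k[X] M]

/-- The span of the vectors `c t^i e_{-w} v` for the words `w` of weight `β` with `2 i + |w| < d`.
Here `t` is the parameter of the line of weights; it has degree `2`, and the root vectors have
degree `1`. -/
def lowerSpan (φ : U k m n →ₐ[k] Module.End k[X] M) (v : M) (β : Fin (m + n) → ℤ) (d : ℕ) :
    AddSubgroup M :=
  AddSubgroup.closure {x | ∃ (w : List (PosRoot m n)) (i : ℕ) (c : k), wordWt w = β ∧
    2 * i + w.length < d ∧ x = (monomial i c : k[X]) • φ (wordProd k w) v}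

variable {φ : U k m n →ₐ[k] Module.End k[X] M} {v : M}

theorem monomial_smul_mem_lowerSpan (w : List (PosRoot m n)) (i : ℕ) (c : k) {d : ℕ}
    (h : 2 * i + w.length < d) :
    (monomial i c : k[X]) • φ (wordProd k w) v ∈ lowerSpan φ v (wordWt w) d :=
  AddSubgroup.subset_closure ⟨w, i, c, rfl, h, rfl⟩

theorem lowerSpan_mono {β : Fin (m + n) → ℤ} {d d' : ℕ} (h : d ≤ d') :
    lowerSpan φ v β d ≤ lowerSpan φ v β d' := by
  refine AddSubgroup.closure_mono ?_
  rintro x ⟨w, i, c, h1, h2, h3⟩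
  exact ⟨w, i, c, h1, h2.trans_le h, h3⟩

theorem monomial_smul_lowerSpan {β : Fin (m + n) → ℤ} {d : ℕ} {x : M} (hx : x ∈ lowerSpan φ v β d)
    (i : ℕ) (c : k) : (monomial i c : k[X]) • x ∈ lowerSpan φ v β (2 * i + d) := by
  induction hx using AddSubgroup.closure_induction with
  | mem x hx =>
    obtain ⟨w, j, c', rfl, h, rfl⟩ := hx
    rw [smul_smul, monomial_mul_monomial]
    exact monomial_smul_mem_lowerSpan _ _ _ (by omega)
  | zero => rw [smul_zero]; exact zero_mem _
  | add x y _ _ hx hy => rw [smul_add]; exact add_mem hx hy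
  | neg x _ hx => rw [smul_neg]; exact neg_mem hx

theorem smul_lowerSpan {β : Fin (m + n) → ℤ} {d : ℕ} {x : M} (hx : x ∈ lowerSpan φ v β d)
    (c : k) : c • x ∈ lowerSpan φ v β d := by
  have h := monomial_smul_lowerSpan hx 0 c
  rw [monomial_zero_left, ← algebraMap_eq, algebraMap_smul] at h
  simpa using h

theorem eNeg_lowerSpan {β : Fin (m + n) → ℤ} {d : ℕ} {x : M} (hx : x ∈ lowerSpan φ v β d)
    (α : PosRoot m n) : φ (eNeg k α) x ∈ lowerSpan φ v (wt ℤ α + β) (d + 1) := by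
  induction hx using AddSubgroup.closure_induction with
  | mem x hx =>
    obtain ⟨w, j, c', rfl, h, rfl⟩ := hx
    rw [map_smul, ← Module.End.mul_apply, ← map_mul, ← wordProd_cons, ← wordWt_cons]
    exact monomial_smul_mem_lowerSpan _ _ _ (by rw [List.length_cons]; omega)
  | zero => rw [map_zero]; exact zero_mem _
  | add x y _ _ hx hy => rw [map_add]; exact add_mem hx hy
  | neg x _ hx => rw [map_neg]; exact neg_mem hx

theorem exists_of_mem_lowerSpan_zero {d : ℕ} {x : M} (hx : x ∈ lowerSpan φ v 0 d) :
    ∃ s : k[X], x = s • v ∧ ∀ i, s.coeff i ≠ 0 → 2 * i < d := by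
  induction hx using AddSubgroup.closure_induction with
  | mem x hx =>
    obtain ⟨w, j, c', hw, h, rfl⟩ := hx
    rw [eq_nil_of_wordWt_eq_zero hw] at h ⊢
    refine ⟨monomial j c', by rw [wordProd_nil, map_one, Module.End.one_apply], fun i hi => ?_⟩
    rw [coeff_monomial] at hi
    split_ifs at hi with hij
    · simp at h; omega
    · exact absurd rfl hi
  | zero => exact ⟨0, by simp, by simp⟩
  | add x y _ _ hx hy =>
    obtain ⟨s, rfl, hs⟩ := hx
    obtain ⟨t, rfl, ht⟩ := hy
    refine ⟨s + t, (add_smul _ _ _).symm, fun i hi => ?_⟩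
    rw [coeff_add] at hi
    by_cases h : s.coeff i = 0
    · exact ht i (by simpa [h] using hi)
    · exact hs i h
  | neg x _ hx =>
    obtain ⟨s, rfl, hs⟩ := hx
    exact ⟨-s, (neg_smul _ _).symm, fun i hi => hs i (by simpa using hi)⟩

variable {l0 mu : Fin (m + n) → k} (hv : ∀ i, φ (e k i i) v = (C (l0 i) + X * C (mu i)) • v)
include hv

theorem e_diag_word (w : List (PosRoot m n)) (i : Fin (m + n)) :
    φ (e k i i) (φ (wordProd k w) v)
      = (C (l0 i) + X * C (mu i) - C ((wordWt w i : ℤ) : k)) • φ (wordProd k w) v := by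
  induction w with
  | nil => simp [wordProd_nil, wordWt_nil, hv]
  | cons α w ih =>
    rw [wordProd_cons, map_mul, Module.End.mul_apply, ← Module.End.mul_apply, ← map_mul, eNeg,
      e_diag_mul, map_mul, map_add, AlgHom.commutes, Module.End.mul_apply, LinearMap.add_apply, ih,
      Module.algebraMap_end_apply, ← algebraMap_smul k[X] (_ : k), ← add_smul, map_smul,
      algebraMap_eq, wordWt_cons]
    congr 1
    rw [sub_add, ← C_sub, Pi.add_apply, wt, Pi.sub_apply, Pi.single_apply, Pi.single_apply]
    congr 2
    push_cast
    split_ifs <;> ring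

variable (hn : ∀ i j, i < j → φ (e k i j) v = 0)
include hn

/-- A matrix unit raises the degree of a word by at most `1`, and a diagonal one by at most `2`. -/
theorem e_word_mem (w : List (PosRoot m n)) (x y : Fin (m + n)) :
    φ (e k x y) (φ (wordProd k w) v) ∈
      lowerSpan φ v (wordWt w - (Pi.single x 1 - Pi.single y 1)) (w.length + if x = y then 3 else 2) := by
  have hdiag : ∀ (w : List (PosRoot m n)) x, φ (e k x x) (φ (wordProd k w) v) ∈
      lowerSpan φ v (wordWt w - (Pi.single x 1 - Pi.single x 1)) (w.length + 3) := by
    intro w x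
    rw [e_diag_word hv, sub_self, sub_zero, add_sub_right_comm, ← C_sub, add_smul]
    refine add_mem ?_ ?_
    · rw [← monomial_zero_left]
      exact monomial_smul_mem_lowerSpan _ _ _ (by omega)
    · rw [X_mul_C, C_mul_X_eq_monomial]
      exact monomial_smul_mem_lowerSpan _ _ _ (by omega)
  have hneg : ∀ (w : List (PosRoot m n)) x y, y < x → φ (e k x y) (φ (wordProd k w) v) ∈
      lowerSpan φ v (wordWt w - (Pi.single x 1 - Pi.single y 1)) (w.length + 2) := by
    intro w x y h
    have := monomial_smul_mem_lowerSpan (φ := φ) (v := v) (⟨(y, x), h⟩ :: w) 0 1 (d := w.length + 2)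
      (by rw [List.length_cons]; omega)
    rw [monomial_zero_left, C_1, one_smul, wordProd_cons, map_mul, Module.End.mul_apply,
      wordWt_cons] at this
    convert this using 2
    · rw [wt]; abel
    · rfl
  induction w generalizing x y with
  | nil =>
    rcases lt_trichotomy x y with h | rfl | h
    · rw [wordProd_nil, map_one, Module.End.one_apply, hn x y h]; exact zero_mem _
    · rw [if_pos rfl]; exact hdiag _ _
    · rw [if_neg h.ne']; exact hneg _ _ _ h
  | cons α w ih =>
    rcases lt_trichotomy x y with h | rfl | h
    · rw [if_neg h.ne, wordProd_cons, map_mul, Module.End.mul_apply, ← Module.End.mul_apply,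
        ← map_mul, eNeg, e_mul_e]
      simp only [map_sub, map_add, map_smul, LinearMap.sub_apply, LinearMap.add_apply,
        LinearMap.smul_apply, map_mul, Module.End.mul_apply]
      have ih' : ∀ x y, φ (e k x y) (φ (wordProd k w) v) ∈
          lowerSpan φ v (wordWt w - (Pi.single x 1 - Pi.single y 1)) (w.length + 3) := by
        intro x y
        exact lowerSpan_mono (by split_ifs <;> omega) (ih x y)
      refine sub_mem (add_mem (smul_lowerSpan ?_ _) ?_) (smul_lowerSpan ?_ _)
      · have := eNeg_lowerSpan (ih x y) α
        rw [if_neg h.ne] at this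
        rw [wordWt_cons, add_sub_assoc]
        exact lowerSpan_mono (by simp) this
      · split_ifs with hy
        · subst hy
          convert ih' x α.1.1 using 2
          · rw [wordWt_cons, wt]; abel
          · rfl
        · rw [map_zero, LinearMap.zero_apply]; exact zero_mem _
      · split_ifs with hy
        · subst hy
          convert ih' α.1.2 y using 2
          · rw [wordWt_cons, wt]; abel
          · rfl
        · rw [map_zero, LinearMap.zero_apply]; exact zero_mem _
    · rw [if_pos rfl]; exact hdiag _ _
    · rw [if_neg h.ne']; exact hneg _ _ _ h

/-- The operator `e_α` does not raise the degree of a word that does not contain `α`. -/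
theorem e_word_mem_of_notMem (w : List (PosRoot m n)) (α : PosRoot m n) (hα : α ∉ w) :
    φ (e k α.1.1 α.1.2) (φ (wordProd k w) v) ∈
      lowerSpan φ v (wordWt w - wt ℤ α) (w.length + 1) := by
  induction w with
  | nil =>
    rw [wordProd_nil, map_one, Module.End.one_apply, hn _ _ α.2]; exact zero_mem _
  | cons β w ih =>
    rw [List.mem_cons, not_or] at hα
    rw [wordProd_cons, map_mul, Module.End.mul_apply, ← Module.End.mul_apply,
      ← map_mul, eNeg, e_mul_e]
    simp only [map_sub, map_add, map_smul, LinearMap.sub_apply, LinearMap.add_apply,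
      LinearMap.smul_apply, map_mul, Module.End.mul_apply]
    refine sub_mem (add_mem (smul_lowerSpan ?_ _) ?_) (smul_lowerSpan ?_ _)
    · have := eNeg_lowerSpan (ih hα.2) β
      rw [wordWt_cons, add_sub_assoc]
      exact lowerSpan_mono (by simp) this
    · split_ifs with hy
      · have h1 := e_word_mem hv hn w α.1.1 β.1.1
        rw [if_neg fun h => hα.1 (Subtype.ext (Prod.ext h hy))] at h1
        convert h1 using 2
        · rw [wordWt_cons, wt, wt, hy]; abel
        · rfl
      · rw [map_zero, LinearMap.zero_apply]; exact zero_mem _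
    · split_ifs with hy
      · have h1 := e_word_mem hv hn w β.1.2 α.1.2
        rw [if_neg fun h => hα.1 (Subtype.ext (Prod.ext hy.symm h.symm))] at h1
        convert h1 using 2
        · rw [wordWt_cons, wt, wt, hy]; abel
        · rfl
      · rw [map_zero, LinearMap.zero_apply]; exact zero_mem _

/-- Up to lower terms, `e_α` deletes the letter `α` from a word and multiplies by a multiple of `t`,
which is nonzero unless `h_α` vanishes on the direction of the line. -/
theorem e_word_sub_mem (w : List (PosRoot m n)) (hw : w.Nodup) (α : PosRoot m n) (hα : α ∈ w) :
    ∃ c : k, (mu α.1.1 - unitSign k α.1.1 α.1.2 α.1.2 α.1.1 * mu α.1.2 ≠ 0 → c ≠ 0) ∧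
    φ (e k α.1.1 α.1.2) (φ (wordProd k w) v)
        - (monomial 1 c : k[X]) • φ (wordProd k (w.erase α)) v ∈
      lowerSpan φ v (wordWt w - wt ℤ α) (w.length + 1) := by
  induction w with
  | nil => simp at hα
  | cons β w ih =>
    rw [List.nodup_cons] at hw
    rw [wordProd_cons, map_mul, Module.End.mul_apply, ← Module.End.mul_apply,
      ← map_mul, eNeg, e_mul_e]
    simp only [map_sub, map_add, map_smul, LinearMap.sub_apply, LinearMap.add_apply,
      LinearMap.smul_apply, map_mul, Module.End.mul_apply]
    by_cases hβ : α = β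
    · subst hβ
      refine ⟨_, id, ?_⟩
      rw [if_pos rfl, if_pos rfl, e_diag_word hv, e_diag_word hv, List.erase_cons_head,
        add_sub_assoc, add_sub_assoc, ← algebraMap_smul k[X] (unitSign k _ _ _ _) (_ • φ (wordProd k w) v),
        smul_smul, ← sub_smul, ← sub_smul]
      refine add_mem (smul_lowerSpan ?_ _) ?_
      · have := eNeg_lowerSpan (e_word_mem_of_notMem hv hn w α hw.1) α
        rw [wordWt_cons, add_sub_assoc]
        exact lowerSpan_mono (by simp) this
      · generalize unitSign k _ _ _ _ = s
        have : ∀ x y a b : k, (C x + X * C (mu α.1.1) - C a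
              - algebraMap k k[X] s * (C y + X * C (mu α.1.2) - C b)
              - monomial 1 (mu α.1.1 - s * mu α.1.2) : k[X]) = monomial 0 (x - a - s * (y - b)) := by
          intro x y a b
          rw [← C_mul_X_eq_monomial, monomial_zero_left, algebraMap_eq]
          simp only [C_sub, C_mul]
          ring
        rw [this, wordWt_cons, add_sub_cancel_left]
        exact monomial_smul_mem_lowerSpan _ _ _ (by simp)
    · have hαw : α ∈ w := (List.mem_cons.1 hα).resolve_left hβ
      obtain ⟨c, hc, hmem⟩ := ih hw.2 hαw
      refine ⟨unitSign k α.1.1 α.1.2 β.1.2 β.1.1 * c, fun h => mul_ne_zero ?_ (hc h), ?_⟩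
      · unfold unitSign superSign; split_ifs <;> simp
      have he : e k β.1.2 β.1.1 = eNeg k β := rfl
      rw [List.erase_cons_tail (by rw [beq_iff_eq]; exact Ne.symm hβ), wordProd_cons, map_mul φ,
        Module.End.mul_apply, ← smul_eq_mul, ← smul_monomial, smul_assoc, ← map_smul (φ (eNeg k β)),
        show ∀ a b c d : M, a + b - c - d = (a - d) + (b - c) from fun a b c d => by abel,
        ← smul_sub, he, ← map_sub]
      refine add_mem (smul_lowerSpan ?_ _) (sub_mem ?_ (smul_lowerSpan ?_ _))
      · have := eNeg_lowerSpan hmem β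
        rw [wordWt_cons, add_sub_assoc]
        exact lowerSpan_mono (by simp) this
      · split_ifs with hy
        · have h1 := e_word_mem hv hn w α.1.1 β.1.1
          rw [if_neg fun h => hβ (Subtype.ext (Prod.ext h hy))] at h1
          convert h1 using 2
          · rw [wordWt_cons, wt, wt, hy]; abel
          · rfl
        · rw [map_zero, LinearMap.zero_apply]; exact zero_mem _
      · split_ifs with hy
        · have h1 := e_word_mem hv hn w β.1.2 α.1.2
          rw [if_neg fun h => hβ (Subtype.ext (Prod.ext hy.symm h.symm))] at h1
          convert h1 using 2
          · rw [wordWt_cons, wt, wt, hy]; abel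
          · rfl
        · rw [map_zero, LinearMap.zero_apply]; exact zero_mem _

theorem e_lowerSpan {β : Fin (m + n) → ℤ} {d : ℕ} {x : M} (hx : x ∈ lowerSpan φ v β d)
    (α : PosRoot m n) : φ (e k α.1.1 α.1.2) x ∈ lowerSpan φ v (β - wt ℤ α) (d + 1) := by
  induction hx using AddSubgroup.closure_induction with
  | mem x hx =>
    obtain ⟨w, j, c', rfl, h, rfl⟩ := hx
    rw [map_smul]
    have h1 := e_word_mem hv hn w α.1.1 α.1.2
    rw [if_neg α.2.ne] at h1
    exact lowerSpan_mono (by omega) (monomial_smul_lowerSpan h1 j c')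
  | zero => rw [map_zero]; exact zero_mem _
  | add x y _ _ hx hy => rw [map_add]; exact add_mem hx hy
  | neg x _ hx => rw [map_neg]; exact neg_mem hx

end Line

end

/-! ### Singular vectors along a line of weights -/

section

open Polynomial

variable {k : Type u} [Field k] {m n : ℕ}

/-- The product `e_{α_l} ⋯ e_{α_1}` of positive root vectors for a list `α_1, …, α_l`. -/
def raiseProd (k : Type*) [Field k] {m n : ℕ} : List (PosRoot m n) → U k m n
  | [] => 1
  | α :: σ => raiseProd k σ * e k α.1.1 α.1.2

section Line

variable {M : Type v} [AddCommGroup M] [Module k[X] M] [Module k M] [IsScalarTower k k[X] M]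
variable {φ : U k m n →ₐ[k] Module.End k[X] M} {v : M}
  {l0 mu : Fin (m + n) → k} (hv : ∀ i, φ (e k i i) v = (C (l0 i) + X * C (mu i)) • v)
  (hn : ∀ i j, i < j → φ (e k i j) v = 0)
include hv hn

theorem raiseProd_lowerSpan (σ : List (PosRoot m n)) {β : Fin (m + n) → ℤ} {d : ℕ} {x : M}
    (hx : x ∈ lowerSpan φ v β d) :
    φ (raiseProd k σ) x ∈ lowerSpan φ v (β - wordWt σ) (d + σ.length) := by
  induction σ generalizing x β d with
  | nil => simpa [raiseProd, wordWt_nil] using hx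
  | cons α σ ih =>
    rw [raiseProd, map_mul, Module.End.mul_apply, wordWt_cons, ← sub_sub, List.length_cons,
      add_comm σ.length, ← add_assoc]
    exact ih (e_lowerSpan hv hn hx α)

/-- The matrix coefficients `e_σ e_{-w} v` have degree at most `(|σ| + |w|) / 2` in the parameter of
the line, and this degree is attained only if `σ` and `w` have the same letters. -/
theorem raiseProd_word (σ w : List (PosRoot m n)) (hw : w.Nodup) (h : wordWt σ = wordWt w) :
    ∃ c : k, (σ.Perm w →
        (∀ α ∈ σ, mu α.1.1 - unitSign k α.1.1 α.1.2 α.1.2 α.1.1 * mu α.1.2 ≠ 0) → c ≠ 0) ∧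
      (¬ σ.Perm w → c = 0) ∧
      φ (raiseProd k σ) (φ (wordProd k w) v) - (monomial σ.length c : k[X]) • v ∈
        lowerSpan φ v 0 (σ.length + w.length) := by
  induction σ generalizing w with
  | nil =>
    rw [wordWt_nil] at h
    obtain rfl := eq_nil_of_wordWt_eq_zero h.symm
    refine ⟨1, fun _ _ => one_ne_zero, fun h => absurd (List.Perm.refl _) h, ?_⟩
    rw [raiseProd, wordProd_nil, map_one, Module.End.one_apply, Module.End.one_apply,
      List.length_nil, monomial_zero_left, C_1, one_smul, sub_self]
    exact zero_mem _
  | cons α σ ih =>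
    rw [wordWt_cons] at h
    rw [raiseProd, map_mul, Module.End.mul_apply]
    have h0 : wordWt w - wt ℤ α - wordWt σ = 0 := by rw [← h]; abel
    by_cases hα : α ∈ w
    · obtain ⟨c1, hc1, h1⟩ := e_word_sub_mem hv hn w hw α hα
      have hp := List.perm_cons_erase hα
      have hlen := hp.length_eq
      rw [List.length_cons] at hlen
      obtain ⟨c2, hc2, hc2', h2⟩ := ih (w.erase α) (hw.erase α) (by
        rw [wordWt_perm hp, wordWt_cons] at h
        exact add_left_cancel h)
      refine ⟨c1 * c2, fun hp hg => mul_ne_zero (hc1 (hg α List.mem_cons_self))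
        (hc2 (List.cons_perm_iff_perm_erase.1 hp).2 fun β hβ => hg β (List.mem_cons_of_mem _ hβ)),
        fun hp => ?_, ?_⟩
      · rw [hc2' fun h => hp (List.cons_perm_iff_perm_erase.2 ⟨hα, h⟩), mul_zero]
      · have h3 := raiseProd_lowerSpan hv hn σ h1
        rw [h0] at h3
        have h4 := monomial_smul_lowerSpan h2 1 c1
        have h5 := add_mem (lowerSpan_mono (d' := (α :: σ).length + w.length)
          (by rw [List.length_cons]; omega) h3) (lowerSpan_mono (d' := (α :: σ).length + w.length)
          (by rw [List.length_cons]; omega) h4)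
        convert h5 using 1
        rw [map_sub, map_smul, smul_sub, smul_smul, monomial_mul_monomial, List.length_cons,
          add_comm 1]
        abel
    · refine ⟨0, fun hp _ => absurd (hp.subset List.mem_cons_self) hα, fun _ => rfl, ?_⟩
      have h3 := raiseProd_lowerSpan hv hn σ (e_word_mem_of_notMem hv hn w α hα)
      rw [h0] at h3
      rw [monomial_zero_right, zero_smul, sub_zero]
      exact lowerSpan_mono (by rw [List.length_cons]; omega) h3

/-- A singular vector `∑_π D_π e_{-π} v` whose coefficients vanish at all partitions involving a root
`α` with `h_α` constant on the line is zero. -/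
theorem eq_zero_of_singular {L : List (PosRoot m n)} (hnodup : L.Nodup) (hall : ∀ α, α ∈ L)
    {γ : PosRoot m n} (htf : ∀ c : k[X], c • v = 0 → c = 0) (D : RootPartition γ →₀ k[X])
    (hD : ∀ α : PosRoot m n,
      φ (e k α.1.1 α.1.2) (D.sum fun π f => f • φ (ePart k L π) v) = 0)
    (hgood : ∀ π, D π ≠ 0 → ∀ α ∈ partWord L π,
      mu α.1.1 - unitSign k α.1.1 α.1.2 α.1.2 α.1.1 * mu α.1.2 ≠ 0) :
    D = 0 := by
  by_contra hne
  -- apply the raising operators of a partition that maximizes the degree of `D π • e_{-π} v`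
  obtain ⟨π₀, hπ₀, hmax⟩ := D.support.exists_max_image
    (fun π => 2 * (D π).natDegree + (partWord L π).length) (Finsupp.support_nonempty_iff.2 hne)
  rw [Finsupp.mem_support_iff] at hπ₀
  have hwt := wordWt_partWord hnodup hall (γ := γ)
  have key := fun π : RootPartition γ => raiseProd_word hv hn (partWord L π₀) (partWord L π)
    (nodup_of_wordWt_eq (hwt π)) ((hwt π₀).trans (hwt π).symm)
  choose c hc1 hc2 hmem using key
  choose s hs hs' using fun π => exists_of_mem_lowerSpan_zero (hmem π)
  have hsum : φ (raiseProd k (partWord L π₀)) (D.sum fun π f => f • φ (ePart k L π) v) = 0 := by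
    have hcases : partWord L π₀ ≠ [] := by
      intro h
      have h1 := hwt π₀
      rw [h, wordWt_nil] at h1
      have h2 := cut_wt γ.1.1 γ
      rw [← h1, map_zero, if_pos ⟨le_rfl, γ.2⟩] at h2
      exact zero_ne_one h2
    obtain ⟨α, σ, hασ⟩ := List.exists_cons_of_ne_nil hcases
    rw [hασ, raiseProd, map_mul, Module.End.mul_apply, hD, map_zero]
  rw [Finsupp.sum, map_sum] at hsum
  set l := (partWord L π₀).length
  have hsum2 : ∑ π ∈ D.support, D π * (s π + monomial l (c π)) = 0 := by
    refine htf _ ?_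
    rw [Finset.sum_smul, ← hsum]
    refine Finset.sum_congr rfl fun π _ => ?_
    rw [map_smul, ePart_eq_wordProd, mul_smul, add_smul, ← hs π, sub_add_cancel]
  have hcoeff := congr_arg (fun f => coeff f (l + (D π₀).natDegree)) hsum2
  simp only [finsetSum_coeff, coeff_zero] at hcoeff
  -- the coefficients of the remainders `s π` do not reach the top degree
  have hs0 : ∀ π ∈ D.support, (D π * s π).coeff (l + (D π₀).natDegree) = 0 := by
    intro π hπ
    rw [coeff_mul]
    refine Finset.sum_eq_zero fun ij hij => ?_
    replace hij := Finset.HasAntidiagonal.mem_antidiagonal.1 hij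
    by_contra h
    have h1 := le_natDegree_of_ne_zero (left_ne_zero_of_mul h)
    have h2 := hs' π _ (right_ne_zero_of_mul h)
    have h3 := hmax π hπ
    omega
  rw [Finset.sum_eq_single π₀] at hcoeff
  · rw [mul_add, coeff_add, hs0 π₀ (by rwa [Finsupp.mem_support_iff]), zero_add, mul_comm,
      ← C_mul_X_pow_eq_monomial, mul_assoc, coeff_C_mul, X_pow_mul, add_comm, coeff_mul_X_pow,
      mul_eq_zero] at hcoeff
    rcases hcoeff with h | h
    · exact hc1 π₀ (List.Perm.refl _) (hgood π₀ hπ₀) h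
    · exact hπ₀ (leadingCoeff_eq_zero.1 h)
  · intro π hπ hne
    rw [hc2 π fun h => hne ((partWord_perm_iff hnodup hall).1 h).symm, monomial_zero_right, add_zero]
    exact hs0 π hπ
  · intro h
    exact absurd (Finsupp.notMem_support_iff.1 h) hπ₀

end Line

end

/-! ### Uniqueness of Šapovalov elements on the hyperplane -/

section

open Polynomial

variable {k : Type u} [Field k] {m n : ℕ}

theorem sum_count_smul_wt (w : List (PosRoot m n)) :
    ∑ α, w.count α • wt ℤ α = wordWt w := by
  induction w with
  | nil => simp [wordWt_nil]
  | cons β w ih =>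
    simp only [List.count_cons, add_smul, Finset.sum_add_distrib, ih, wordWt_cons, beq_iff_eq,
      ite_smul, one_smul, zero_smul, Finset.sum_ite_eq, Finset.mem_univ, if_true]
    exact add_comm _ _

/-- The partition of `γ` given by the letters of a word of weight `γ`. -/
def wordPartition {γ : PosRoot m n} (w : List (PosRoot m n)) (hw : wordWt w = wt ℤ γ) :
    RootPartition γ :=
  ⟨fun α => w.count α, fun _ _ => List.nodup_iff_count_le_one.1 (nodup_of_wordWt_eq hw) _, by
    rw [← hw, ← sum_count_smul_wt]⟩

theorem partWord_wordPartition_perm {L : List (PosRoot m n)} (hnodup : L.Nodup) (hall : ∀ α, α ∈ L)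
    {γ : PosRoot m n} (w : List (PosRoot m n)) (hw : wordWt w = wt ℤ γ) :
    (partWord L (wordPartition w hw)).Perm w :=
  List.perm_iff_count.2 fun α => count_partWord hnodup hall _ α

theorem exists_simple_word (γ : PosRoot m n) :
    ∃ w : List (PosRoot m n), wordWt w = wt ℤ γ ∧ ∀ α ∈ w, IsSimpleRoot α := by
  obtain ⟨⟨a, b⟩, hab⟩ := γ
  simp only at hab
  obtain ⟨d, hd⟩ : ∃ d, (b : ℕ) = a + 1 + d := ⟨b - (a + 1), by rw [Fin.lt_def] at hab; omega⟩
  induction d generalizing a with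
  | zero => exact ⟨[⟨(a, b), hab⟩], by simp [wordWt], by simp [IsSimpleRoot, hd]⟩
  | succ d ih =>
    have hb := b.2
    have hlt : (⟨a + 1, by omega⟩ : Fin (m + n)) < b := by rw [Fin.lt_def]; simp only; omega
    obtain ⟨w, hw, hs⟩ := ih ⟨a + 1, by omega⟩ hlt (by simp only; omega)
    refine ⟨⟨(a, ⟨a + 1, by omega⟩), by rw [Fin.lt_def]; simp⟩ :: w, ?_, ?_⟩
    · rw [wordWt_cons, hw, wt, wt, wt, sub_add_sub_cancel]
    · intro α hα
      rcases List.mem_cons.1 hα with rfl | hα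
      · rfl
      · exact hs α hα

theorem unitSign_mul_sgn (i j : Fin (m + n)) : unitSign k i j j i * sgn k m n j = sgn k m n i := by
  unfold unitSign superSign sgn parity
  split_ifs <;> simp_all

theorem sgn_mul_self (R : Type*) [CommRing R] (i : Fin (m + n)) :
    sgn R m n i * sgn R m n i = 1 := by
  unfold sgn; split_ifs <;> simp

theorem sgn_ne_zero (i : Fin (m + n)) : sgn k m n i ≠ 0 :=
  left_ne_zero_of_mul (by rw [sgn_mul_self]; exact one_ne_zero)

theorem form_wt {R : Type*} [CommRing R] (lam : Fin (m + n) → R) (α : PosRoot m n) :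
    form lam (wt R α) = sgn R m n α.1.1 * lam α.1.1 - sgn R m n α.1.2 * lam α.1.2 := by
  simp [form, wt, mul_sub, Finset.sum_sub_distrib, Pi.single_apply]

theorem form_add_left {R : Type*} [CommRing R] (lam mu nu : Fin (m + n) → R) :
    form (lam + mu) nu = form lam nu + form mu nu := by
  simp [form, mul_add, add_mul, Finset.sum_add_distrib]

section Rep

variable {R : Type*} [CommRing R] [Algebra k R] {M : Type v} [AddCommGroup M] [Module R M]
  [Module k M] [IsScalarTower k R M] {φ : U k m n →ₐ[k] Module.End R M} {v : M}
  {lam : Fin (m + n) → R} (hv : ∀ i, φ (e k i i) v = lam i • v)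
include hv

theorem cartanHom_apply_highest (f : MvPolynomial (Fin (m + n)) k) :
    φ (cartanHom k m n f) v = MvPolynomial.aeval lam f • v := by
  induction f using MvPolynomial.induction_on with
  | C c =>
    rw [← MvPolynomial.algebraMap_eq, AlgHom.commutes, AlgHom.commutes, AlgHom.commutes,
      algebraMap_smul]
    rfl
  | add p q hp hq => rw [map_add, map_add, map_add, LinearMap.add_apply, hp, hq, add_smul]
  | mul_X p i hp =>
    rw [map_mul, map_mul, map_mul, cartanHom_X, Module.End.mul_apply, hv, map_smul, hp, smul_smul,
      MvPolynomial.aeval_X, mul_comm]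

theorem sapSum_apply_highest (L : List (PosRoot m n)) {γ : PosRoot m n}
    (H : RootPartition γ →₀ MvPolynomial (Fin (m + n)) k) :
    φ (sapSum L H) v = Finsupp.linearCombination R (fun π => φ (ePart k L π) v)
      (H.mapRange (MvPolynomial.aeval lam) (map_zero _)) := by
  rw [sapSum, Finsupp.linearCombination_apply, Finsupp.sum_mapRange_index (by simp), Finsupp.sum,
    Finsupp.sum, map_sum, LinearMap.sum_apply]
  refine Finset.sum_congr rfl fun π _ => ?_
  rw [map_mul, Module.End.mul_apply, cartan_eq_cartanHom, cartanHom_apply_highest hv, map_smul]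

theorem sapIdeal_apply_highest (hn : ∀ i j, i < j → φ (e k i j) v = 0) (γ : PosRoot m n)
    (hγ : algebraMap k R (sgn k m n γ.1.1) * lam γ.1.1 - algebraMap k R (sgn k m n γ.1.2) * lam γ.1.2
      + algebraMap k R (form (rho k m n) (wt k γ) - form (wt k γ) (wt k γ) / 2) = 0)
    {u : U k m n} (hu : u ∈ sapIdeal k γ) : φ u v = 0 := by
  let A : Ideal (U k m n) :=
    { carrier := {u | φ u v = 0}
      add_mem' := fun {a b} (ha : φ a v = 0) (hb : φ b v = 0) => by
        change φ (a + b) v = 0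
        rw [map_add, LinearMap.add_apply, ha, hb, add_zero]
      zero_mem' := by simp
      smul_mem' := fun c x (hx : φ x v = 0) => by
        change φ (c • x) v = 0
        rw [smul_eq_mul, map_mul, Module.End.mul_apply, hx, map_zero] }
  refine (?_ : sapIdeal k γ ≤ A) hu
  refine sup_le (Ideal.span_le.2 ?_) (Ideal.span_le.2 ?_)
  · rintro _ rfl
    change φ _ v = 0
    rw [map_add, AlgHom.commutes, LinearMap.add_apply, Module.algebraMap_end_apply,
      ← algebraMap_smul R (_ : k) v]
    have : φ (hRoot k γ) v = (algebraMap k R (sgn k m n γ.1.1) * lam γ.1.1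
        - algebraMap k R (sgn k m n γ.1.2) * lam γ.1.2) • v := by
      rw [hRoot, map_sum, LinearMap.sum_apply]
      simp only [map_smul, LinearMap.smul_apply, hv]
      simp only [wt, Pi.sub_apply, Pi.single_apply, mul_sub, sub_smul, Finset.sum_sub_distrib,
        mul_ite, mul_one, mul_zero, ite_smul, zero_smul, Finset.sum_ite_eq', Finset.mem_univ, if_true,
        mul_smul, algebraMap_smul]
    rw [this, ← add_smul, hγ, zero_smul]
  · rintro _ ⟨α, rfl⟩
    change φ (ePos k α) v = 0
    rw [ePos, map_smul, LinearMap.smul_apply, hn _ _ α.2, smul_zero]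

end Rep

/-- The coefficients of a Šapovalov element are determined on the hyperplane. -/
theorem IsSapovalov.eval_eq [CharZero k] {L : List (PosRoot m n)} (hnodup : L.Nodup)
    (hall : ∀ α, α ∈ L) {γ : PosRoot m n} {H H' : RootPartition γ →₀ MvPolynomial (Fin (m + n)) k}
    (h : IsSapovalov L γ H) (h' : IsSapovalov L γ H') {lam : Fin (m + n) → k}
    (hlam : lam ∈ hyperplane k γ) (π : RootPartition γ) :
    MvPolynomial.eval lam (H π) = MvPolynomial.eval lam (H' π) := by
  -- a direction in the hyperplane on which `h_α` is not constant for the other roots `α` in the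
  -- support of `γ`
  let η : Fin (m + n) → ℕ := fun i => if i = γ.1.2 then γ.1.1 else i
  let mu : Fin (m + n) → k := fun i => sgn k m n i * η i
  let lamT : Fin (m + n) → k[X] := fun i => C (lam i) + X * C (mu i)
  obtain ⟨M, _, _, _, _, φ, v, htf, hv, hn⟩ := exists_highest_weight_vector (k := k) lamT
  have hann : ∀ u ∈ sapIdeal k γ, φ u v = 0 := fun u hu => by
    refine sapIdeal_apply_highest hv hn γ ?_ hu
    have h1 : form lam (wt k γ) + (form (rho k m n) (wt k γ) - form (wt k γ) (wt k γ) / 2) = 0 := by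
      have h2 : form (lam + rho k m n) (wt k γ) = form (wt k γ) (wt k γ) / 2 := hlam
      rw [form_add_left] at h2
      linear_combination h2
    have h2 : sgn k m n γ.1.1 * mu γ.1.1 - sgn k m n γ.1.2 * mu γ.1.2 = 0 := by
      simp only [mu, ← mul_assoc, sgn_mul_self, one_mul, η, if_pos, if_neg γ.2.ne, sub_self]
    rw [form_wt lam] at h1
    simp only [lamT, algebraMap_eq]
    generalize form (rho k m n) (wt k γ) - form (wt k γ) (wt k γ) / 2 = c at h1 ⊢
    linear_combination (norm := skip) congr_arg C h1 + X * congr_arg C h2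
    simp only [C_add, C_sub, C_mul, C_0]
    ring
  let D : (RootPartition γ →₀ MvPolynomial (Fin (m + n)) k) → RootPartition γ →₀ k[X] :=
    fun H => H.mapRange (MvPolynomial.aeval lamT) (map_zero _)
  let S := Finsupp.linearCombination k[X] fun π : RootPartition γ => φ (ePart k L π) v
  have hsing : ∀ H, IsSapovalov L γ H → ∀ α : PosRoot m n, φ (e k α.1.1 α.1.2) (S (D H)) = 0 := by
    intro H hH α
    have h1 := hann _ (hH.highest α)
    rw [map_mul, Module.End.mul_apply, sapSum_apply_highest hv, ePos, map_smul,
      LinearMap.smul_apply] at h1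
    replace h1 := congr_arg (sgn k m n α.1.1 • ·) h1
    simpa only [smul_smul, sgn_mul_self, one_smul, smul_zero] using h1
  have hgood : ∀ (π : RootPartition γ) (α : PosRoot m n), α ∈ partWord L π → γ ∉ partWord L π →
      mu α.1.1 - unitSign k α.1.1 α.1.2 α.1.2 α.1.1 * mu α.1.2 ≠ 0 := by
    intro π α hα hγ
    have h1 := mem_interval_of_mem (wordWt_partWord hnodup hall π) hα
    have hαγ : α ≠ γ := fun h => hγ (h ▸ hα)
    simp only [mu]
    rw [← mul_assoc, unitSign_mul_sgn, ← mul_sub]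
    refine mul_ne_zero (sgn_ne_zero _) (sub_ne_zero.2 fun h2 => ?_)
    have h3 : η α.1.1 = η α.1.2 := by exact_mod_cast h2
    have h4 := α.2
    simp only [η] at h3
    rw [if_neg (h4.trans_le h1.2).ne] at h3
    split_ifs at h3 with h5
    · exact hαγ (Subtype.ext (Prod.ext (Fin.ext h3) h5))
    · exact h4.ne (Fin.ext h3)
  have hzero : ∀ E : RootPartition γ →₀ k[X], (∀ α : PosRoot m n, φ (e k α.1.1 α.1.2) (S E) = 0) →
      (∀ π, γ ∈ partWord L π → E π = 0) → E = 0 := fun E hE hEγ =>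
    eq_zero_of_singular hv hn hnodup hall htf E hE fun π hπ α hα =>
      hgood π α hα fun hγ => hπ (hEγ π hγ)
  have hγw : wordWt [γ] = wt ℤ γ := by simp [wordWt]
  let πγ := wordPartition [γ] hγw
  have hπγ : ∀ π, γ ∈ partWord L π → π = πγ := by
    intro π hπ
    refine (partWord_perm_iff hnodup hall).1 ?_
    rw [eq_singleton_of_mem (wordWt_partWord hnodup hall π) hπ]
    exact (partWord_wordPartition_perm hnodup hall _ _).symm
  obtain ⟨w₀, hw₀, hs₀⟩ := exists_simple_word γ
  let π₀ := wordPartition w₀ hw₀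
  have hπ₀ : ∀ α, ¬ IsSimpleRoot α → π₀.1 α = 0 := fun α hα =>
    List.count_eq_zero.2 fun h => hα (hs₀ α h)
  have hD₀ : ∀ H, IsSapovalov L γ H → D H π₀ = 1 := by
    intro H hH
    simp only [D, Finsupp.mapRange_apply, hH.normalized π₀ hπ₀, map_one]
  -- the coefficient of `e_{-γ}` does not vanish identically
  have hT : D H' πγ ≠ 0 := by
    intro h0
    have h1 := hzero (D H') (hsing H' h') fun π hπ => by rw [hπγ π hπ, h0]
    have h2 := hD₀ H' h'
    rw [h1] at h2
    exact zero_ne_one h2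
  -- eliminate the coefficient of `e_{-γ}`
  have hE := hzero (D H' πγ • (D H - D H') - (D H πγ - D H' πγ) • D H')
    (fun α => by simp only [map_sub, map_smul, hsing H h, hsing H' h', smul_zero, sub_zero])
    (fun π hπ => by
      rw [hπγ π hπ]
      simp only [Finsupp.sub_apply, Finsupp.smul_apply, smul_eq_mul]
      ring)
  have hP : D H πγ - D H' πγ = 0 := by
    have h1 := DFunLike.congr_fun hE π₀
    rw [← neg_eq_zero, neg_sub]
    simpa [hD₀ H h, hD₀ H' h'] using h1
  have hDD : D H π = D H' π := by
    have h1 := DFunLike.congr_fun hE π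
    rw [hP, zero_smul, sub_zero, Finsupp.smul_apply, Finsupp.sub_apply, smul_eq_mul,
      Finsupp.coe_zero, Pi.zero_apply, mul_eq_zero, sub_eq_zero] at h1
    exact h1.resolve_left hT
  have hev : ∀ f : MvPolynomial (Fin (m + n)) k,
      MvPolynomial.eval lam f = (MvPolynomial.aeval lamT f).eval 0 := by
    intro f
    induction f using MvPolynomial.induction_on with
    | C c => simp
    | add p q hp hq => simp [hp, hq]
    | mul_X p i hp => simp [hp, lamT]
  rw [hev, hev]
  exact congr_arg (Polynomial.eval 0) hDD

/-- All Šapovalov elements have the same value on the hyperplane. -/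
theorem IsSapovalov.sapEval_eq [CharZero k] {L : List (PosRoot m n)} (hnodup : L.Nodup)
    (hall : ∀ α, α ∈ L) {γ : PosRoot m n} {H H' : RootPartition γ →₀ MvPolynomial (Fin (m + n)) k}
    (h : IsSapovalov L γ H) (h' : IsSapovalov L γ H') {lam : Fin (m + n) → k}
    (hlam : lam ∈ hyperplane k γ) : sapEval L H lam = sapEval L H' lam := by
  classical
  have key : ∀ H : RootPartition γ →₀ MvPolynomial (Fin (m + n)) k, sapEval L H lam
      = (H.mapRange (MvPolynomial.eval lam) (map_zero _)).sum fun π c => c • ePart k L π := by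
    intro H
    rw [Finsupp.sum_mapRange_index (by simp)]; rfl
  rw [key, key]
  congr 1
  ext π
  exact h.eval_eq hnodup hall h' hlam π

end

/-! ### The chain recursion -/

section

/-- The recursion `Z(o+1, q) = e_{q,o} Z(o, o) + Z(o, q) c_o` with `Z(0, q) = δ_{q,0}`, in a general
setting: `lt q o` stands for the multiplication by `e_{q,o}` and `cf o` for that by `c_o`.  Unfolded,
`Z(b, b)` is the sum over all increasing paths from `0` to `b` of the products of the `e_{q,o}` over
the steps `o → q` of the path (later steps to the left) and of the `c_o` over the nodes that the
path avoids. -/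
def chain {M : Type*} [AddCommGroup M] (lt : ℕ → ℕ → M →+ M) (cf : ℕ → M →+ M) (v : M) :
    ℕ → ℕ → M
  | 0, q => if q = 0 then v else 0
  | o + 1, q => lt q o (chain lt cf v o o) + cf o (chain lt cf v o q)

/-- A homomorphism compatible with the operations maps chains to chains; only the steps `o → q` with
`o < q ≤ B` matter for the part of the chain considered. -/
theorem map_chain {M M' : Type*} [AddCommGroup M] [AddCommGroup M'] {lt : ℕ → ℕ → M →+ M}
    {cf : ℕ → M →+ M} {lt' : ℕ → ℕ → M' →+ M'} {cf' : ℕ → M' →+ M'} {B : ℕ} (f : M →+ M')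
    (hl : ∀ q o x, o < q → q ≤ B → f (lt q o x) = lt' q o (f x))
    (hc : ∀ o x, f (cf o x) = cf' o (f x)) (v : M) (o q : ℕ) (hoq : o ≤ q) (hq : q ≤ B) :
    f (chain lt cf v o q) = chain lt' cf' (f v) o q := by
  induction o generalizing q with
  | zero => simp only [chain]; split_ifs <;> simp
  | succ o ih =>
    simp only [chain, map_add, hl q o _ hoq hq, hc, ih o le_rfl (by omega), ih q (by omega) hq]

theorem chain_mem {M : Type*} [AddCommGroup M] {lt : ℕ → ℕ → M →+ M} {cf : ℕ → M →+ M} {v : M}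
    {B : ℕ} (G : ℕ → AddSubgroup M) (hv : v ∈ G 0)
    (hl : ∀ q o, o < q → q ≤ B → ∀ x ∈ G o, lt q o x ∈ G q)
    (hc : ∀ q o, ∀ x ∈ G q, cf o x ∈ G q) (o q : ℕ) (hoq : o ≤ q) (hq : q ≤ B) :
    chain lt cf v o q ∈ G q := by
  induction o generalizing q with
  | zero =>
    simp only [chain]
    split_ifs with h
    · exact h ▸ hv
    · exact zero_mem _
  | succ o ih =>
    exact add_mem (hl q o hoq hq _ (ih o le_rfl (by omega))) (hc q o _ (ih q (by omega) hq))

/-- The chain in a ring, with `e_{q,o}` multiplied from the left and `c_o` from the right. -/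
def ringChain {A : Type*} [Ring A] (E : ℕ → ℕ → A) (c : ℕ → A) : ℕ → ℕ → A :=
  chain (fun q o => AddMonoidHom.mulLeft (E q o)) (fun o => AddMonoidHom.mulRight (c o)) 1

section RingChain

variable {A : Type*} [Ring A] (E : ℕ → ℕ → A) (c : ℕ → A)

theorem ringChain_zero (q : ℕ) : ringChain E c 0 q = if q = 0 then 1 else 0 := rfl

theorem ringChain_succ (o q : ℕ) :
    ringChain E c (o + 1) q = E q o * ringChain E c o o + ringChain E c o q * c o := rfl

end RingChain

/-- The relations of the matrix units with indices below `N`, where `p` is the parity. -/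
def MatrixUnits (k : Type*) [Field k] {A : Type*} [Ring A] [Algebra k A] (E : ℕ → ℕ → A)
    (p : ℕ → ZMod 2) (N : ℕ) : Prop :=
  ∀ i j u v, i < N → j < N → u < N → v < N →
    E i j * E u v = superSign k (p i + p j) (p u + p v) • (E u v * E i j)
      + (if j = u then E i v else 0)
      - superSign k (p i + p j) (p u + p v) • (if v = i then E u j else 0)

section Singular

variable {k : Type*} [Field k] {A : Type*} [Ring A] [Algebra k A] {E : ℕ → ℕ → A}
  {p : ℕ → ZMod 2} {N : ℕ} {c : ℕ → A} {J : Ideal A}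

/-- An element of `J` that commutes up to scalars with all steps of the chain keeps it in `J`. -/
theorem mul_ringChain_mem_of_commute (hJc : ∀ x ∈ J, ∀ o, x * c o ∈ J)
    {x : A} (hx : x ∈ J) {B : ℕ}
    (hcomm : ∀ q o, o < q → q ≤ B → ∃ s : k, x * E q o = s • (E q o * x)) (o q : ℕ) (hoq : o ≤ q)
    (hq : q ≤ B) : x * ringChain E c o q ∈ J := by
  induction o generalizing q with
  | zero => rw [ringChain_zero]; split_ifs <;> simp [hx]
  | succ o ih =>
    obtain ⟨s, hs⟩ := hcomm q o (by omega) hq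
    rw [ringChain_succ, mul_add, ← mul_assoc, ← mul_assoc, hs, smul_mul_assoc, mul_assoc]
    exact add_mem (J.smul_of_tower_mem _ (J.mul_mem_left _ (ih o le_rfl (by omega))))
      (hJc _ (ih q (by omega) hq) _)

variable (hE : MatrixUnits k E p N)
include hE

theorem MatrixUnits.diag_mul_ringChain (hc : ∀ i o, i < N → Commute (E i i) (c o)) {i : ℕ} (hi : i < N)
    (o q : ℕ) (hoq : o ≤ q) (hq : q < N) :
    E i i * ringChain E c o q
      = ringChain E c o q * (E i i + ((if i = q then 1 else 0) - if i = 0 then 1 else 0)) := by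
  induction o generalizing q with
  | zero =>
    rw [ringChain_zero]
    split_ifs <;> simp_all
  | succ o ih =>
    rw [ringChain_succ, mul_add, ← mul_assoc, ← mul_assoc, ih q (by omega) hq,
      hE i i q o hi hi hq (by omega), CharTwo.add_self_eq_zero, superSign_zero_left, one_smul, one_smul,
      add_sub_assoc, add_mul, mul_assoc (E q o), ih o le_rfl (by omega), add_mul (E q o * _),
      mul_assoc _ _ (c o)]
    have hcomm : Commute (E i i + ((if i = q then 1 else 0) - if i = 0 then 1 else 0)) (c o) :=
      (hc i o hi).add_left (Commute.sub_left (by split_ifs <;> simp) (by split_ifs <;> simp))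
    rw [hcomm.eq, ← mul_assoc _ (c o)]
    have h1 : ((if i = q then E i o else 0) - if o = i then E q i else 0)
        = E q o * ((if i = q then 1 else 0) - if i = o then 1 else 0) := by
      rw [mul_sub]
      rcases eq_or_ne i q with rfl | h1 <;> rcases eq_or_ne i o with rfl | h2 <;>
        simp_all [eq_comm]
    rw [h1]
    split_ifs <;> noncomm_ring

variable (hJc : ∀ x ∈ J, ∀ o, x * c o ∈ J)
include hJc

/-- The raising operator `e_{i,i+1}` annihilates, modulo `J`, the part of the chain below `i`. -/
theorem MatrixUnits.raise_mem_of_le {i : ℕ} (hi : i + 1 < N) (hiJ : E i (i + 1) ∈ J) (o q : ℕ)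
    (hoi : o ≤ i) (hoq : o ≤ q) (hq : q < N) (hqi : q ≠ i + 1) :
    E i (i + 1) * ringChain E c o q ∈ J := by
  induction o generalizing q with
  | zero => rw [ringChain_zero]; split_ifs <;> simp [hiJ]
  | succ o ih =>
    rw [ringChain_succ, mul_add, ← mul_assoc, ← mul_assoc,
      hE i (i + 1) q o (by omega) hi hq (by omega), if_neg (Ne.symm hqi),
      if_neg (by omega), smul_zero, add_zero, sub_zero, smul_mul_assoc, mul_assoc]
    exact add_mem (J.smul_of_tower_mem _ (J.mul_mem_left _
        (ih o (by omega) le_rfl (by omega) (by omega))))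
      (hJc _ (ih q (by omega) (by omega) hq hqi) _)

/-- On the way to the node `i + 1`, the raising operator `e_{i,i+1}` replaces the last step by one to
`i`. -/
theorem MatrixUnits.raise_last_sub_mem {i : ℕ} (hi0 : i ≠ 0) (hi : i + 1 < N)
    (hiJ : E i (i + 1) ∈ J) (o : ℕ) (hoi : o ≤ i) :
    E i (i + 1) * ringChain E c o (i + 1) - ringChain E c o i ∈ J := by
  induction o with
  | zero => rw [ringChain_zero, ringChain_zero, if_neg (by omega), if_neg hi0]; simp
  | succ o ih =>
    rw [ringChain_succ, ringChain_succ, mul_add, ← mul_assoc, ← mul_assoc,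
      hE i (i + 1) (i + 1) o (by omega) hi hi (by omega), if_pos rfl,
      if_neg (by omega), smul_zero, sub_zero, add_mul, smul_mul_assoc, mul_assoc]
    have h1 := hE.raise_mem_of_le hJc hi hiJ o o (by omega) le_rfl (by omega) (by omega)
    convert add_mem (J.smul_of_tower_mem (superSign k (p i + p (i + 1)) (p (i + 1) + p o))
      (J.mul_mem_left (E (i + 1) o) h1)) (hJc _ (ih (by omega)) o) using 1
    rw [sub_mul]; abel

/-- The element of `h` that the raising operator `e_{i,i+1}` produces from the chain. -/
def raiseCoeff (k : Type*) [Field k] {A : Type*} [Ring A] [Algebra k A] (E : ℕ → ℕ → A)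
    (p : ℕ → ZMod 2) (c : ℕ → A) (i : ℕ) : A :=
  E i i - superSign k (p i + p (i + 1)) (p i + p (i + 1)) • E (i + 1) (i + 1)
    + if i = 0 then 0 else 1 + c i

variable (hc : ∀ i o, i < N → Commute (E i i) (c o))
include hc

theorem MatrixUnits.raise_self_sub_mem {i : ℕ} (hi : i + 1 < N) (hiJ : E i (i + 1) ∈ J) :
    E i (i + 1) * ringChain E c (i + 1) (i + 1) - ringChain E c i i * raiseCoeff k E p c i ∈ J := by
  have h1 := hE.raise_mem_of_le hJc hi hiJ i i le_rfl le_rfl (by omega) (by omega)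
  have h2 : E i (i + 1) * ringChain E c i (i + 1) * c i
      - (if i = 0 then 0 else ringChain E c i i * c i) ∈ J := by
    by_cases hi0 : i = 0
    · subst hi0; simp [ringChain_zero]
    · rw [if_neg hi0, ← sub_mul]
      exact hJc _ (hE.raise_last_sub_mem hJc hi0 hi hiJ i le_rfl) _
  rw [ringChain_succ, mul_add, ← mul_assoc, ← mul_assoc,
    hE i (i + 1) (i + 1) i (by omega) hi hi (by omega), if_pos rfl, if_pos rfl, sub_mul, add_mul,
    smul_mul_assoc, smul_mul_assoc, mul_assoc (E (i + 1) i),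
    hE.diag_mul_ringChain hc (by omega) i i le_rfl (by omega),
    hE.diag_mul_ringChain hc hi i i le_rfl (by omega), if_pos (rfl : i = i),
    if_neg (show ¬ i + 1 = i by omega), if_neg (show ¬ i + 1 = 0 by omega), sub_zero, add_zero]
  convert add_mem (J.smul_of_tower_mem (superSign k (p i + p (i + 1)) (p (i + 1) + p i))
    (J.mul_mem_left (E (i + 1) i) h1)) h2 using 1
  rw [raiseCoeff, add_comm (p (i + 1))]
  by_cases hi0 : i = 0
  · simp only [hi0, if_true, mul_add, mul_sub, mul_smul_comm, mul_zero]; abel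
  · simp only [hi0, if_false, mul_add, mul_sub, mul_smul_comm, mul_one, sub_zero]; abel

/-- With the recursion for the coefficients, the contributions of the paths through `i + 1` and of the
paths through `i` but not through `i + 1` cancel. -/
theorem MatrixUnits.raise_succ_mem {B : ℕ}
    (hrec : ∀ i, i + 1 < B → c (i + 1)
      = superSign k (p i + p (i + 1)) (p i + p (i + 1)) • raiseCoeff k E p c i)
    {i : ℕ} (hiB : i + 1 < B) (hi : i + 1 < N) (hiJ : E i (i + 1) ∈ J) (q : ℕ) (hiq : i + 2 ≤ q)
    (hq : q < N) : E i (i + 1) * ringChain E c (i + 2) q ∈ J := by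
  have h1 := hE.raise_mem_of_le hJc hi hiJ i i le_rfl le_rfl (by omega) (by omega)
  have h2 := hE.raise_mem_of_le hJc hi hiJ i q le_rfl (by omega) (by omega) (by omega)
  have h3 := hE.raise_self_sub_mem hJc hc hi hiJ
  have h4 : E i (i + 1) * ringChain E c (i + 1) q
      + superSign k (p i + p (i + 1)) (p q + p i) • (E q (i + 1) * ringChain E c i i) ∈ J := by
    rw [ringChain_succ, mul_add, ← mul_assoc, ← mul_assoc,
      hE i (i + 1) q i (by omega) hi hq (by omega), if_pos rfl, if_neg (by omega), add_zero, sub_mul,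
      smul_mul_assoc, smul_mul_assoc, mul_assoc]
    convert add_mem (J.smul_of_tower_mem (superSign k (p i + p (i + 1)) (p q + p i))
      (J.mul_mem_left (E q i) h1)) (hJc _ h2 i) using 1
    abel
  have hsign : superSign k (p i + p (i + 1)) (p q + p (i + 1))
      = superSign k (p i + p (i + 1)) (p q + p i)
        * superSign k (p i + p (i + 1)) (p i + p (i + 1)) := by
    have : p q + p (i + 1) = (p q + p i) + (p i + p (i + 1)) := by
      generalize p q = x; generalize p i = y; generalize p (i + 1) = z
      revert x y z; decide
    rw [superSign_comm, this, superSign_add_left, superSign_comm (p q + p i)]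
  rw [ringChain_succ _ _ (i + 1), mul_add, ← mul_assoc, ← mul_assoc,
    hE i (i + 1) q (i + 1) (by omega) hi hq hi, if_neg (by omega), if_neg (by omega), smul_zero,
    add_zero, sub_zero, smul_mul_assoc, mul_assoc]
  convert add_mem (J.smul_of_tower_mem (superSign k (p i + p (i + 1)) (p q + p (i + 1)))
    (J.mul_mem_left (E q (i + 1)) h3)) (hJc _ h4 (i + 1)) using 1
  rw [mul_sub, smul_sub, add_mul, hsign, hrec i hiB, smul_mul_assoc, mul_smul_comm, mul_smul_comm,
    smul_smul, mul_assoc (E q (i + 1))]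
  abel

/-- The end of the chain is singular modulo `J`. -/
theorem MatrixUnits.raise_ringChain_mem {B : ℕ} (hB : B < N)
    (hrec : ∀ i, i + 1 < B → c (i + 1)
      = superSign k (p i + p (i + 1)) (p i + p (i + 1)) • raiseCoeff k E p c i)
    (hlast : ∀ i, i + 1 = B → raiseCoeff k E p c i ∈ J)
    {i : ℕ} (hi : i + 1 < N) (hiJ : E i (i + 1) ∈ J) :
    E i (i + 1) * ringChain E c B B ∈ J := by
  rcases lt_trichotomy (i + 1) B with h | h | h
  · have key : ∀ d q, i + 2 + d ≤ q → q ≤ B → E i (i + 1) * ringChain E c (i + 2 + d) q ∈ J := by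
      intro d
      induction d with
      | zero => exact fun q h1 h2 => hE.raise_succ_mem hJc hc hrec h hi hiJ q h1 (by omega)
      | succ d ih =>
        intro q h1 h2
        rw [← add_assoc, ringChain_succ, mul_add, ← mul_assoc, ← mul_assoc,
          hE i (i + 1) q (i + 2 + d) (by omega) hi (by omega) (by omega), if_neg (by omega),
          if_neg (by omega), smul_zero, add_zero, sub_zero, smul_mul_assoc, mul_assoc]
        exact add_mem (J.smul_of_tower_mem _ (J.mul_mem_left _ (ih _ le_rfl (by omega))))
          (hJc _ (ih q (by omega) h2) _)
    obtain ⟨d, rfl⟩ := Nat.exists_eq_add_of_le (show i + 2 ≤ B by omega)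
    exact key d _ le_rfl le_rfl
  · subst h
    have h1 := hE.raise_self_sub_mem hJc hc hi hiJ
    have h2 := J.mul_mem_left (ringChain E c i i) (hlast i rfl)
    simpa using add_mem h1 h2
  · exact hE.raise_mem_of_le hJc hi hiJ B B (by omega) le_rfl hB (by omega)

end Singular

end

/-! ### The vector `ρ` -/

section

variable {k : Type*} [Field k] {m n : ℕ}

/-- `1` below `m` and `-1` from `m` on; this is `sgn` on natural numbers. -/
def sgnNat (k : Type*) [Field k] (m i : ℕ) : k := if i < m then 1 else -1

theorem sgnNat_mul_self (i : ℕ) : sgnNat k m i * sgnNat k m i = 1 := by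
  unfold sgnNat; split_ifs <;> simp

theorem rho_apply (i : Fin (m + n)) :
    rho k m n i = 1 / 2 * ∑ α : PosRoot m n, sgn k m n α.1.1 * sgn k m n α.1.2 * wt k α i := by
  rw [rho, Pi.sub_apply, Pi.smul_apply, Pi.smul_apply, Finset.sum_apply, Finset.sum_apply, smul_eq_mul,
    smul_eq_mul, ← mul_sub, Finset.sum_filter, Finset.sum_filter, ← Finset.sum_sub_distrib]
  congr 1
  refine Finset.sum_congr rfl fun α _ => ?_
  unfold IsOddRoot sgn parity
  split_ifs <;> simp_all

theorem sgn_mul_rho (i : Fin (m + n)) :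
    sgn k m n i * rho k m n i
      = 1 / 2 * ∑ j : Fin (m + n), sgn k m n j * ((if i < j then 1 else 0) - if j < i then 1 else 0) := by
  rw [rho_apply, mul_left_comm]
  congr 1
  have h1 : ∀ F : Fin (m + n) → Fin (m + n) → k, ∑ α : PosRoot m n, F α.1.1 α.1.2
      = ∑ u, ∑ v, if u < v then F u v else 0 := by
    intro F
    rw [← Finset.sum_product' (f := fun u v => if u < v then F u v else 0), Finset.univ_product_univ,
      ← Finset.sum_filter, ← Finset.sum_subtype_eq_sum_filter]
    exact Finset.sum_congr (by ext; simp) fun _ _ => rfl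
  have h2 := h1 fun u v =>
    sgn k m n u * sgn k m n v * ((Pi.single u 1 - Pi.single v 1 : Fin (m + n) → k) i)
  have h3 : ∀ u v : Fin (m + n), (if u < v then sgn k m n u * sgn k m n v *
        ((Pi.single u 1 - Pi.single v 1 : Fin (m + n) → k) i) else 0)
      = (if i = u then if u < v then sgn k m n u * sgn k m n v else 0 else 0)
        - (if i = v then if u < v then sgn k m n u * sgn k m n v else 0 else 0) := by
    intro u v
    rw [Pi.sub_apply, Pi.single_apply, Pi.single_apply]
    split_ifs <;> simp
  simp only [h3, Finset.sum_sub_distrib] at h2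
  rw [Finset.sum_comm (f := fun u v => if i = u then _ else _)] at h2
  simp only [Finset.sum_ite_eq, Finset.mem_univ, if_true] at h2
  simp only [wt]
  rw [h2, ← Finset.sum_sub_distrib, Finset.mul_sum]
  refine Finset.sum_congr rfl fun j _ => ?_
  have h4 := sgn_mul_self k i
  split_ifs
  · linear_combination
  · linear_combination sgn k m n j * h4
  · linear_combination -sgn k m n j * h4
  · linear_combination

/-- `(ρ, α)` is half the sum of the lengths of the two ends plus the sum of the lengths in between. -/
theorem form_rho_wt [CharZero k] (α : PosRoot m n) :
    form (rho k m n) (wt k α) = 1 / 2 * (sgn k m n α.1.1 + sgn k m n α.1.2)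
      + ∑ l ∈ Finset.Ioo (α.1.1 : ℕ) α.1.2, sgnNat k m l := by
  have hα := α.2
  rw [form_wt, sgn_mul_rho, sgn_mul_rho, ← mul_sub, ← Finset.sum_sub_distrib]
  have h2 : ∑ l ∈ Finset.Ioo (α.1.1 : ℕ) α.1.2, sgnNat k m l
      = ∑ j : Fin (m + n), if α.1.1 < j ∧ j < α.1.2 then sgn k m n j else 0 := by
    rw [← Finset.sum_filter]
    symm
    refine Finset.sum_bij (fun j _ => (j : ℕ)) ?_ ?_ ?_ ?_
    · intro j hj; rw [Finset.mem_filter] at hj; exact Finset.mem_Ioo.2 hj.2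
    · intro i _ j _ h; exact Fin.ext h
    · intro l hl
      rw [Finset.mem_Ioo] at hl
      exact ⟨⟨l, by omega⟩, Finset.mem_filter.2 ⟨Finset.mem_univ _, hl⟩, rfl⟩
    · intro j _; rfl
  have h3 : ∀ i : Fin (m + n), sgn k m n i = ∑ j, if j = i then sgn k m n j else 0 := by simp
  rw [h2, h3 α.1.1, h3 α.1.2, ← Finset.sum_add_distrib, Finset.mul_sum, Finset.mul_sum,
    ← Finset.sum_add_distrib]
  refine Finset.sum_congr rfl fun j _ => ?_
  rcases lt_trichotomy j α.1.1 with h | h | h <;> rcases lt_trichotomy j α.1.2 with h' | h' | h' <;>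
    first
    | (exfalso; simp only [Fin.lt_def, Fin.ext_iff] at *; omega)
    | (simp [h, h', h.not_gt, h'.not_gt, h.ne, h'.ne, h.ne', h'.ne']; try ring)
    | (subst h; simp [h', h'.not_gt, h'.ne])
    | (subst h'; simp [h, h.not_gt, h.ne'])

end

/-! ### The chain in the enveloping algebra -/

section

variable {k : Type*} [Field k] {m n : ℕ}

/-- The index `r + i` of `gl(m,n)` (the junk value for an index that is too large is `r`). -/
def node (n : ℕ) (r : Fin m) (i : ℕ) : Fin (m + n) :=
  if h : (r : ℕ) + i < m + n then ⟨r + i, h⟩ else Fin.castAdd n r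

theorem val_node (r : Fin m) {i : ℕ} (hi : i < m + n - r) : (node n r i : ℕ) = r + i := by
  rw [node, dif_pos (by omega)]

theorem node_zero (r : Fin m) : node n r 0 = Fin.castAdd n r :=
  Fin.ext (val_node r (by have := r.2; omega))

theorem node_eq_iff (r : Fin m) {i j : ℕ} (hi : i < m + n - r) (hj : j < m + n - r) :
    node n r i = node n r j ↔ i = j := by
  rw [Fin.ext_iff, val_node r hi, val_node r hj]; omega

theorem sgn_node (r : Fin m) {i : ℕ} (hi : i < m + n - r) :
    sgn k m n (node n r i) = sgnNat k m (r + i) := by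
  rw [sgn, val_node r hi, sgnNat]

/-- The matrix units with the indices counted from `r`. -/
def nodeUnit (k : Type*) [Field k] (n : ℕ) (r : Fin m) (i j : ℕ) : U k m n :=
  e k (node n r i) (node n r j)

theorem matrixUnits_nodeUnit (r : Fin m) :
    MatrixUnits k (nodeUnit k n r) (fun i => parity m n (node n r i)) (m + n - r) := by
  intro i j u v hi hj hu hv
  rw [nodeUnit, nodeUnit, e_mul_e]
  simp only [node_eq_iff r hj hu, node_eq_iff r hv hi]
  rfl

/-- The polynomial `C_p` at the node `p = r + o`.  Its value at `lam` is
`(lam + ρ, (ε_r - ε_p)^∨) - 1` for the even nodes `p`, and `-(lam + ρ, (δ_p - δ_s)^∨)` for the odd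
ones if `lam` is in the hyperplane of `ε_r - δ_s`. -/
def chainPoly (k : Type*) [Field k] (n : ℕ) (r : Fin m) (o : ℕ) : MvPolynomial (Fin (m + n)) k :=
  sgnNat k m (r + o) • (MvPolynomial.X (node n r 0)
      + MvPolynomial.C (∑ l ∈ Finset.Ioo (r : ℕ) (r + o), sgnNat k m l))
    - MvPolynomial.X (node n r o)

/-- The coefficients of the chain that gives the Šapovalov element. -/
def chainCoeff (k : Type*) [Field k] (n : ℕ) (r : Fin m) (o : ℕ) : U k m n :=
  cartanHom k m n (chainPoly k n r o)

theorem chainCoeff_eq (r : Fin m) (o : ℕ) : chainCoeff k n r o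
    = sgnNat k m (r + o) • (nodeUnit k n r 0 0
      + algebraMap k _ (∑ l ∈ Finset.Ioo (r : ℕ) (r + o), sgnNat k m l)) - nodeUnit k n r o o := by
  rw [chainCoeff, chainPoly, map_sub, map_smul, map_add, cartanHom_X, cartanHom_X,
    ← MvPolynomial.algebraMap_eq, AlgHom.commutes]
  rfl

theorem superSign_parity (i j : Fin (m + n)) : superSign k (parity m n i + parity m n j)
    (parity m n i + parity m n j) = sgn k m n i * sgn k m n j := by
  unfold superSign sgn parity
  split_ifs <;> simp_all

/-- The recursion that makes the chain singular. -/
theorem chainCoeff_succ (r : Fin m) {i : ℕ} (hi : i + 1 < m + n - r) :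
    chainCoeff k n r (i + 1)
      = superSign k (parity m n (node n r i) + parity m n (node n r (i + 1)))
          (parity m n (node n r i) + parity m n (node n r (i + 1)))
        • raiseCoeff k (nodeUnit k n r) (fun i => parity m n (node n r i)) (chainCoeff k n r) i := by
  have h1 := sgnNat_mul_self (k := k) (m := m) (r + i)
  have h2 := sgnNat_mul_self (k := k) (m := m) (r + (i + 1))
  rw [raiseCoeff, superSign_parity, sgn_node r hi, sgn_node r (by omega : i < m + n - r),
    chainCoeff_eq]
  by_cases hi0 : i = 0
  · subst hi0
    have h3 : sgnNat k m r = 1 := by simp [sgnNat]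
    have h4 : Finset.Ioo (r : ℕ) (r + (0 + 1)) = ∅ := by ext; simp
    simp only [h3, h4, Finset.sum_empty, map_zero, add_zero, one_mul, if_true, smul_sub, smul_smul, h2,
      one_smul]
  · have h4 : Finset.Ioo (r : ℕ) (r + (i + 1)) = insert (r + i) (Finset.Ioo (r : ℕ) (r + i)) := by
      ext x; simp only [Finset.mem_Ioo, Finset.mem_insert]; omega
    rw [if_neg hi0, chainCoeff_eq, h4, Finset.sum_insert (by simp), map_add, Algebra.algebraMap_eq_smul_one,
      Algebra.algebraMap_eq_smul_one]
    generalize sgnNat k m (r + i) = x at *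
    generalize sgnNat k m (r + (i + 1)) = y at *
    simp only [smul_add, smul_sub, smul_smul]
    rw [show x * y * (x * y) = 1 by linear_combination x * x * h2 + h1,
      show x * y * x = y by linear_combination y * h1]
    rw [show ∀ z, x * y * (x * z) = y * z by intro z; linear_combination y * z * h1, mul_comm x y, one_smul]
    abel

theorem e_mem_sapIdeal (γ : PosRoot m n) {i j : Fin (m + n)} (h : i < j) : e k i j ∈ sapIdeal k γ := by
  have h1 : ePos k ⟨(i, j), h⟩ ∈ sapIdeal k γ :=
    Ideal.mem_sup_right (Ideal.subset_span ⟨_, rfl⟩)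
  have h2 := (sapIdeal k γ).smul_of_tower_mem (sgn k m n i) h1
  rwa [ePos, smul_smul, sgn_mul_self, one_smul] at h2

theorem gammaRoot_eq (r : Fin m) (s : Fin n) :
    (gammaRoot r s).1 = (node n r 0, node n r (m - r + s)) := by
  have hr := r.2
  have hs := s.2
  refine Prod.ext ?_ (Fin.ext ?_)
  · rw [node_zero]; rfl
  · rw [val_node r (by omega)]
    simp only [gammaRoot, Fin.val_natAdd]
    omega

theorem form_gammaRoot {R : Type*} [CommRing R] (r : Fin m) (s : Fin n) :
    form (wt R (gammaRoot r s)) (wt R (gammaRoot r s)) = 0 := by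
  have h1 : ¬ ((Fin.natAdd m s : Fin (m + n)) = Fin.castAdd n r) := by
    rw [Fin.ext_iff]; simp only [Fin.val_natAdd, Fin.val_castAdd]; omega
  rw [form_wt]
  simp [gammaRoot, wt, sgn, h1, Ne.symm h1]

/-- At the end of the chain, the coefficient is minus the generator `h_γ + ρ(h_γ)` of the ideal. -/
theorem chainCoeff_mem [CharZero k] (r : Fin m) (s : Fin n) :
    chainCoeff k n r (m - r + s) ∈ sapIdeal k (gammaRoot r s) := by
  have hr := r.2
  have hs := s.2
  have h1 : hRoot k (gammaRoot r s) + algebraMap k (U k m n) (form (rho k m n) (wt k (gammaRoot r s))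
      - form (wt k (gammaRoot r s)) (wt k (gammaRoot r s)) / 2) ∈ sapIdeal k (gammaRoot r s) :=
    Ideal.mem_sup_left (Ideal.subset_span rfl)
  have h2 : sgnNat k m (r + (m - r + s)) = -1 := by rw [sgnNat, if_neg (by omega)]
  have h4 : hRoot k (gammaRoot r s) = nodeUnit k n r 0 0 + nodeUnit k n r (m - r + s) (m - r + s) := by
    simp only [hRoot, wt, gammaRoot_eq, Pi.sub_apply, Pi.single_apply, mul_sub, sub_smul,
      Finset.sum_sub_distrib, mul_ite, mul_one, mul_zero, ite_smul, zero_smul, Finset.sum_ite_eq',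
      Finset.mem_univ, if_true]
    rw [sgn_node r (by omega), sgn_node r (by omega), h2]
    simp [sgnNat, nodeUnit]
  have h3 : r + (m - r + s) = m + s := by omega
  rw [form_gammaRoot, zero_div, sub_zero, form_rho_wt, h4, gammaRoot_eq, sgn_node r (by omega),
    sgn_node r (by omega), h2, val_node r (by omega), val_node r (by omega)] at h1
  rw [chainCoeff_eq, h2]
  convert (sapIdeal k (gammaRoot r s)).neg_mem h1 using 1
  have h5 : sgnNat k m (r + 0) = 1 := by simp [sgnNat]
  rw [h5, add_neg_cancel, mul_zero, zero_add, add_zero, neg_smul, one_smul]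
  abel

/-- The end of the chain is a singular vector modulo the ideal. -/
theorem ePos_mul_ringChain_mem [CharZero k] (r : Fin m) (s : Fin n) (α : PosRoot m n) :
    ePos k α * ringChain (nodeUnit k n r) (chainCoeff k n r) (m - r + s) (m - r + s)
      ∈ sapIdeal k (gammaRoot r s) := by
  have hr := r.2
  have hs := s.2
  set J := sapIdeal k (gammaRoot r s) with hJ
  set B := m - r + s with hB
  have hJc : ∀ x ∈ J, ∀ o, x * chainCoeff k n r o ∈ J := fun x hx o =>
    mul_cartanHom_mem_sapIdeal _ hx _
  have hc : ∀ i o, i < m + n - r → Commute (nodeUnit k n r i i) (chainCoeff k n r o) := by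
    intro i o _
    rw [nodeUnit, ← cartanHom_X]
    exact commute_cartanHom _ _
  have hsimple : ∀ u v : Fin (m + n), (u : ℕ) + 1 = v →
      e k u v * ringChain (nodeUnit k n r) (chainCoeff k n r) B B ∈ J := by
    intro u v huv
    have huv' : u < v := by rw [Fin.lt_def]; omega
    have hv := v.2
    by_cases hur : (u : ℕ) < r
    · refine mul_ringChain_mem_of_commute (k := k) hJc (e_mem_sapIdeal _ huv') (B := B) ?_ B B le_rfl le_rfl
      intro q o hoq hq
      refine ⟨unitSign k u v (node n r q) (node n r o), ?_⟩
      rw [nodeUnit, e_mul_e, if_neg, if_neg, smul_zero, add_zero, sub_zero]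
      · rw [Fin.ext_iff, val_node r (by omega)]; omega
      · rw [Fin.ext_iff, val_node r (by omega)]; omega
    · obtain ⟨i, hi⟩ := Nat.exists_eq_add_of_le (not_lt.1 hur)
      have hu : u = node n r i := Fin.ext (by rw [val_node r (by omega), hi])
      have hv : v = node n r (i + 1) := Fin.ext (by rw [val_node r (by omega)]; omega)
      subst hu hv
      refine (matrixUnits_nodeUnit (k := k) (n := n) r).raise_ringChain_mem hJc hc (by omega)
        (fun i hi => chainCoeff_succ r (by omega)) ?_ (by omega) (e_mem_sapIdeal _ huv')
      intro i hi
      have h1 := J.smul_of_tower_mem (superSign k (parity m n (node n r i)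
        + parity m n (node n r (i + 1))) (parity m n (node n r i) + parity m n (node n r (i + 1))))
        (chainCoeff_mem (k := k) r s)
      rw [← hB, ← hi, chainCoeff_succ r (by omega), smul_smul, superSign_mul_self, one_smul] at h1
      exact h1
  have hall : ∀ d, ∀ u v : Fin (m + n), (u : ℕ) + 1 + d = v →
      e k u v * ringChain (nodeUnit k n r) (chainCoeff k n r) B B ∈ J := by
    intro d
    induction d with
    | zero => exact fun u v h => hsimple u v h
    | succ d ih =>
      intro u v huv
      have hv := v.2
      let w : Fin (m + n) := ⟨u + 1, by omega⟩
      have h1 := e_mul_e (k := k) u w w v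
      rw [if_pos rfl, if_neg (by rw [Fin.ext_iff]; omega), smul_zero, sub_zero] at h1
      rw [← sub_eq_iff_eq_add'.2 h1, sub_mul, smul_mul_assoc, mul_assoc, mul_assoc]
      exact sub_mem (J.mul_mem_left _ (ih w v (by simp only [w]; omega)))
        (J.smul_of_tower_mem _ (J.mul_mem_left _ (hsimple u w rfl)))
  have hα := α.2
  rw [ePos, smul_mul_assoc]
  refine J.smul_of_tower_mem _ (hall ((α.1.2 : ℕ) - α.1.1 - 1) _ _ ?_)
  rw [Fin.lt_def] at hα
  omega

end

/-! ### Straightening words -/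

section

variable {k : Type*} [Field k] {m n : ℕ}

/-- The commutator of two negative root vectors that are not both odd is zero, or a multiple of the root
vector of the sum of the roots, which is not simple. -/
theorem eNeg_mul_eNeg_sub (α β : PosRoot m n) (hodd : ¬ IsOddRoot α ∨ ¬ IsOddRoot β) :
    eNeg k α * eNeg k β - eNeg k β * eNeg k α = 0 ∨
      ∃ (c : k) (δ : PosRoot m n), ¬ IsSimpleRoot δ ∧ wt ℤ δ = wt ℤ α + wt ℤ β ∧
        eNeg k α * eNeg k β - eNeg k β * eNeg k α = c • eNeg k δ := by
  have hs : unitSign k α.1.2 α.1.1 β.1.2 β.1.1 = 1 := by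
    unfold IsOddRoot at hodd
    rw [not_not, not_not] at hodd
    rcases hodd with h | h
    · rw [unitSign, h, CharTwo.add_self_eq_zero, superSign_zero_left]
    · rw [unitSign, h, CharTwo.add_self_eq_zero, superSign_zero_right]
  have h := e_mul_e (k := k) α.1.2 α.1.1 β.1.2 β.1.1
  rw [hs, one_smul, one_smul] at h
  have hα := α.2
  have hβ := β.2
  rw [Fin.lt_def] at hα hβ
  simp only [eNeg]
  rw [h, add_sub_assoc, add_sub_cancel_left]
  by_cases h1 : α.1.1 = β.1.2
  · have h2 : ¬ β.1.1 = α.1.2 := by intro h2; rw [h1] at hα; rw [h2] at hβ; omega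
    have h1' := congr_arg Fin.val h1
    refine Or.inr ⟨1, ⟨(β.1.1, α.1.2), by rw [Fin.lt_def]; simp only; omega⟩, ?_, ?_, ?_⟩
    · simp only [IsSimpleRoot]; omega
    · simp only [wt, h1]; abel
    · rw [if_pos h1, if_neg h2, sub_zero, one_smul]
  · by_cases h2 : β.1.1 = α.1.2
    · have h2' := congr_arg Fin.val h2
      refine Or.inr ⟨-1, ⟨(α.1.1, β.1.2), by rw [Fin.lt_def]; simp only; omega⟩, ?_, ?_, ?_⟩
      · simp only [IsSimpleRoot]; omega
      · simp only [wt, h2]; abel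
      · rw [if_neg h1, if_pos h2, zero_sub, neg_smul, one_smul]
    · exact Or.inl (by rw [if_neg h1, if_neg h2, sub_zero])

/-- The letters of a word cannot both be odd, since odd roots have a simple root in common. -/
theorem not_isOddRoot_or {γ : PosRoot m n} {u v : List (PosRoot m n)}
    {α β : PosRoot m n} (hw : wordWt (u ++ α :: β :: v) = wt ℤ γ) :
    ¬ IsOddRoot α ∨ ¬ IsOddRoot β := by
  by_contra! h
  have hodd : ∀ α : PosRoot m n, IsOddRoot α → ∃ h : m - 1 < m + n, Crosses ⟨m - 1, h⟩ α := by
    intro α hα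
    have h1 := α.2
    have h2 := α.1.2.2
    rw [Fin.lt_def] at h1
    simp only [IsOddRoot, parity] at hα
    refine ⟨by omega, ?_, ?_⟩
    · rw [Fin.le_def]; simp only; split_ifs at hα <;> first | omega | simp at hα
    · rw [Fin.lt_def]; simp only; split_ifs at hα <;> first | omega | simp at hα
  obtain ⟨hm, h1⟩ := hodd α h.1
  obtain ⟨_, h2⟩ := hodd β h.2
  have h3 := nodup_of_wordWt_eq hw
  have hne : α ≠ β := by
    rintro rfl
    simp [List.nodup_append] at h3
  exact not_crosses_of_mem hw (by simp) (by simp) hne h1 h2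

theorem wordProd_append (w w' : List (PosRoot m n)) :
    wordProd k (w ++ w') = wordProd k w * wordProd k w' := by
  rw [wordProd, List.map_append, List.prod_append]; rfl

theorem wordWt_append (w w' : List (PosRoot m n)) :
    wordWt (w ++ w') = wordWt w + wordWt w' := by
  rw [wordWt, List.map_append, List.sum_append]; rfl

section Straightening

variable (lam : Fin (m + n) → k)

open Classical in
/-- The term `e_{-w} f` of an element of `U(b^-)`, together with its value at `lam` and with its
contribution to the coefficient of the partition into simple roots. -/
def wordTerm (w : List (PosRoot m n)) : MvPolynomial (Fin (m + n)) k →+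
    U k m n × U k m n × MvPolynomial (Fin (m + n)) k where
  toFun f := (wordProd k w * cartanHom k m n f, MvPolynomial.eval lam f • wordProd k w,
    if ∀ α ∈ w, IsSimpleRoot α then f else 0)
  map_zero' := by simp
  map_add' f g := by
    simp only [map_add, mul_add, add_smul, Prod.mk_add_mk]
    split_ifs <;> simp

/-- The sums of the terms of the ordered words, with one word for each partition `π`. -/
def straightSpan (L : List (PosRoot m n)) (γ : PosRoot m n) :
    AddSubgroup (U k m n × U k m n × MvPolynomial (Fin (m + n)) k) :=
  (Finsupp.liftAddHom fun π : RootPartition γ => wordTerm lam (partWord L π)).range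

/-- Interchanging two letters of a word of weight `γ` produces a shorter word, which has a letter that
is not simple. -/
theorem wordTerm_swap_sub {γ : PosRoot m n} {u v : List (PosRoot m n)} {α β : PosRoot m n}
    (hw : wordWt (u ++ α :: β :: v) = wt ℤ γ) (f : MvPolynomial (Fin (m + n)) k) :
    ∃ w' f', wordTerm lam (u ++ α :: β :: v) f - wordTerm lam (u ++ β :: α :: v) f
      = wordTerm lam w' f' ∧ (f' ≠ 0 → wordWt w' = wt ℤ γ ∧ w'.length < (u ++ α :: β :: v).length) := by
  have hs : (∀ δ ∈ u ++ α :: β :: v, IsSimpleRoot δ) ↔ ∀ δ ∈ u ++ β :: α :: v, IsSimpleRoot δ := by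
    simp only [List.mem_append, List.mem_cons]
    constructor <;> intro h δ hδ <;> exact h δ (by tauto)
  have hsub : wordProd k (u ++ α :: β :: v) - wordProd k (u ++ β :: α :: v)
      = wordProd k u * (eNeg k α * eNeg k β - eNeg k β * eNeg k α) * wordProd k v := by
    simp only [wordProd_append, wordProd_cons, mul_sub, sub_mul, mul_assoc]
  have hterm : wordTerm lam (u ++ α :: β :: v) f - wordTerm lam (u ++ β :: α :: v) f
      = ((wordProd k (u ++ α :: β :: v) - wordProd k (u ++ β :: α :: v)) * cartanHom k m n f,
        MvPolynomial.eval lam f • (wordProd k (u ++ α :: β :: v) - wordProd k (u ++ β :: α :: v)), 0) := by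
    refine Prod.ext (sub_mul _ _ _).symm (Prod.ext (smul_sub _ _ _).symm ?_)
    simp only [wordTerm, AddMonoidHom.coe_mk, ZeroHom.coe_mk, Prod.snd_sub]
    split_ifs with h1 h2 h2
    exacts [sub_self _, absurd (hs.1 h1) h2, absurd (hs.2 h2) h1, sub_self _]
  rw [hterm, hsub]
  rcases eNeg_mul_eNeg_sub (k := k) α β (not_isOddRoot_or hw) with h | ⟨c, δ, hδ, hwt, h⟩
  · refine ⟨[], 0, ?_, by simp⟩
    rw [h, map_zero]; simp
  -- the letter `δ` is not simple, so that the last component vanishes on both sides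
  · refine ⟨u ++ δ :: v, c • f, ?_, fun _ => ⟨?_, by simp⟩⟩
    · have h3 : ¬ ∀ α ∈ u ++ δ :: v, IsSimpleRoot α := fun h => hδ (h δ (by simp))
      rw [h]
      simp only [wordTerm, AddMonoidHom.coe_mk, ZeroHom.coe_mk, h3, if_false, wordProd_append,
        wordProd_cons, map_smul, mul_smul_comm, smul_mul_assoc, mul_assoc]
      rw [MvPolynomial.smul_eval, mul_comm, mul_smul]
    · rw [← hw]
      simp only [wordWt_append, wordWt_cons, hwt, add_assoc]

/-- Words of weight `γ` with the same letters have the same term up to terms of shorter words.  The prefix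
`u` is there for the induction, since the condition on the weight is not inherited by suffixes. -/
theorem wordTerm_perm_sub_mem {γ : PosRoot m n}
    (S : AddSubgroup (U k m n × U k m n × MvPolynomial (Fin (m + n)) k)) (N : ℕ)
    (hS : ∀ w, wordWt w = wt ℤ γ → w.length < N → ∀ f, wordTerm lam w f ∈ S)
    {w w' : List (PosRoot m n)} (hp : w.Perm w') (f : MvPolynomial (Fin (m + n)) k) :
    ∀ u, wordWt (u ++ w) = wt ℤ γ → (u ++ w).length = N →
      wordTerm lam (u ++ w) f - wordTerm lam (u ++ w') f ∈ S := by
  induction hp with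
  | nil => intro u _ _; rw [sub_self]; exact zero_mem _
  | cons α hp ih =>
    intro u hu hN
    have := ih (u ++ [α]) (by simpa using hu) (by simpa using hN)
    simpa using this
  | swap α β v =>
    intro u hu hN
    obtain ⟨w', f', h, hf'⟩ := wordTerm_swap_sub lam hu f
    rw [h]
    by_cases h0 : f' = 0
    · rw [h0, map_zero]; exact zero_mem _
    · exact hS w' (hf' h0).1 (hN ▸ (hf' h0).2) f'
  | trans h1 h2 ih1 ih2 =>
    intro u hu hN
    have h3 := ih2 u (by rw [← hu]; exact wordWt_perm (h1.symm.append_left u))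
      (by rw [← hN]; exact (h1.symm.append_left u).length_eq)
    have := add_mem (ih1 u hu hN) h3
    rwa [sub_add_sub_cancel] at this

theorem wordTerm_mem_straightSpan {L : List (PosRoot m n)} (hnodup : L.Nodup) (hall : ∀ α, α ∈ L)
    {γ : PosRoot m n} (w : List (PosRoot m n)) (hw : wordWt w = wt ℤ γ)
    (f : MvPolynomial (Fin (m + n)) k) : wordTerm lam w f ∈ straightSpan lam L γ := by
  induction hN : w.length using Nat.strong_induction_on generalizing w f with
  | _ N ih =>
    have h1 := wordTerm_perm_sub_mem lam (straightSpan lam L γ) N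
      (fun w' hw' hl f => ih _ hl w' hw' f rfl)
      (partWord_wordPartition_perm hnodup hall w hw).symm f [] hw hN
    have h2 : wordTerm lam (partWord L (wordPartition w hw)) f ∈ straightSpan lam L γ :=
      ⟨Finsupp.single (wordPartition w hw) f, by simp⟩
    simpa using add_mem h1 h2

/-- The partition into simple roots is unique. -/
theorem eq_of_simple {L : List (PosRoot m n)} (hnodup : L.Nodup) (hall : ∀ α, α ∈ L)
    {γ : PosRoot m n} {π π' : RootPartition γ} (hπ : ∀ α, ¬ IsSimpleRoot α → π.1 α = 0)
    (hπ' : ∀ α, ¬ IsSimpleRoot α → π'.1 α = 0) : π = π' := by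
  have key : ∀ π : RootPartition γ, (∀ α, ¬ IsSimpleRoot α → π.1 α = 0) →
      ∀ α, IsSimpleRoot α → π.1 α = if Crosses α.1.1 γ then 1 else 0 := by
    intro π hπ α hα
    rw [← countP_crosses (wordWt_partWord hnodup hall π), ← count_partWord hnodup hall π]
    refine List.countP_congr fun β hβ => ?_
    rw [beq_iff_eq, decide_eq_true_eq]
    constructor
    · rintro rfl; exact ⟨le_rfl, β.2⟩
    · rintro ⟨h1, h2⟩
      have hβs : IsSimpleRoot β := by
        by_contra h
        rw [← List.count_pos_iff, count_partWord hnodup hall π, hπ β h] at hβ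
        exact absurd hβ (lt_irrefl _)
      unfold IsSimpleRoot at hα hβs
      rw [Fin.le_def] at h1
      rw [Fin.lt_def] at h2
      exact Subtype.ext (Prod.ext (Fin.ext (by omega)) (Fin.ext (by omega)))
  refine Subtype.ext (funext fun α => ?_)
  by_cases h : IsSimpleRoot α
  · exact (key π hπ α h).trans (key π' hπ' α h).symm
  · exact (hπ α h).trans (hπ' α h).symm

theorem exists_of_mem_straightSpan {L : List (PosRoot m n)} (hnodup : L.Nodup) (hall : ∀ α, α ∈ L)
    {γ : PosRoot m n} {x y : U k m n} {f : MvPolynomial (Fin (m + n)) k}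
    (h : (x, y, f) ∈ straightSpan lam L γ) :
    ∃ H : RootPartition γ →₀ MvPolynomial (Fin (m + n)) k, sapSum L H = x ∧ sapEval L H lam = y ∧
      ∀ π : RootPartition γ, (∀ α, ¬ IsSimpleRoot α → π.1 α = 0) → H π = f := by
  obtain ⟨H, hH⟩ := h
  rw [Finsupp.liftAddHom_apply] at hH
  refine ⟨H, ?_, ?_, fun π hπ => ?_⟩
  · have h1 := congr_arg Prod.fst hH
    simp only at h1
    rw [← h1, sapSum, Finsupp.sum, Finsupp.sum, Prod.fst_sum]
    refine Finset.sum_congr rfl fun π _ => ?_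
    rw [ePart_eq_wordProd, cartan_eq_cartanHom]; rfl
  · have h1 := congr_arg (fun x => x.2.1) hH
    simp only at h1
    rw [← h1, sapEval, Finsupp.sum, Finsupp.sum, Prod.snd_sum, Prod.fst_sum]
    refine Finset.sum_congr rfl fun π _ => ?_
    rw [ePart_eq_wordProd]; rfl
  · have h1 := congr_arg (fun x => x.2.2) hH
    simp only at h1
    rw [← h1, Finsupp.sum, Prod.snd_sum, Prod.snd_sum]
    have hiff : ∀ π' : RootPartition γ, (∀ α ∈ partWord L π', IsSimpleRoot α) ↔ π' = π := by
      intro π'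
      constructor
      · intro h
        refine eq_of_simple hnodup hall (fun α hα => ?_) hπ
        rw [← count_partWord hnodup hall π', List.count_eq_zero]
        exact fun h' => hα (h α h')
      · rintro rfl α hα
        by_contra h
        rw [← List.count_pos_iff, count_partWord hnodup hall, hπ α h] at hα
        exact absurd hα (lt_irrefl _)
    symm
    refine (Finset.sum_eq_single π (fun π' _ hne => ?_) (fun h => ?_)).trans ?_
    · exact if_neg fun h => hne ((hiff π').1 h)
    · rw [Finsupp.notMem_support_iff.1 h, map_zero]; rfl
    · exact if_pos ((hiff π).2 rfl)

end Straightening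

end

/-! ### Existence of Šapovalov elements -/

section

variable {k : Type*} [Field k] {m n : ℕ}

section Existence

variable (lam : Fin (m + n) → k) (r : Fin m)

/-- Left multiplication by `e_{q,o}` on the terms of `wordTerm`; the last component records the words
in the simple roots. -/
def termLeft (q o : ℕ) : U k m n × U k m n × MvPolynomial (Fin (m + n)) k →+
    U k m n × U k m n × MvPolynomial (Fin (m + n)) k :=
  (AddMonoidHom.mulLeft (nodeUnit k n r q o)).prodMap
    ((AddMonoidHom.mulLeft (nodeUnit k n r q o)).prodMap
      (if q = o + 1 then AddMonoidHom.id _ else 0))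

/-- Right multiplication by the coefficient of the chain at `o` on the terms of `wordTerm`. -/
def termRight (o : ℕ) : U k m n × U k m n × MvPolynomial (Fin (m + n)) k →+
    U k m n × U k m n × MvPolynomial (Fin (m + n)) k :=
  (AddMonoidHom.mulRight (chainCoeff k n r o)).prodMap
    ((AddMonoidHom.mulRight (algebraMap k _ (MvPolynomial.eval lam (chainPoly k n r o)))).prodMap
      (AddMonoidHom.mulRight (chainPoly k n r o)))

theorem termRight_wordTerm (o : ℕ) (w : List (PosRoot m n)) (f : MvPolynomial (Fin (m + n)) k) :
    termRight lam r o (wordTerm lam w f) = wordTerm lam w (f * chainPoly k n r o) := by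
  refine Prod.ext ?_ (Prod.ext ?_ ?_)
  · change wordProd k w * cartanHom k m n f * chainCoeff k n r o = _
    rw [mul_assoc, chainCoeff, ← map_mul]; rfl
  · change MvPolynomial.eval lam f • wordProd k w * algebraMap k _ _ = _
    rw [← Algebra.commutes, ← Algebra.smul_def, smul_smul, mul_comm, ← map_mul]; rfl
  · simp only [termRight, wordTerm, AddMonoidHom.coe_mk, ZeroHom.coe_mk, AddMonoidHom.prodMap_def,
      AddMonoidHom.prod_apply, AddMonoidHom.comp_apply, AddMonoidHom.coe_snd,
      AddMonoidHom.coe_mulRight, ite_mul, zero_mul]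

theorem termLeft_wordTerm {q o : ℕ} (hoq : o < q) (h : node n r o < node n r q)
    (hq : q < m + n - r) (w : List (PosRoot m n)) (f : MvPolynomial (Fin (m + n)) k) :
    termLeft r q o (wordTerm lam w f) = wordTerm lam (⟨(node n r o, node n r q), h⟩ :: w) f := by
  refine Prod.ext ?_ (Prod.ext ?_ ?_)
  · change nodeUnit k n r q o * (wordProd k w * cartanHom k m n f) = wordProd k _ * _
    rw [wordProd_cons, mul_assoc]; rfl
  · change nodeUnit k n r q o * (MvPolynomial.eval lam f • wordProd k w) = _ • wordProd k _
    rw [wordProd_cons, mul_smul_comm]; rfl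
  · have hs : IsSimpleRoot (⟨(node n r o, node n r q), h⟩ : PosRoot m n) ↔ q = o + 1 := by
      simp only [IsSimpleRoot, val_node r hq, val_node r (hoq.trans hq)]; omega
    simp only [termLeft, wordTerm, AddMonoidHom.coe_mk, ZeroHom.coe_mk, AddMonoidHom.prodMap_def,
      AddMonoidHom.prod_apply, AddMonoidHom.comp_apply, AddMonoidHom.coe_snd]
    have hcons := List.forall_mem_cons (p := IsSimpleRoot)
      (a := (⟨(node n r o, node n r q), h⟩ : PosRoot m n)) (l := w)
    rw [hs] at hcons
    by_cases h1 : q = o + 1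
    · rw [if_pos h1, AddMonoidHom.id_apply]
      by_cases h2 : ∀ α ∈ w, IsSimpleRoot α
      · rw [if_pos h2, if_pos (hcons.2 ⟨h1, h2⟩)]
      · rw [if_neg h2, if_neg fun h3 => h2 (hcons.1 h3).2]
    · rw [if_neg h1, AddMonoidHom.zero_apply]
      exact (if_neg fun h3 => h1 (hcons.1 h3).1).symm

/-- There is a Šapovalov element for `ε_r - δ_s`, and its value at `lam` is given by the chain with
scalar coefficients. -/
theorem exists_isSapovalov [CharZero k] {L : List (PosRoot m n)} (hnodup : L.Nodup)
    (hall : ∀ α, α ∈ L) (s : Fin n) :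
    ∃ H : RootPartition (gammaRoot r s) →₀ MvPolynomial (Fin (m + n)) k,
      IsSapovalov L (gammaRoot r s) H ∧
      sapEval L H lam = ringChain (nodeUnit k n r)
        (fun o => algebraMap k _ (MvPolynomial.eval lam (chainPoly k n r o))) (m - r + s) (m - r + s) := by
  have hr := r.2
  have hs := s.2
  set B := m - r + s with hB
  let Z := chain (termLeft r) (termRight lam r) (wordTerm lam [] 1)
  let G : ℕ → AddSubgroup (U k m n × U k m n × MvPolynomial (Fin (m + n)) k) := fun q =>
    AddSubgroup.closure {x | ∃ w f, x = wordTerm lam w f ∧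
      wordWt w = Pi.single (node n r 0) 1 - Pi.single (node n r q) 1}
  have hZ : Z B B ∈ G B := by
    refine chain_mem G (AddSubgroup.subset_closure ⟨[], 1, rfl, by simp [wordWt_nil]⟩) ?_ ?_
      B B le_rfl le_rfl
    · intro q o hoq hq
      have hlt : node n r o < node n r q := by
        rw [Fin.lt_def, val_node r (by omega), val_node r (by omega)]; omega
      suffices h : (G o).map (termLeft r q o) ≤ G q from AddSubgroup.map_le_iff_le_comap.1 h
      rw [AddMonoidHom.map_closure, AddSubgroup.closure_le]
      rintro _ ⟨_, ⟨w, f, rfl, hw⟩, rfl⟩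
      refine AddSubgroup.subset_closure
        ⟨_, _, termLeft_wordTerm lam r hoq hlt (by omega) w f, ?_⟩
      rw [wordWt_cons, hw, wt]
      abel
    · intro q o
      suffices h : (G q).map (termRight lam r o) ≤ G q from AddSubgroup.map_le_iff_le_comap.1 h
      rw [AddMonoidHom.map_closure, AddSubgroup.closure_le]
      rintro _ ⟨_, ⟨w, f, rfl, hw⟩, rfl⟩
      exact AddSubgroup.subset_closure ⟨_, _, termRight_wordTerm lam r o w f, hw⟩
  have hGS : G B ≤ straightSpan lam L (gammaRoot r s) := by
    rw [AddSubgroup.closure_le]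
    rintro _ ⟨w, f, rfl, hw⟩
    refine wordTerm_mem_straightSpan lam hnodup hall w ?_ f
    rw [hw, wt, gammaRoot_eq]
  have h1 : (Z B B).1 = ringChain (nodeUnit k n r) (chainCoeff k n r) B B := by
    have := map_chain (B := B) (AddMonoidHom.fst _ _)
      (lt' := fun q o => AddMonoidHom.mulLeft (nodeUnit k n r q o))
      (cf' := fun o => AddMonoidHom.mulRight (chainCoeff k n r o))
      (lt := termLeft r) (cf := termRight lam r)
      (fun _ _ _ _ _ => rfl) (fun _ _ => rfl) (wordTerm lam [] 1) B B le_rfl le_rfl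
    refine this.trans ?_
    simp [ringChain, wordTerm, wordProd_nil]
  have h2 : (Z B B).2.1 = ringChain (nodeUnit k n r)
      (fun o => algebraMap k _ (MvPolynomial.eval lam (chainPoly k n r o))) B B := by
    have := map_chain (B := B) ((AddMonoidHom.fst _ _).comp (AddMonoidHom.snd _ _))
      (lt' := fun q o => AddMonoidHom.mulLeft (nodeUnit k n r q o))
      (cf' := fun o => AddMonoidHom.mulRight
        (algebraMap k _ (MvPolynomial.eval lam (chainPoly k n r o))))
      (lt := termLeft r) (cf := termRight lam r)
      (fun _ _ _ _ _ => rfl) (fun _ _ => rfl) (wordTerm lam [] 1) B B le_rfl le_rfl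
    refine this.trans ?_
    simp [ringChain, wordTerm, wordProd_nil]
  -- only the path through all nodes consists of simple roots
  have h3 : ∀ o q, o ≤ q → (Z o q).2.2 = if o = q then 1 else 0 := by
    intro o
    induction o with
    | zero =>
      intro q _
      simp only [Z, chain, eq_comm (a := q)]
      split_ifs
      · simp [wordTerm]
      · rfl
    | succ o ih =>
      intro q hq
      have h4 : (Z (o + 1) q).2.2
          = (if q = o + 1 then AddMonoidHom.id _ else 0) (Z o o).2.2
            + (Z o q).2.2 * chainPoly k n r o := rfl
      rw [h4, ih o le_rfl, ih q (by omega), if_pos (rfl : o = o),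
        if_neg (show ¬ o = q by omega), zero_mul, add_zero]
      by_cases h5 : q = o + 1
      · rw [if_pos h5, if_pos h5.symm]; rfl
      · rw [if_neg h5, if_neg (Ne.symm h5)]; rfl
  obtain ⟨H, hH1, hH2, hH3⟩ := exists_of_mem_straightSpan lam hnodup hall (hGS hZ)
  refine ⟨H, ⟨fun π hπ => ?_, fun α => ?_⟩, ?_⟩
  · rw [hH3 π hπ, h3 B B le_rfl, if_pos rfl]
  · rw [hH1, h1]; exact ePos_mul_ringChain_mem r s α
  · rw [hH2, h2]

end Existence

end

/-! ### Noncommutative determinants -/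

section

section Det

variable {A : Type*} [Ring A]

/-- Expansion along the first column, whose entries are the last factors of the products. -/
theorem detRL_succ {l : ℕ} (B : Matrix (Fin (l + 1)) (Fin (l + 1)) A) :
    detRL B = ∑ i : Fin (l + 1), ((-1) ^ (i : ℕ) : ℤ) •
      (detRL (B.submatrix i.succAbove Fin.succ) * B i 0) := by
  rw [detRL, Finset.univ_perm_fin_succ, ← Finset.univ_product_univ]
  simp only [Finset.sum_map, Equiv.toEmbedding_apply, Finset.sum_product]
  refine Finset.sum_congr rfl fun i _ => ?_
  rw [detRL, Finset.sum_mul, Finset.smul_sum]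
  refine Fin.cases ?_ (fun i => ?_) i
  · refine Finset.sum_congr rfl fun σ _ => ?_
    simp [List.ofFn_succ, Equiv.Perm.decomposeFin.symm_sign, mul_assoc]
  · refine Fintype.sum_equiv (Equiv.mulLeft i.cycleRange) _ _ fun σ => ?_
    rw [Equiv.Perm.decomposeFin.symm_sign, if_neg (Fin.succ_ne_zero i)]
    simp only [List.ofFn_succ, Equiv.Perm.decomposeFin_symm_apply_zero,
      Equiv.Perm.decomposeFin_symm_apply_succ, ← Fin.succAbove_cycleRange, List.reverse_cons,
      List.prod_append, List.prod_singleton, Equiv.coe_mulLeft, Equiv.Perm.mul_apply, map_mul,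
      Fin.sign_cycleRange, Matrix.submatrix_apply, smul_mul_assoc, smul_smul]
    congr 1
    rw [Fin.val_succ]
    push_cast
    rw [← mul_assoc, ← pow_add, show (i : ℕ) + 1 + i = 2 * i + 1 by ring, pow_succ, pow_mul]
    simp

theorem detRL_eq_zero_of_row {l : ℕ} (B : Matrix (Fin l) (Fin l) A) (i : Fin l)
    (h : ∀ c, B i c = 0) : detRL B = 0 := by
  refine Finset.sum_eq_zero fun w _ => ?_
  rw [List.prod_eq_zero, smul_zero]
  rw [List.mem_reverse, List.mem_ofFn]
  exact ⟨w.symm i, by rw [Equiv.apply_symm_apply, h]⟩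

theorem detLR_eq_detRL_rev {l : ℕ} (B : Matrix (Fin l) (Fin l) A) :
    detLR B = detRL (B.submatrix Fin.rev Fin.rev) := by
  refine Fintype.sum_equiv (Fin.revPerm.permCongr) _ _ fun w => ?_
  rw [Equiv.Perm.sign_permCongr]
  congr 2
  refine List.ext_getElem (by simp) fun i h1 h2 => ?_
  simp only [List.getElem_reverse, List.getElem_ofFn, Equiv.permCongr_apply, Fin.revPerm_symm,
    Fin.revPerm_apply, Matrix.submatrix_apply, Fin.rev_rev, List.length_ofFn]
  have : Fin.rev (⟨l - 1 - i, by simp at h1; omega⟩ : Fin l) = ⟨i, by simpa using h1⟩ := by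
    simp at h1; ext; simp [Fin.val_rev]; omega
  rw [this]

theorem detRL_eq_detLR_rev {l : ℕ} (B : Matrix (Fin l) (Fin l) A) :
    detRL B = detLR (B.submatrix Fin.rev Fin.rev) := by
  rw [detLR_eq_detRL_rev, Matrix.submatrix_submatrix]
  congr 1
  ext i j
  simp

theorem detLR_eq_unop {l : ℕ} (B : Matrix (Fin l) (Fin l) A) :
    detLR B = MulOpposite.unop (detRL (B.map MulOpposite.op)) := by
  rw [detLR, detRL, ← MulOpposite.opAddEquiv_symm_apply, map_sum]
  refine Finset.sum_congr rfl fun w _ => ?_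
  rw [map_zsmul, MulOpposite.opAddEquiv_symm_apply, MulOpposite.unop_list_prod, List.map_reverse,
    List.reverse_reverse, List.map_ofFn]
  rfl

variable {k : Type*} [Field k] [Algebra k A]

/-- The matrix with one more row than columns with the entries `b l` on the main diagonal, the
entries `g i l` below it and zeros above. -/
def lowerHess (g : ℕ → ℕ → A) (b : ℕ → k) (l : ℕ) : Matrix (Fin (l + 1)) (Fin l) A :=
  Matrix.of fun i c =>
    if (c : ℕ) < i then g i c else if (i : ℕ) = c then algebraMap k A (b c) else 0

/-- Deleting a row and the first row and column leaves a matrix of the same form. -/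
theorem lowerHess_shift (g : ℕ → ℕ → A) (b : ℕ → k) (l : ℕ) (i : Fin (l + 1)) :
    ((lowerHess g b (l + 1)).submatrix (Fin.succ ∘ i.succAbove) Fin.succ)
      = delRow i (lowerHess (fun i c => g (i + 1) (c + 1)) (fun c => b (c + 1)) l) := by
  ext x y
  simp [lowerHess, delRow]

/-- The maximal minors of a lower Hessenberg matrix: the columns before the deleted row contribute
their diagonal entries, and the others a solution `V` of a recursion. -/
theorem detRL_delRow_lowerHess (l : ℕ) (g : ℕ → ℕ → A) (b : ℕ → k) (V : ℕ → A) (hl : V l = 1)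
    (hV : ∀ i < l, V i = ∑ q ∈ Finset.range (l - i), ((-1) ^ q * ∏ p ∈ Finset.range q, b (i + 1 + p))
      • (V (i + 1 + q) * g (i + 1 + q) i)) (i : Fin (l + 1)) :
    detRL (delRow i (lowerHess g b l)) = (∏ p ∈ Finset.range i, b p) • V i := by
  induction l generalizing g b V with
  | zero =>
    have : i = 0 := Fin.ext (by omega)
    subst this
    simp [detRL, hl]
  | succ l ih =>
    have ih' := ih (fun i c => g (i + 1) (c + 1)) (fun c => b (c + 1)) (fun i => V (i + 1)) hl
      fun i hi => by
        rw [hV (i + 1) (by omega), Nat.add_sub_add_right]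
        refine Finset.sum_congr rfl fun q _ => ?_
        simp only [show ∀ q, i + 1 + 1 + q = i + 1 + q + 1 by intro q; ring]
    rw [detRL_succ]
    refine Fin.cases ?_ (fun i => ?_) i
    · rw [Fin.val_zero, Finset.range_zero, Finset.prod_empty, one_smul, hV 0 (by omega),
        Finset.sum_range]
      refine Finset.sum_congr rfl fun q _ => ?_
      have h1 : (delRow 0 (lowerHess g b (l + 1))).submatrix q.succAbove Fin.succ
          = delRow q (lowerHess (fun i c => g (i + 1) (c + 1)) (fun c => b (c + 1)) l) := by
        rw [← lowerHess_shift, delRow, Matrix.submatrix_submatrix]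
        rfl
      have h2 : delRow 0 (lowerHess g b (l + 1)) q 0 = g (0 + 1 + q) 0 := by
        simp [lowerHess, delRow, add_comm]
      rw [h1, ih', h2, smul_mul_assoc, mul_smul, zero_add]
      simp only [add_comm 1]
      rcases Nat.even_or_odd (q : ℕ) with h | h <;> simp [h.neg_one_pow]
    -- the first row is not deleted, and only its first entry is nonzero
    · rw [Finset.sum_eq_single 0]
      · have h1 : (delRow i.succ (lowerHess g b (l + 1))).submatrix (Fin.succAbove 0) Fin.succ
            = delRow i (lowerHess (fun i c => g (i + 1) (c + 1)) (fun c => b (c + 1)) l) := by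
          rw [← lowerHess_shift, delRow, Matrix.submatrix_submatrix]
          congr 1
          ext x
          simp
        have h2 : delRow i.succ (lowerHess g b (l + 1)) 0 0 = algebraMap k A (b 0) := by
          simp [lowerHess, delRow]
        rw [h1, h2, ih', ← Algebra.commutes, ← Algebra.smul_def, smul_smul, Fin.val_succ,
          Finset.prod_range_succ']
        simp [mul_comm]
      · intro j _ hj
        obtain ⟨j, rfl⟩ := Fin.exists_succ_eq.2 hj
        obtain ⟨l, rfl⟩ : ∃ l', l = l' + 1 := ⟨l - 1, by have := j.2; omega⟩
        rw [detRL_eq_zero_of_row _ 0, zero_mul, smul_zero]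
        intro c
        simp [lowerHess, delRow]
      · simp

/-- The same for the other order of the factors, by passing to the opposite ring. -/
theorem detLR_delRow_lowerHess (l : ℕ) (g : ℕ → ℕ → A) (b : ℕ → k) (V : ℕ → A) (hl : V l = 1)
    (hV : ∀ i < l, V i = ∑ q ∈ Finset.range (l - i), ((-1) ^ q * ∏ p ∈ Finset.range q, b (i + 1 + p))
      • (g (i + 1 + q) i * V (i + 1 + q))) (i : Fin (l + 1)) :
    detLR (delRow i (lowerHess g b l)) = (∏ p ∈ Finset.range i, b p) • V i := by
  have h := detRL_delRow_lowerHess l (fun i c => MulOpposite.op (g i c)) b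
    (fun i => MulOpposite.op (V i)) (by rw [hl, MulOpposite.op_one])
    (fun i hi => by
      rw [hV i hi, ← MulOpposite.opAddEquiv_apply, map_sum]
      rfl) i
  rw [detLR_eq_unop, ← MulOpposite.unop_op ((∏ p ∈ Finset.range i, b p) • V i), MulOpposite.op_smul, ← h]
  congr 2
  ext x y
  simp only [delRow, Matrix.map_apply, Matrix.submatrix_apply, lowerHess, Matrix.of_apply]
  split_ifs <;> rfl

/-- The recursion of `detRL_delRow_lowerHess` has a solution. -/
theorem exists_hess_recursion (l : ℕ) (w : ℕ → ℕ → k) (F : ℕ → ℕ → A →+ A) :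
    ∃ V : ℕ → A, V l = 1 ∧
      ∀ i < l, V i = ∑ q ∈ Finset.range (l - i), w i q • F i q (V (i + 1 + q)) := by
  induction l generalizing w F with
  | zero => exact ⟨fun _ => 1, rfl, by simp⟩
  | succ l ih =>
    obtain ⟨V, hl, hV⟩ := ih (fun i => w (i + 1)) (fun i => F (i + 1))
    refine ⟨fun i => Nat.casesOn i
      (∑ q ∈ Finset.range (l + 1), w 0 q • F 0 q (V q)) V, hl, ?_⟩
    rintro (_ | i) hi
    · simp [add_comm 1]
    · simp only [Nat.add_sub_add_right, hV i (by omega)]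
      refine Finset.sum_congr rfl fun q _ => ?_
      rw [show i + 1 + 1 + q = i + 1 + q + 1 by ring]

end Det

end

/-! ### The scalar chain -/

section

section ScalarChain

variable {k : Type*} [Field k] {A : Type*} [Ring A] [Algebra k A]

/-- The chain with scalar coefficients. -/
def scalarChain (E : ℕ → ℕ → A) (c : ℕ → k) : ℕ → ℕ → A :=
  ringChain E fun o => algebraMap k A (c o)

theorem scalarChain_zero (E : ℕ → ℕ → A) (c : ℕ → k) (q : ℕ) :
    scalarChain E c 0 q = if q = 0 then 1 else 0 := rfl

theorem scalarChain_succ (E : ℕ → ℕ → A) (c : ℕ → k) (o q : ℕ) :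
    scalarChain E c (o + 1) q = E q o * scalarChain E c o o + c o • scalarChain E c o q := by
  rw [scalarChain, ringChain_succ, ← Algebra.commutes, ← Algebra.smul_def]

section Commutation

variable {E : ℕ → ℕ → A} {B : ℕ}
  (hE : ∀ x y u q, y < x → x ≤ u → u < q → q ≤ B →
    E q u * E x y = E x y * E q u + if u = x then E q y else 0)
include hE

/-- The commutator of `e_{q,u}` with the part of the chain that ends at `u` extends the last step to
`q`. -/
theorem mul_scalarChain (c : ℕ → k) {u q : ℕ} (huq : u < q) (hq : q ≤ B) (i x : ℕ) (hix : i ≤ x)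
    (hxu : x ≤ u) : E q u * scalarChain E c i x
      = scalarChain E c i x * E q u + if u = x then scalarChain E c i q else 0 := by
  induction i generalizing x with
  | zero =>
    rw [scalarChain_zero, scalarChain_zero, if_neg (by omega : ¬ q = 0)]
    split_ifs <;> simp
  | succ i ih =>
    rw [scalarChain_succ, scalarChain_succ, mul_add, ← mul_assoc, hE x i u q hix hxu huq hq, add_mul,
      mul_assoc, ih i le_rfl (by omega), if_neg (by omega : ¬ u = i), mul_smul_comm,
      ih x (by omega) hxu, add_mul, smul_mul_assoc]
    split_ifs
    · rw [smul_add, add_zero, mul_assoc]; abel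
    · rw [zero_mul, add_zero, add_zero, add_zero, add_zero, mul_assoc]

/-- The chain also satisfies the recursion with multiplication from the right and with all
coefficients raised by `1`. -/
theorem scalarChain_succ' (c : ℕ → k) {o q : ℕ} (hoq : o < q) (hq : q ≤ B) :
    scalarChain E c (o + 1) q
      = scalarChain E c o o * E q o + (c o + 1) • scalarChain E c o q := by
  rw [scalarChain_succ, mul_scalarChain hE c hoq hq o o le_rfl le_rfl, if_pos rfl, add_smul, one_smul]
  abel

end Commutation

/-- A chain as a sum over the last node `o - 1 - t` of its paths below `o`. -/
theorem chain_expand {W T : ℕ → ℕ → A} {d : ℕ → k} {B : ℕ} (h0 : ∀ q, 0 < q → W 0 q = 0)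
    (hW : ∀ o q, o < q → q ≤ B → W (o + 1) q = T q o + d o • W o q) (o q : ℕ) (hoq : o ≤ q)
    (hq : q ≤ B) (hq0 : 0 < q) :
    W o q = ∑ t ∈ Finset.range o, (∏ p ∈ Finset.range t, d (o - 1 - p)) • T q (o - 1 - t) := by
  induction o with
  | zero => rw [h0 q hq0]; simp
  | succ o ih =>
    rw [hW o q hoq hq, ih (by omega), Finset.sum_range_succ', Finset.smul_sum, add_comm]
    congr 1
    · refine Finset.sum_congr rfl fun t _ => ?_
      rw [Finset.prod_range_succ', smul_smul, mul_comm, show o + 1 - 1 - (t + 1) = o - 1 - t by omega]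
      congr 2
      refine Finset.prod_congr rfl fun p _ => ?_
      rw [show o + 1 - 1 - (p + 1) = o - 1 - p by omega]
    · simp

theorem chain_expand_fin {W T : ℕ → ℕ → A} {d : ℕ → k} {B : ℕ} (h0 : ∀ q, 0 < q → W 0 q = 0)
    (hW : ∀ o q, o < q → q ≤ B → W (o + 1) q = T q o + d o • W o q) (l q : ℕ) (hlq : l < q)
    (hq : q ≤ B) : W (l + 1) q
      = ∑ j : Fin (l + 1), (∏ p ∈ Finset.range j.rev, d (l - p)) • T q j := by
  rw [chain_expand h0 hW (l + 1) q hlq hq (by omega), Finset.sum_range, ← Equiv.sum_comp Fin.revPerm]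
  refine Finset.sum_congr rfl fun j _ => ?_
  rw [Fin.revPerm_apply, show l + 1 - 1 - (j.rev : ℕ) = j by rw [Fin.val_rev]; omega,
    Nat.add_sub_cancel]

/-- The paths from `0` to `a + s` are cut at the node `a + t` where they first reach `a` or pass it; the
part after the cut contributes `V t`.  The bilinear map `β` is the multiplication, in one of the two
orders.  The induction moves the cut down from `a + s`. -/
theorem chain_split {W T : ℕ → ℕ → A} {d : ℕ → k} {a s : ℕ} (β : A →ₗ[k] A →ₗ[k] A) {V : ℕ → A}
    {S : ℕ → ℕ → A} (hW : ∀ o q, o < q → q ≤ a + s → W (o + 1) q = T q o + d o • W o q)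
    (hVs : ∀ x, β (V s) x = x)
    (hV : ∀ i < s, V i = ∑ q ∈ Finset.range (s - i),
      (∏ p ∈ Finset.range q, d (a + (i + 1 + p))) • S i (i + 1 + q))
    (hβ : ∀ i q, i < q → q ≤ s → β (V q) (T (a + q) (a + i)) = β (S i q) (W (a + i) (a + i)))
    (j : ℕ) (hj : j ≤ s) :
    W (a + s) (a + s) = ∑ t ∈ Finset.range (j + 1), (∏ p ∈ Finset.range t, d (a + (s - j + p))) •
      β (V (s - j + t)) (W (a + (s - j)) (a + (s - j + t))) := by
  induction j with
  | zero => simp [hVs]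
  | succ j ih =>
    have h1 : s - j = s - (j + 1) + 1 := by omega
    rw [ih (by omega), Finset.sum_range_succ' _ (j + 1)]
    have h2 : ∀ t ∈ Finset.range (j + 1), (∏ p ∈ Finset.range t, d (a + (s - j + p))) •
          β (V (s - j + t)) (W (a + (s - j)) (a + (s - j + t)))
        = (∏ p ∈ Finset.range t, d (a + (s - (j + 1) + 1 + p))) •
            β (S (s - (j + 1)) (s - (j + 1) + 1 + t)) (W (a + (s - (j + 1))) (a + (s - (j + 1))))
          + (∏ p ∈ Finset.range (t + 1), d (a + (s - (j + 1) + p))) •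
            β (V (s - (j + 1) + (t + 1))) (W (a + (s - (j + 1))) (a + (s - (j + 1) + (t + 1)))) := by
      intro t ht
      rw [Finset.mem_range] at ht
      rw [h1, ← add_assoc a, hW _ _ (by omega) (by omega), map_add, hβ _ _ (by omega) (by omega),
        map_smul, smul_add, smul_smul, Finset.prod_range_succ']
      simp only [add_zero, show ∀ p, s - (j + 1) + 1 + p = s - (j + 1) + (p + 1) by intro p; ring]
    rw [Finset.sum_congr rfl h2, Finset.sum_add_distrib, add_comm]
    congr 1
    rw [Finset.prod_range_zero, one_smul, add_zero, hV _ (by omega), map_sum, LinearMap.sum_apply,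
      show s - (s - (j + 1)) = j + 1 by omega]
    refine Finset.sum_congr rfl fun t _ => ?_
    rw [map_smul, LinearMap.smul_apply]

end ScalarChain

variable {k : Type*} [Field k] {m n : ℕ}

theorem nodeUnit_mul (r : Fin m) (s : Fin n) (x y u q : ℕ) (hyx : y < x) (hxu : x ≤ u)
    (huq : u < q) (hq : q ≤ m - r + s) :
    nodeUnit k n r q u * nodeUnit k n r x y
      = nodeUnit k n r x y * nodeUnit k n r q u + if u = x then nodeUnit k n r q y else 0 := by
  have hr := r.2
  have hs := s.2
  rw [matrixUnits_nodeUnit (k := k) (n := n) r q u x y (by omega) (by omega) (by omega) (by omega),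
    if_neg (by omega : ¬ y = q), smul_zero, sub_zero]
  have : superSign k (parity m n (node n r q) + parity m n (node n r u))
      (parity m n (node n r x) + parity m n (node n r y)) = 1 := by
    simp only [parity]
    rw [val_node r (by omega), val_node r (by omega), val_node r (by omega), val_node r (by omega)]
    by_cases h : (r : ℕ) + x < m
    · rw [if_pos h, if_pos (show (r : ℕ) + y < m by omega), add_zero, superSign_zero_right]
    · rw [if_neg (show ¬ (r : ℕ) + q < m by omega), if_neg (show ¬ (r : ℕ) + u < m by omega),
        CharTwo.add_self_eq_zero, superSign_zero_left]
  rw [this, one_smul]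

/-! ### The determinants of the matrices -/

theorem castAdd_plusIdx (r : Fin m) (j : Fin (m - 1 - r + 1)) :
    Fin.castAdd n (plusIdx r j) = node n r j :=
  Fin.ext (by rw [val_node r (by omega)]; rfl)

theorem natAdd_minusIdx (r : Fin m) (s : Fin n) (i : Fin ((s : ℕ) + 1)) :
    Fin.natAdd m (minusIdx s i) = node n r (m - r + i) := by
  have hr := r.2
  have hi := i.2
  have hs := s.2
  refine Fin.ext ?_
  rw [val_node r (by omega)]
  simp only [Fin.val_natAdd, minusIdx]
  omega

theorem oddVector_eq (r : Fin m) (s : Fin n) (j : Fin (m - 1 - r + 1)) (i : Fin ((s : ℕ) + 1)) :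
    oddVector k r s j i = nodeUnit k n r (m - r + i) j := by
  rw [oddVector, castAdd_plusIdx, natAdd_minusIdx r]; rfl

theorem minusMatrix_eq (r : Fin m) (s : Fin n) (b : Fin (s : ℕ) → k) (d : ℕ → k)
    (hb : ∀ l, b l = -d (m - r + l)) :
    minusMatrix (m := m) s b = lowerHess (fun i l => nodeUnit k n r (m - r + i) (m - r + l))
      (fun l => -d (m - r + l)) s := by
  ext i l
  simp only [minusMatrix, lowerHess, Matrix.of_apply, natAdd_minusIdx r, hb]
  rfl

theorem plusMatrix_submatrix_rev (r : Fin m) (a : Fin (m - 1 - r) → k) (d : ℕ → k)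
    (ha : ∀ l, a l = d (l + 1)) :
    (plusMatrix (n := n) r a).submatrix Fin.rev Fin.rev
      = lowerHess (fun i l => nodeUnit k n r (m - 1 - r - l) (m - 1 - r - i))
        (fun l => -d (m - 1 - r - l)) (m - 1 - r) := by
  ext i l
  have hi := i.2
  have hl := l.2
  simp only [plusMatrix, lowerHess, Matrix.of_apply, Matrix.submatrix_apply, castAdd_plusIdx, ha,
    Fin.val_rev, Fin.val_succ]
  have h1 : m - 1 - r - (l + 1 : ℕ) + 1 = m - 1 - r - l := by omega
  have h2 : m - 1 - r + 1 - (i + 1 : ℕ) = m - 1 - r - i := by omega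
  rw [h1, h2]
  by_cases h3 : (l : ℕ) < i
  · rw [if_pos (by omega), if_pos h3]; rfl
  · rw [if_neg (by omega), if_neg h3]
    by_cases h4 : (i : ℕ) = l
    · rw [if_pos (by omega), if_pos h4]
    · rw [if_neg (by omega), if_neg h4]

theorem delRow_submatrix_rev {R : Type*} {l : ℕ} (j : Fin (l + 1)) (B : Matrix (Fin (l + 1)) (Fin l) R) :
    (delRow j B).submatrix Fin.rev Fin.rev = delRow j.rev (B.submatrix Fin.rev Fin.rev) := by
  ext x y
  simp [delRow, Fin.succAbove_rev_right]

theorem neg_one_pow_mul_prod_neg (d : ℕ → k) (q : ℕ) :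
    (-1) ^ q * ∏ p ∈ Finset.range q, -d p = ∏ p ∈ Finset.range q, d p := by
  rw [Finset.prod_neg, Finset.card_range, ← mul_assoc, ← mul_pow, neg_one_mul, neg_neg, one_pow, one_mul]

section PlusMinus

variable (r : Fin m) {d : ℕ → k}

theorem detLR_delRow_plusMatrix {a : Fin (m - 1 - r) → k} (ha : ∀ l, a l = d (l + 1))
    (Y : ℕ → U k m n) (h0 : Y 0 = 1)
    (hY : ∀ j, 0 < j → j ≤ m - 1 - r → Y j = ∑ t ∈ Finset.range j,
      (∏ p ∈ Finset.range t, d (j - 1 - p)) • (Y (j - 1 - t) * nodeUnit k n r j (j - 1 - t)))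
    (j : Fin (m - 1 - r + 1)) :
    detLR (delRow j (plusMatrix r a))
      = ((-1) ^ (j.rev : ℕ) * ∏ p ∈ Finset.range j.rev, d (m - 1 - r - p)) • Y j := by
  rw [detLR_eq_detRL_rev, delRow_submatrix_rev, plusMatrix_submatrix_rev r a d ha,
    detRL_delRow_lowerHess _ _ _ (fun i => Y (m - 1 - r - i))]
  · rw [Finset.prod_neg, Finset.card_range, show m - 1 - r - (j.rev : ℕ) = j by
      rw [Fin.val_rev]; omega]
  · simp only [Nat.sub_self, h0]
  · intro i hi
    rw [hY _ (by omega) (by omega)]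
    refine Finset.sum_congr rfl fun q _ => ?_
    rw [neg_one_pow_mul_prod_neg]
    simp only [Nat.sub_sub, add_assoc]

theorem detRL_delRow_plusMatrix {a : Fin (m - 1 - r) → k} (ha : ∀ l, a l = d (l + 1))
    (Y : ℕ → U k m n) (h0 : Y 0 = 1)
    (hY : ∀ j, 0 < j → j ≤ m - 1 - r → Y j = ∑ t ∈ Finset.range j,
      (∏ p ∈ Finset.range t, d (j - 1 - p)) • (nodeUnit k n r j (j - 1 - t) * Y (j - 1 - t)))
    (j : Fin (m - 1 - r + 1)) :
    detRL (delRow j (plusMatrix r a))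
      = ((-1) ^ (j.rev : ℕ) * ∏ p ∈ Finset.range j.rev, d (m - 1 - r - p)) • Y j := by
  rw [detRL_eq_detLR_rev, delRow_submatrix_rev, plusMatrix_submatrix_rev r a d ha,
    detLR_delRow_lowerHess _ _ _ (fun i => Y (m - 1 - r - i))]
  · rw [Finset.prod_neg, Finset.card_range, show m - 1 - r - (j.rev : ℕ) = j by
      rw [Fin.val_rev]; omega]
  · simp only [Nat.sub_self, h0]
  · intro i hi
    rw [hY _ (by omega) (by omega)]
    refine Finset.sum_congr rfl fun q _ => ?_
    rw [neg_one_pow_mul_prod_neg]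
    simp only [Nat.sub_sub, add_assoc]

variable (s : Fin n)

theorem detRL_delRow_minusMatrix {b : Fin (s : ℕ) → k} (hb : ∀ l, b l = -d (m - r + l))
    (V : ℕ → U k m n) (hs : V s = 1)
    (hV : ∀ i < (s : ℕ), V i = ∑ q ∈ Finset.range (s - i),
      (∏ p ∈ Finset.range q, d (m - r + (i + 1 + p))) •
        (V (i + 1 + q) * nodeUnit k n r (m - r + (i + 1 + q)) (m - r + i)))
    (i : Fin ((s : ℕ) + 1)) :
    detRL (delRow i (minusMatrix s b))
      = ((-1) ^ (i : ℕ) * ∏ p ∈ Finset.range i, d (m - r + p)) • V i := by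
  rw [minusMatrix_eq r s b d hb, detRL_delRow_lowerHess _ _ _ V hs, Finset.prod_neg, Finset.card_range]
  intro i hi
  rw [hV i hi]
  simp only [neg_one_pow_mul_prod_neg]

theorem detLR_delRow_minusMatrix {b : Fin (s : ℕ) → k} (hb : ∀ l, b l = -d (m - r + l))
    (V : ℕ → U k m n) (hs : V s = 1)
    (hV : ∀ i < (s : ℕ), V i = ∑ q ∈ Finset.range (s - i),
      (∏ p ∈ Finset.range q, d (m - r + (i + 1 + p))) •
        (nodeUnit k n r (m - r + (i + 1 + q)) (m - r + i) * V (i + 1 + q)))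
    (i : Fin ((s : ℕ) + 1)) :
    detLR (delRow i (minusMatrix s b))
      = ((-1) ^ (i : ℕ) * ∏ p ∈ Finset.range i, d (m - r + p)) • V i := by
  rw [minusMatrix_eq r s b d hb, detLR_delRow_lowerHess _ _ _ V hs, Finset.prod_neg, Finset.card_range]
  intro i hi
  rw [hV i hi]
  simp only [neg_one_pow_mul_prod_neg]

end PlusMinus

end

/-! ### The values of the coefficients -/

section

variable {k : Type*} [Field k] {m n : ℕ}

/-- The coefficients of the chain at a weight. -/
def chainValue (lam : Fin (m + n) → k) (r : Fin m) (o : ℕ) : k :=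
  MvPolynomial.eval lam (chainPoly k n r o)

theorem chainValue_eq (lam : Fin (m + n) → k) (r : Fin m) (o : ℕ) :
    chainValue lam r o = sgnNat k m (r + o) * (lam (node n r 0)
      + ∑ l ∈ Finset.Ioo (r : ℕ) (r + o), sgnNat k m l) - lam (node n r o) := by
  simp [chainValue, chainPoly, MvPolynomial.smul_eval, mul_add]

theorem form_wt_self (α : PosRoot m n) :
    form (wt k α) (wt k α) = sgn k m n α.1.1 + sgn k m n α.1.2 := by
  rw [form_wt]
  simp [wt, α.2.ne, α.2.ne']

theorem corootPairing_eq (lam : Fin (m + n) → k) (α : PosRoot m n) :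
    corootPairing lam α = 2 / (sgn k m n α.1.1 + sgn k m n α.1.2) * form lam (wt k α) := by
  rw [corootPairing, form_wt_self, form, form, Finset.mul_sum]
  refine Finset.sum_congr rfl fun i _ => ?_
  rw [Pi.smul_apply, smul_eq_mul]
  ring

theorem form_add_rho [CharZero k] (lam : Fin (m + n) → k) (α : PosRoot m n) :
    form (lam + rho k m n) (wt k α) = sgn k m n α.1.1 * lam α.1.1 - sgn k m n α.1.2 * lam α.1.2
      + (1 / 2 * (sgn k m n α.1.1 + sgn k m n α.1.2)
        + ∑ l ∈ Finset.Ioo (α.1.1 : ℕ) α.1.2, sgnNat k m l) := by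
  rw [form_add_left, form_wt, form_rho_wt]

theorem aCoeff_eq [CharZero k] (lam : Fin (m + n) → k) (r : Fin m) (l : Fin (m - 1 - r)) :
    aCoeff lam r l = chainValue lam r (l + 1) + 1 := by
  have hl := l.2
  have h1 : (sigmaRoot (n := n) r (plusIdx r l.succ) (lt_plusIdx_succ r l)).1
      = (node n r 0, node n r (l + 1)) :=
    Prod.ext (node_zero r).symm (castAdd_plusIdx r l.succ)
  rw [aCoeff, corootPairing_eq, form_add_rho, chainValue_eq, h1, sgn_node r (by omega),
    sgn_node r (by omega), val_node r (by omega), val_node r (by omega)]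
  have h2 : sgnNat k m (r + 0) = 1 := by simp [sgnNat]
  have h3 : sgnNat k m (r + (l + 1)) = 1 := by rw [sgnNat, if_pos (by omega)]
  rw [h2, h3, add_zero]
  ring

theorem bCoeff_eq [CharZero k] {lam : Fin (m + n) → k} (r : Fin m) (s : Fin n)
    (hlam : lam ∈ hyperplane k (gammaRoot r s)) (i : Fin (s : ℕ)) :
    bCoeff lam s i = -chainValue lam r (m - r + i) := by
  have hr := r.2
  have hs := s.2
  have hi := i.2
  have h1 : (tauRoot (m := m) (minusIdx s i.castSucc) s (minusIdx_castSucc_lt s i)).1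
      = (node n r (m - r + i), node n r (m - r + s)) := by
    refine Prod.ext (natAdd_minusIdx r s i.castSucc) (natAdd_minusIdx r s (Fin.last _))
  have h2 : form (lam + rho k m n) (wt k (gammaRoot r s)) = 0 := by
    have : form (lam + rho k m n) (wt k (gammaRoot r s)) = _ / 2 := hlam
    rw [this, form_gammaRoot, zero_div]
  rw [form_add_rho, gammaRoot_eq] at h2
  rw [bCoeff, corootPairing_eq, form_add_rho, chainValue_eq, h1]
  simp only at h2 ⊢
  rw [sgn_node r (by omega), sgn_node r (by omega), val_node r (by omega), val_node r (by omega)]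
    at h2 ⊢
  have h3 : sgnNat k m (r + 0) = 1 := by simp [sgnNat]
  have h4 : ∀ i, sgnNat k m (r + (m - r + i)) = -1 := fun i => by rw [sgnNat, if_neg (by omega)]
  have h5 : Finset.Ioo (r : ℕ) (r + (m - r + s)) = Finset.Ioo (r : ℕ) (r + (m - r + i))
      ∪ insert (r + (m - r + i : ℕ)) (Finset.Ioo (r + (m - r + i : ℕ)) (r + (m - r + s))) := by
    ext x; simp only [Finset.mem_Ioo, Finset.mem_union, Finset.mem_insert]; omega
  rw [add_zero, h5, Finset.sum_union, Finset.sum_insert (by simp), h4, h4] at h2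
  · have h3' : sgnNat k m r = 1 := h3
    rw [h4, h4]
    rw [h3'] at h2
    field_simp
    linear_combination 2 * h2
  · rw [Finset.disjoint_left]
    intro x
    simp only [Finset.mem_Ioo, Finset.mem_insert]
    omega

/-! ### The two formulas -/

section Formulas

variable (r : Fin m) (s : Fin n) (c : ℕ → k)

theorem scalarChain_pos (E : ℕ → ℕ → U k m n) (q : ℕ) (hq : 0 < q) : scalarChain E c 0 q = 0 := by
  rw [scalarChain_zero, if_neg hq.ne']

/-- The chain as a sum over the odd steps of its paths, with the even part of the path to the right of
the odd step, and the odd part to the right of the even one. -/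
theorem scalarChain_eq_sum_oddVector_mul {a : Fin (m - 1 - r) → k} (ha : ∀ l, a l = c (l + 1))
    {b : Fin (s : ℕ) → k} (hb : ∀ l, b l = -(c (m - r + l) + 1)) :
    scalarChain (nodeUnit k n r) c (m - r + s) (m - r + s)
      = ∑ j : Fin (m - 1 - r + 1), ∑ i : Fin ((s : ℕ) + 1),
          oddVector k r s j i * (-1) ^ (((i : ℕ) + 1) + ((j : ℕ) + 1) + ((r : ℕ) + 1) + m) *
            detRL (delRow j (plusMatrix r a)) * detLR (delRow i (minusMatrix s b)) := by
  have hr := r.2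
  set E := nodeUnit k n r
  set Z := scalarChain E c
  have hcomm := nodeUnit_mul (k := k) r s
  obtain ⟨V, hVs, hV⟩ := exists_hess_recursion (s : ℕ)
    (fun i q => ∏ p ∈ Finset.range q, (c (m - r + (i + 1 + p)) + 1))
    (fun i q => AddMonoidHom.mulLeft (E (m - r + (i + 1 + q)) (m - r + i)))
  simp only [AddMonoidHom.coe_mulLeft] at hV
  have h1 := chain_split (W := Z) (T := fun q o => Z o o * E q o) (d := fun o => c o + 1)
    (a := m - r) (s := s) (V := V) (LinearMap.mul k (U k m n)).flip
    (S := fun i q => E (m - r + q) (m - r + i) * V q)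
    (fun o q hoq hq => scalarChain_succ' hcomm c hoq hq) (fun x => by simp [hVs]) hV
    (fun i q _ _ => by simp [mul_assoc]) s le_rfl
  rw [Nat.sub_self, Finset.sum_range] at h1
  rw [h1, Finset.sum_comm]
  refine Finset.sum_congr rfl fun i _ => ?_
  have h2 := detLR_delRow_minusMatrix r (d := fun o => c o + 1) s hb V hVs hV i
  have hexp := fun o q hoq hq hq0 => chain_expand (W := Z) (T := fun q o => E q o * Z o o) (d := c)
    (B := m - r + s) (scalarChain_pos c E) (fun o q _ _ => scalarChain_succ E c o q) o q hoq hq hq0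
  rw [LinearMap.flip_apply, LinearMap.mul_apply', zero_add, add_zero,
    show Z (m - r) = Z (m - 1 - r + 1) by rw [show m - 1 - r + 1 = m - r by omega],
    chain_expand_fin (W := Z) (T := fun q o => E q o * Z o o) (d := c) (B := m - r + s)
      (scalarChain_pos c E) (fun o q _ _ => scalarChain_succ E c o q) _ _ (by omega) (by omega),
    Finset.sum_mul, Finset.smul_sum]
  refine Finset.sum_congr rfl fun j _ => ?_
  rw [detRL_delRow_plusMatrix r ha (fun j => Z j j) rfl
    (fun j hj hjl => hexp j j le_rfl (by omega) hj) j, h2, oddVector_eq]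
  have h4 : ((-1) ^ (((i : ℕ) + 1) + ((j : ℕ) + 1) + ((r : ℕ) + 1) + m) : U k m n)
      = algebraMap k _ ((-1) ^ (j.rev : ℕ) * (-1) ^ (i : ℕ)) := by
    rw [← pow_add, map_pow, map_neg, map_one]
    refine neg_one_pow_congr ?_
    have : (j.rev : ℕ) + j = m - 1 - r := by rw [Fin.val_rev]; omega
    have h5 : ((i : ℕ) + 1) + ((j : ℕ) + 1) + ((r : ℕ) + 1) + m = (j.rev + i) + 2 * (j + r + 2) := by
      omega
    rw [h5, Nat.even_add]
    simp
  rw [h4, ← Algebra.commutes, ← Algebra.smul_def]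
  have hsq : ∀ a : ℕ, (-1 : k) ^ a * (-1) ^ a = 1 := fun a => by rw [← mul_pow]; simp
  simp only [smul_mul_assoc, mul_smul_comm, smul_smul, mul_assoc]
  congr 1
  simp only [zero_add]
  generalize ∏ x ∈ Finset.range (i : ℕ), (c (m - r + x) + 1) = P
  generalize ∏ x ∈ Finset.range (j.rev : ℕ), c (m - 1 - r - x) = Q
  linear_combination -(P * Q * ((-1) ^ (j.rev : ℕ) * (-1) ^ (j.rev : ℕ))) * hsq i
    - P * Q * hsq j.rev

/-- The same with the even part to the left of the odd step, and the odd part to the left of that. -/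
theorem scalarChain_eq_sum_mul_oddVector {a : Fin (m - 1 - r) → k} (ha : ∀ l, a l = c (l + 1) + 1)
    {b : Fin (s : ℕ) → k} (hb : ∀ l, b l = -c (m - r + l)) :
    scalarChain (nodeUnit k n r) c (m - r + s) (m - r + s)
      = (-1) ^ (m + ((r : ℕ) + 1)) * ∑ j : Fin (m - 1 - r + 1), ∑ i : Fin ((s : ℕ) + 1),
          (-1) ^ (((i : ℕ) + 1) + ((j : ℕ) + 1)) *
            detLR (delRow j (plusMatrix r a)) * detRL (delRow i (minusMatrix s b)) *
            oddVector k r s j i := by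
  have hr := r.2
  set E := nodeUnit k n r
  set Z := scalarChain E c
  have hcomm := nodeUnit_mul (k := k) r s
  obtain ⟨V, hVs, hV⟩ := exists_hess_recursion (s : ℕ)
    (fun i q => ∏ p ∈ Finset.range q, c (m - r + (i + 1 + p)))
    (fun i q => AddMonoidHom.mulRight (E (m - r + (i + 1 + q)) (m - r + i)))
  simp only [AddMonoidHom.coe_mulRight] at hV
  -- the even and the odd parts commute
  have hVZ : ∀ j < m - r, ∀ d, ∀ t, (s : ℕ) - t = d → t ≤ s → Commute (V t) (Z j j) := by
    intro j hj d
    induction d using Nat.strong_induction_on with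
    | _ d ih =>
      intro t ht hts
      rcases hts.eq_or_lt with rfl | hts
      · rw [hVs]; exact Commute.one_left _
      · rw [hV t hts]
        refine Commute.sum_left _ _ _ fun q hq => Commute.smul_left (Commute.mul_left ?_ ?_) _
        · rw [Finset.mem_range] at hq
          exact ih _ (by omega) _ rfl (by omega)
        · rw [Finset.mem_range] at hq
          have := mul_scalarChain hcomm c (u := m - r + t) (q := m - r + (t + 1 + q)) (by omega)
            (by omega) j j le_rfl (by omega)
          rwa [if_neg (by omega), add_zero] at this
  have h1 := chain_split (W := Z) (T := fun q o => E q o * Z o o) (d := c)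
    (a := m - r) (s := s) (V := V) (LinearMap.mul k (U k m n))
    (S := fun i q => V q * E (m - r + q) (m - r + i))
    (fun o q _ _ => scalarChain_succ E c o q) (fun x => by simp [hVs]) hV
    (fun i q _ _ => by simp [mul_assoc]) s le_rfl
  rw [Nat.sub_self, Finset.sum_range] at h1
  rw [h1, Finset.sum_comm, Finset.mul_sum]
  refine Finset.sum_congr rfl fun i _ => ?_
  have h2 := detRL_delRow_minusMatrix r s hb V hVs hV i
  have hexp := fun o q hoq hq hq0 => chain_expand (W := Z) (T := fun q o => Z o o * E q o)
    (d := fun o => c o + 1) (B := m - r + s) (scalarChain_pos c E)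
    (fun o q hoq hq => scalarChain_succ' hcomm c hoq hq) o q hoq hq hq0
  rw [LinearMap.mul_apply', zero_add, add_zero,
    show Z (m - r) = Z (m - 1 - r + 1) by rw [show m - 1 - r + 1 = m - r by omega],
    chain_expand_fin (W := Z) (T := fun q o => Z o o * E q o) (d := fun o => c o + 1)
      (B := m - r + s) (scalarChain_pos c E) (fun o q hoq hq => scalarChain_succ' hcomm c hoq hq)
      _ _ (by omega) (by omega),
    Finset.mul_sum, Finset.smul_sum, Finset.mul_sum]
  refine Finset.sum_congr rfl fun j _ => ?_
  rw [detLR_delRow_plusMatrix r (d := fun o => c o + 1) ha (fun j => Z j j) rfl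
    (fun j hj hjl => hexp j j le_rfl (by omega) hj) j, h2, oddVector_eq]
  have h4 : ((-1) ^ (m + ((r : ℕ) + 1)) * (-1) ^ (((i : ℕ) + 1) + ((j : ℕ) + 1)) : U k m n)
      = algebraMap k _ ((-1) ^ (j.rev : ℕ) * (-1) ^ (i : ℕ)) := by
    rw [← pow_add, ← pow_add, map_pow, map_neg, map_one]
    refine neg_one_pow_congr ?_
    have : (j.rev : ℕ) + j = m - 1 - r := by rw [Fin.val_rev]; omega
    have h5 : m + ((r : ℕ) + 1) + (((i : ℕ) + 1) + ((j : ℕ) + 1)) = (j.rev + i) + 2 * (j + r + 2) := by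
      omega
    rw [h5, Nat.even_add]
    simp
  have hsq : ∀ a : ℕ, (-1 : k) ^ a * (-1) ^ a = 1 := fun a => by rw [← mul_pow]; simp
  rw [mul_assoc ((-1) ^ (((i : ℕ) + 1) + ((j : ℕ) + 1))),
    mul_assoc ((-1) ^ (((i : ℕ) + 1) + ((j : ℕ) + 1))), ← mul_assoc ((-1) ^ (m + ((r : ℕ) + 1))), h4,
    ← Algebra.smul_def]
  simp only [smul_mul_assoc, mul_smul_comm, smul_smul]
  rw [← mul_assoc (V i), (hVZ j (by omega) _ i rfl (by omega)).eq]
  congr 1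
  simp only [zero_add]
  generalize ∏ x ∈ Finset.range (i : ℕ), c (m - r + x) = P
  generalize ∏ x ∈ Finset.range (j.rev : ℕ), (c (m - 1 - r - x) + 1) = Q
  linear_combination -(P * Q * ((-1) ^ (j.rev : ℕ) * (-1) ^ (j.rev : ℕ))) * hsq i
    - P * Q * hsq j.rev

end Formulas

end

end GLSuper

end

theorem theorem8p1 (k : Type*) [Field k] [IsAlgClosed k] [CharZero k] (m n : ℕ)
    (L : List (GLSuper.PosRoot m n)) (hnodup : L.Nodup) (hall : ∀ α, α ∈ L)
    (r : Fin m) (s : Fin n) :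
    (∃ H : GLSuper.RootPartition (GLSuper.gammaRoot r s) →₀ MvPolynomial (Fin (m + n)) k,
      GLSuper.IsSapovalov L (GLSuper.gammaRoot r s) H) ∧
    ∀ H : GLSuper.RootPartition (GLSuper.gammaRoot r s) →₀ MvPolynomial (Fin (m + n)) k,
      GLSuper.IsSapovalov L (GLSuper.gammaRoot r s) H →
      ∀ lam ∈ GLSuper.hyperplane k (GLSuper.gammaRoot r s),
        GLSuper.sapEval L H lam =
          (-1) ^ (m + ((r : ℕ) + 1)) *
            ∑ j : Fin (m - 1 - r + 1), ∑ i : Fin ((s : ℕ) + 1),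
              (-1) ^ (((i : ℕ) + 1) + ((j : ℕ) + 1)) *
                GLSuper.detLR (GLSuper.delRow j (GLSuper.Aplus lam r)) *
                GLSuper.detRL (GLSuper.delRow i (GLSuper.Aminus lam s)) *
                GLSuper.oddVector k r s j i ∧
        GLSuper.sapEval L H lam =
          ∑ j : Fin (m - 1 - r + 1), ∑ i : Fin ((s : ℕ) + 1),
            GLSuper.oddVector k r s j i *
              (-1) ^ (((i : ℕ) + 1) + ((j : ℕ) + 1) + ((r : ℕ) + 1) + m) *
              GLSuper.detRL (GLSuper.delRow j (GLSuper.Bplus lam r)) *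
              GLSuper.detLR (GLSuper.delRow i (GLSuper.Bminus lam s)) := by
  refine ⟨(GLSuper.exists_isSapovalov 0 r hnodup hall s).imp fun _ h => h.1, fun H hH lam hlam => ?_⟩
  obtain ⟨H', hH', hval⟩ := GLSuper.exists_isSapovalov lam r hnodup hall s
  rw [hH.sapEval_eq hnodup hall hH' hlam, hval]
  have ha := GLSuper.aCoeff_eq lam r
  have hb := GLSuper.bCoeff_eq r s hlam
  exact ⟨GLSuper.scalarChain_eq_sum_mul_oddVector r s (GLSuper.chainValue lam r) ha hb,
    GLSuper.scalarChain_eq_sum_oddVector_mul r s (GLSuper.chainValue lam r)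
      (fun l => by rw [ha, add_sub_cancel_right]) (fun l => by rw [hb]; ring)⟩
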